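/- **Setting.** Let $c>0$, $t>0$, $x\in\mathbb R$, $\Delta\in\mathbb R$, put $\xi=\frac{x}{12t}$ and assume $-\frac{c^2}{2}<\xi<\frac{c^2}{3}$. Let $a=a(\xi)\in(0,c)$ be such that $$\int_0^{ia}\Big(k^2+\xi+\tfrac{c^2-a^2}{2}\Big)\sqrt{\tfrac{k^2+a^2}{k^2+c^2}}\,dk=0 .$$ Let $\sqrt{\tfrac{k^2+a^2}{k^2+c^2}}$ be the standard branch, and let $w(k)=\sqrt{(k^2+a^2)(k^2+c^2)}$ be the branch that is holomorphic off $[ic,ia]\cup[-ia,-ic]$ with $w(0)>0$. The interval $[ic,-ic]$ is oriented top-down, so that $+$ denotes limits from $\operatorname{Re}k>0$. Put $$B=-2g_+(ia),\qquad g(k)=12\int_{ic}^k\Big(s^2+\xi+\tfrac{c^2-a^2}{2}\Big)\sqrt{\tfrac{s^2+a^2}{s^2+c^2}}\,ds,\qquad \Lambda=tB+\Delta .$$ *Model problem.* A model solution is a row vector $m=(m_1,m_2)$, holomorphic in $\mathbb C\setminus[ic,-ic]$, with limits $m_\pm$ on $(ic,-ic)\setminus\{\pm ia\}$, such that - $m_+=m_-\begin{pmatrix}0&i\\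 i&0\end{pmatrix}$ on $(ic,ia)$, $\;m_+=m_-\begin{pmatrix}0&-i\\ -i&0\end{pmatrix}$ on $(-ia,-ic)$, and $m_+=m_-\begin{pmatrix}e^{-i\Lambda}&0\\0&e^{i\Lambda}\end{pmatrix}$ on $(ia,-ia)$; - $m_1(-k)=m_2(k)$; - $m(k)\to(1,1)$ as $k\to\infty$; - $m(k)=O(|k-\kappa|^{-1/4})$ as $k\to\kappa$ for $\kappa\in\{\pm ia,\pm ic\}$. *The point $\lambda(x,t)$.* On the elliptic Riemann surface of $\mathcal R(\lambda)=\sqrt{\lambda(\lambda+c^2)(\lambda+a^2)}$, cut along $[-c^2,-a^2]\cup[0,\infty)$, with $\operatorname{Im}\sqrt\lambda\ge 0$ and $\mathcal R(\lambda)\sim\lambda\sqrt\lambda$ at infinity on the upper sheet, let $\hat{\mathbf b}$ surround $[-c^2,-a^2]$ counterclockwise on the upper sheet. Let $\hat{\mathbf a}$ pass along $[-a^2,0]$ in the positive direction on the lower sheet and return on the upper one. Let $d\hat\omega$ be the holomorphic differential with $\int_{\hat{\mathbf a}}d\hat\omega=2\pi i$. Let $d\Omega_1,d\Omega_3$ be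 the differentials whose only pole is at $\infty$, with $\int_{\hat{\mathbf a}}d\Omega_{1}=\int_{\hat{\mathbf a}}d\Omega_{3}=0$ and $$d\Omega_1=\tfrac{i}{2\sqrt\lambda}(1+O(\lambda^{-1}))d\lambda,\qquad d\Omega_3=-\tfrac{3i}{2}\sqrt\lambda\,(1+O(\lambda^{-2}))d\lambda .$$ Put $iV=\int_{\hat{\mathbf b}}d\Omega_1$ and $iW=\int_{\hat{\mathbf b}}d\Omega_3$. Then $\lambda(x,t)\in[-a^2,0]$ is the projection of a point $p$ over the gap $[-a^2,0]$ such that, modulo $2\pi i$ and for some $p_0$ over the gap (integrals taken over the gap), $$\int_{-a^2}^{p_0}d\hat\omega=-i\Delta,\qquad \int_{p_0}^{p}d\hat\omega=-i(Vx-4Wt).$$ *The function $q^{mod}$.* Let $\mathbf a$ run on the upper sheet of the surface of $w$ from $ia$ to $-ia$ and return on the lower sheet. Let $\mathbf b$ surround $ia,ic$ counterclockwise on the upper sheet. Put $\Gamma=\big(\int_{\mathbf a}\frac{d\zeta}{w}\big)^{-1}$, $\tau=\Gamma\int_{\mathbf b}\frac{d\zeta}{w}$, $\theta_3(z\,|\,\tau)=\sum_{n\in\mathbb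 Z}e^{\pi i(n^2\tau+2nz)}$, and, with the complete elliptic integrals $K,E$ of modulus $a/c$, $$q^{mod}(x,t)=8\Gamma^2\frac{d^2}{dv^2}\log\theta_3\Big(v+\frac{tB+\Delta}{2\pi}\,\Big|\,2\tau\Big)\Big|_{v=0}-a^2+c^2\Big(1-2\frac{E(a/c)}{K(a/c)}\Big).$$ **Claim.** A model solution exists, and $\lambda(x,t)$ exists and is unique. For every model solution, the product $p(k)=m_1(k)m_2(k)$ satisfies $$p(k)=\frac{k^2-\lambda(x,t)}{\sqrt{(k^2+a^2)(k^2+c^2)}},\qquad k\in\mathbb C\setminus[ic,-ic].$$ Moreover $p(k)=1+\frac{q^{mod}(x,t)}{2k^2}+O(k^{-4})$ as $k\to\infty$, and the trace formula holds: $$q^{mod}(x,t)=-c^2-a^2-2\lambda(x,t).$$ -/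

import Mathlib

open Complex Filter Topology Asymptotics MeasureTheory Set

namespace KdVShock

noncomputable section

/-! ### Branches of the square roots -/

/-- `√((k² + a²)/(k² + c²))` with the standard branch of the root (cut along the negative
half-axis). It is holomorphic off `[ic, ia] ∪ [-ia, -ic]`. At a point `iy` with `a < y < c` the
principal value taken here is `i √((y² - a²)/(c² - y²))`, which is the limit from the right
(`Re k > 0`), i.e. from the `+` side of the contour `[ic, -ic]` oriented top-down. -/
def sqrtRatio (c a : ℝ) (k : ℂ) : ℂ :=
  (((k ^ 2 + (a : ℂ) ^ 2) / (k ^ 2 + (c : ℂ) ^ 2)) : ℂ) ^ (1 / 2 : ℂ)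

/-- `w(k) = √((k² + c²)(k² + a²))`, the branch holomorphic off `[ic, ia] ∪ [-ia, -ic]` with
`w(0) > 0`. At `iy`, `a < y < c`, the value is again the limit from the right. -/
def w (c a : ℝ) (k : ℂ) : ℂ := (k ^ 2 + (c : ℂ) ^ 2) * sqrtRatio c a k

/-! ### The Whitham parameter and the phase -/

/-- The pull-back by `k = iy` of the differential
`(k² + ξ + (c² - a²)/2) √((k² + a²)/(k² + c²)) dk` (right limits on the cut, for `y > 0`). -/
def phaseIntegrand (c a ξ y : ℝ) : ℂ :=
  ((I * y) ^ 2 + ξ + ((c : ℂ) ^ 2 - (a : ℂ) ^ 2) / 2) * sqrtRatio c a (I * y) * I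

/-- `a = a(ξ)`: the number `a ∈ (0, c)` such that
`∫_0^{ia} (k² + ξ + (c² - a²)/2) √((k² + a²)/(k² + c²)) dk = 0`. -/
def IsWhithamParameter (c ξ a : ℝ) : Prop :=
  0 < a ∧ a < c ∧ ∫ y in (0 : ℝ)..a, phaseIntegrand c a ξ y = 0

/-- The right limit `g₊(ia)` of
`g(k) = 12 ∫_{ic}^k (s² + ξ + (c² - a²)/2) √((s² + a²)/(s² + c²)) ds`. -/
def gPlus (c a ξ : ℝ) : ℂ := 12 * ∫ y in c..a, phaseIntegrand c a ξ y

/-- `B = -2 g₊(ia)`. -/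
def phaseB (c a ξ : ℝ) : ℂ := -2 * gPlus c a ξ

/-- `Λ = t B(ξ) + Δ` with `ξ = x/(12 t)`. -/
def bigLambda (c a x t Δ : ℝ) : ℂ := t * phaseB c a (x / (12 * t)) + Δ

/-! ### The vector model Riemann-Hilbert problem -/

/-- `ℂ ∖ [ic, -ic]`. -/
def cutPlane (c : ℝ) : Set ℂ := {k | ¬ (k.re = 0 ∧ |k.im| ≤ c)}

/-- The jump matrix at the point `iy` of the contour `[ic, -ic]`. -/
def modelJump (a : ℝ) (Λ : ℂ) (y : ℝ) : Matrix (Fin 2) (Fin 2) ℂ :=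
  if a < y then !![0, I; I, 0]
  else if y < -a then !![0, -I; -I, 0]
  else !![exp (-I * Λ), 0; 0, exp (I * Λ)]

/-- `m = (m₁, m₂)` solves the vector model problem. The contour is oriented top-down, so its
`+` side is the side `Re k > 0`. Values of `m` on the contour itself play no role. -/
structure IsModelSolution (c a : ℝ) (Λ : ℂ) (m : ℂ → Fin 2 → ℂ) : Prop where
  holomorphic : DifferentiableOn ℂ m (cutPlane c)
  jump : ∀ y : ℝ, |y| < c → |y| ≠ a → ∃ mp mm : Fin 2 → ℂ,
    Tendsto m (𝓝[{k : ℂ | 0 < k.re}] (I * y)) (𝓝 mp) ∧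
    Tendsto m (𝓝[{k : ℂ | k.re < 0}] (I * y)) (𝓝 mm) ∧
    mp = Matrix.vecMul mm (modelJump a Λ y)
  symmetry : ∀ k ∈ cutPlane c, m (-k) = Matrix.vecMul (m k) !![0, 1; 1, 0]
  normalization : Tendsto m (Bornology.cobounded ℂ) (𝓝 ![1, 1])
  singularity : ∀ κ ∈ ({I * c, I * a, -(I * a), -(I * c)} : Set ℂ),
    m =O[𝓝[cutPlane c] κ] fun k => ‖k - κ‖ ^ (-(1 / 4) : ℝ)

/-! ### The theta-function form of the modulated elliptic wave -/

/-- `∫_𝐚 dζ/w(ζ)`. The cycle runs on the upper sheet from the cut `[ic, ia]` to the cut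
`[-ia, -ic]`, i.e. from `ia` to `-ia`, and returns on the lower sheet, where `w` changes sign. -/
def aCycle (c a : ℝ) : ℂ :=
  (∫ y in a..(-a), I / w c a (I * y)) + ∫ y in (-a)..a, I / (-w c a (I * y))

/-- `Γ = (∫_𝐚 dζ/w(ζ))⁻¹`. -/
def Gam (c a : ℝ) : ℂ := (aCycle c a)⁻¹

/-- `τ = Γ ∫_𝐛 dζ/w(ζ)`, where `𝐛` surrounds `ia, ic` counterclockwise on the upper sheet: up
along the right side of the cut and down along its left side, where `w₋ = -w₊`. -/
def tau (c a : ℝ) : ℂ :=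
  Gam c a * ((∫ y in a..c, I / w c a (I * y)) + ∫ y in c..a, I / (-w c a (I * y)))

/-- Complete elliptic integral of the first kind, `s` being the modulus. -/
def ellipticK (s : ℝ) : ℝ :=
  ∫ θ in (0 : ℝ)..(Real.pi / 2), 1 / Real.sqrt (1 - s ^ 2 * Real.sin θ ^ 2)

/-- Complete elliptic integral of the second kind, `s` being the modulus. -/
def ellipticE (s : ℝ) : ℝ :=
  ∫ θ in (0 : ℝ)..(Real.pi / 2), Real.sqrt (1 - s ^ 2 * Real.sin θ ^ 2)

/-- `Q = -a² + c² (1 - 2 E(a/c)/K(a/c))`. -/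
def constQ (c a : ℝ) : ℝ :=
  -a ^ 2 + c ^ 2 * (1 - 2 * (ellipticE (a / c) / ellipticK (a / c)))

/-- `q^mod(x,t) = 8 Γ² (d²/dv²) log θ₃(v + (tB + Δ)/(2π) | 2τ) |_{v = 0} + Q`; the theta function
`θ₃(z | τ) = ∑ exp(πi(n²τ + 2nz))` is Mathlib's `jacobiTheta₂ z τ`. -/
def qMod (c a x t Δ : ℝ) : ℂ :=
  8 * Gam c a ^ 2 * iteratedDeriv 2 (fun v : ℝ =>
    log (jacobiTheta₂ (v + bigLambda c a x t Δ / (2 * Real.pi)) (2 * tau c a))) 0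
  + constQ c a

/-! ### The elliptic Riemann surface of `√(λ(λ + c²)(λ + a²))` and Jacobi inversion -/

/-- `√z` with cut along `[0, ∞)` and non-negative imaginary part. -/
def sqrtUp (z : ℂ) : ℂ := I * (-z) ^ (1 / 2 : ℂ)

/-- `√(z(z + c²)(z + a²))` on the upper sheet, cut along `[-c², -a²] ∪ [0, ∞)`, with
`R(z) ~ z √z` at infinity. For real `z ∈ (-c², -a²)` the value is the limit from the upper
half-plane; the limit from the lower half-plane is its negative. -/
def R (c a : ℝ) (z : ℂ) : ℂ := sqrtUp z * w c a (sqrtUp z)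

/-- `∫_â P(λ) dλ/R(λ)`: along the gap `[-a², 0]` in the positive direction on the lower sheet,
and back on the upper sheet. -/
def aHatPeriod (c a : ℝ) (P : ℂ → ℂ) : ℂ :=
  (∫ μ in (-a ^ 2)..(0 : ℝ), P μ / (-R c a μ)) + ∫ μ in (0 : ℝ)..(-a ^ 2), P μ / R c a μ

/-- `∫_b̂ P(λ) dλ/R(λ)`: counterclockwise around `[-c², -a²]` on the upper sheet, i.e. from
`-c²` to `-a²` along the lower side of the cut and back along its upper side. -/
def bHatPeriod (c a : ℝ) (P : ℂ → ℂ) : ℂ :=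
  (∫ μ in (-c ^ 2)..(-a ^ 2), P μ / (-R c a μ)) + ∫ μ in (-a ^ 2)..(-c ^ 2), P μ / R c a μ

/-- The numerator of `dΩ₁ = (i/2)(λ + h) dλ/R(λ)`, the constant `h` being fixed by
`∫_â dΩ₁ = 0`. As `λ → ∞`, `dΩ₁ = (i/(2√λ)) (1 + O(λ⁻¹)) dλ`. -/
def omegaOne (c a : ℝ) (z : ℂ) : ℂ :=
  I / 2 * (z - aHatPeriod c a (fun s => s) / aHatPeriod c a (fun _ => 1))

/-- The numerator of `dΩ₃ = -(3i/2)(λ² + ((a² + c²)/2) λ + h) dλ/R(λ)`, the constant `h` being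
fixed by `∫_â dΩ₃ = 0`. As `λ → ∞`, `dΩ₃ = -(3i/2) √λ (1 + O(λ⁻²)) dλ`. -/
def omegaThree (c a : ℝ) (z : ℂ) : ℂ :=
  -(3 * I / 2) * (z ^ 2 + ((a : ℂ) ^ 2 + (c : ℂ) ^ 2) / 2 * z
    - aHatPeriod c a (fun s => s ^ 2 + ((a : ℂ) ^ 2 + (c : ℂ) ^ 2) / 2 * s)
      / aHatPeriod c a (fun _ => 1))

/-- The wave number: `i V = ∫_b̂ dΩ₁`. -/
def V (c a : ℝ) : ℂ := bHatPeriod c a (omegaOne c a) / I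

/-- The frequency number: `i W = ∫_b̂ dΩ₃`. -/
def W (c a : ℝ) : ℂ := bHatPeriod c a (omegaThree c a) / I

/-- A point `p = (λ, ±)` of the surface over the gap `[-a², 0]`; `sheet = 1` is the upper sheet
and `sheet = -1` the lower one. -/
structure GapPoint (a : ℝ) where
  proj : ℝ
  sheet : ℤˣ
  mem : proj ∈ Icc (-a ^ 2) 0

/-- `∫_{-a²}^p dω̂` along the gap on the sheet of `p`, where
`dω̂ = 2πi (∫_â dλ/R(λ))⁻¹ dλ/R(λ)` has `â`-period `2πi`. -/
def abelHat (c a : ℝ) (p : GapPoint a) : ℂ :=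
  2 * Real.pi * I / aHatPeriod c a (fun _ => 1)
    * ∫ μ in (-a ^ 2)..p.proj, 1 / (((p.sheet : ℤ) : ℂ) * R c a μ)

/-- `z₁ = z₂ (mod 2πi)`. -/
def EqModPeriod (z₁ z₂ : ℂ) : Prop := ∃ n : ℤ, z₁ = z₂ + 2 * Real.pi * I * n

/-- `lam = λ(x,t)`: the projection of the solution `p` of the Jacobi inversion problem
`∫_{p₀}^{p} dω̂ = -i (V x - 4 W t)` with initial divisor `p₀` given by
`∫_{-a²}^{p₀} dω̂ = -i Δ` (both mod `2πi`). -/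
def IsDirichletPoint (c a x t Δ lam : ℝ) : Prop :=
  ∃ p₀ p : GapPoint a,
    EqModPeriod (abelHat c a p₀) (-I * Δ) ∧
    EqModPeriod (abelHat c a p - abelHat c a p₀) (-I * (V c a * x - 4 * W c a * t)) ∧
    p.proj = lam

end

end KdVShock

open KdVShock

namespace KdVShock

noncomputable section

-- The product `m₁ m₂` is pinned down by Liouville's theorem. All jump matrices have determinant
-- one, so for two model solutions `m`, `n` the determinant `m₁ n₂ - m₂ n₁` has no jump. Its
-- singularities are too weak to be poles and it tends to 0 at infinity, hence it vanishes
-- (`det_eq_zero`). Consequently `m₁ n₂ w` has no jump either: on the bands the sign `(±i)² = -1` is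
-- cancelled by the sign change of `w`. It is entire, even and asymptotic to `k²`, hence equal to
-- `k² - μ` (`exists_mul_mul_w_eq`). The identity `(m₁ n₂)² = (m₁ m₂)(n₁ n₂)` then shows that the
-- zero of the product is the same for all solutions (`zero_unique`), so it suffices to compute it
-- for one explicit solution.
--
-- That solution lives on the unit disc. The map `k = (c/2)(1/η - η)` identifies `ℂ ∖ [ic, -ic]`
-- with the punctured disc, and `dk/w` becomes a multiple of `dη/S` with `S = √((1 - Eη²)(1 -
-- Ēη²))`. The elliptic integral of `dη/S` is single-valued on the disc. Normalized, it becomes `Z =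
-- abelMap`, which sends the circle to the boundary of a rectangle with corners `±1/2 ± T/2`, where
-- `T = 2τ` is purely imaginary. The two sides of the gap go to the horizontal edges and differ by
-- `T`; on the bands the two boundary values satisfy `Z₋ = -Z₊` modulo 1. So the pair `F(Z)`,
-- `F(-Z)`, with `F` a quotient of theta functions of period 1 and multiplier `e^{iΛ}` under `T`,
-- has the required jumps after multiplication by the fourth root of `(k² + a²)/(k² + c²)`
-- (`isModelSolution_modelSol`). The denominator of `F` is the product `P = thetaProd`, whose zeros
-- can be read off. They sit at the corners, and the estimate `|S| ≤ C |P ∘ Z|`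
-- (`exists_norm_quarticRoot_le`) gives the singularities of order 1/4.
--
-- For this solution the zero `k² = μ` is found from the zero `1/2 - T/2` of `θ₃`: if `Λ/(2π) =
-- ±shiftOf y` modulo 1, then `μ = -y²` (`modelSol_zero_eq`). On the elliptic surface the Abel map
-- at a point over `-y²` is `∓2πi · shiftOf y` (`abelHat_eq`). The Whitham equation says exactly
-- that the phase differential has vanishing `â`-period, so it agrees with `x dΩ₁ - 4t dΩ₃`, and its
-- `b̂`-period gives `Vx - 4Wt = tB` (`wave_phase`). Jacobi inversion therefore selects the same
-- `y`, that is `λ = μ`.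
--
-- For the trace formula, comparing the expansions at infinity for two shifts shows that `μ - (log
-- θ₃)''/(4κ²)`, with `κ = gapInt c a a`, does not depend on the shift (`zero_sub_eq`). The constant
-- is found by averaging over all shifts: `(log θ₃)'` vanishes at 0 and at 1/2, so only the mean of
-- `y²` with respect to `dy/|w|` on the gap survives, which is `c²(1 - E/K)`
-- (`modelSol_zero_eq_thetaLogTwo`).

local notation "𝔻" => Metric.ball (0 : ℂ) 1
local notation "𝔻c" => Metric.closedBall (0 : ℂ) 1

/-! ### A theta function in product form -/

/-- `∏ (1 + q^(2n+1) X)`. -/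
def thetaHalf (q X : ℂ) : ℂ := ∏' n : ℕ, (1 + q ^ (2 * n + 1) * X)

lemma summable_thetaHalf_term {q : ℂ} (hq : ‖q‖ < 1) (X : ℂ) :
    Summable fun n : ℕ => ‖q ^ (2 * n + 1) * X‖ := by
  have h : Summable fun n : ℕ => (‖q‖ ^ 2) ^ n :=
    summable_geometric_of_lt_one (by positivity) (by nlinarith [norm_nonneg q])
  refine (h.mul_left (‖q‖ * ‖X‖)).congr fun n => ?_
  rw [norm_mul, norm_pow]; ring

/-- Splitting off the factor `n = 0` leaves the same product at `q² X`. This shift is the source of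
the quasi-period `T` of `thetaProd`. -/
lemma thetaHalf_succ {q : ℂ} (hq : ‖q‖ < 1) (X : ℂ) :
    thetaHalf q X = (1 + q * X) * thetaHalf q (q ^ 2 * X) := by
  have h := multipliable_one_add_of_summable (summable_thetaHalf_term hq (q ^ 2 * X))
  have e : (fun n : ℕ => 1 + q ^ (2 * n + 1) * (q ^ 2 * X)) =
      fun n : ℕ => 1 + q ^ (2 * (n + 1) + 1) * X := by
    funext n; ring
  rw [e] at h
  have h' := tprod_eq_zero_mul' (f := fun n : ℕ => 1 + q ^ (2 * n + 1) * X) h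
  have e0 : 1 + q ^ (2 * 0 + 1) * X = 1 + q * X := by ring
  unfold thetaHalf
  rw [h', e, e0]

lemma differentiable_thetaHalf {q : ℂ} (hq : ‖q‖ < 1) : Differentiable ℂ (thetaHalf q) := by
  intro X
  have h : HasProdLocallyUniformlyOn (fun (n : ℕ) (Y : ℂ) => 1 + q ^ (2 * n + 1) * Y)
      (fun Y => ∏' n : ℕ, (1 + q ^ (2 * n + 1) * Y)) (Metric.ball 0 (‖X‖ + 1)) := by
    refine Summable.hasProdLocallyUniformlyOn_nat_one_add Metric.isOpen_ball
      (summable_thetaHalf_term hq ((‖X‖ + 1 : ℝ) : ℂ)) (.of_forall fun n Y hY => ?_)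
      fun n => by fun_prop
    rw [norm_mul, norm_mul, norm_real, Real.norm_of_nonneg (by positivity)]
    gcongr
    simpa using (mem_ball_zero_iff.1 hY).le
  have h2 := h.differentiableOn (.of_forall fun _ => by
    simpa [Finset.prod_fn] using DifferentiableOn.finsetProd (fun _ _ => by fun_prop))
    Metric.isOpen_ball
  exact h2.differentiableAt (Metric.isOpen_ball.mem_nhds (by simp))

/-- The term `qX` is the largest one, so if it has modulus below 1 no factor vanishes, and an
absolutely convergent product of nonzero factors is nonzero. -/
lemma thetaHalf_ne_zero {q X : ℂ} (hq : ‖q‖ < 1) (h : ‖q * X‖ < 1) : thetaHalf q X ≠ 0 := by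
  refine tprod_one_add_ne_zero_of_summable (fun n h0 => ?_) (summable_thetaHalf_term hq X)
  have h1 : ‖q ^ (2 * n + 1) * X‖ < 1 := by
    have : q ^ (2 * n + 1) * X = (q ^ 2) ^ n * (q * X) := by ring
    rw [this, norm_mul, norm_pow, norm_pow]
    have : (‖q‖ ^ 2) ^ n ≤ 1 := pow_le_one₀ (by positivity) (pow_le_one₀ (norm_nonneg _) hq.le)
    nlinarith [norm_nonneg (q * X)]
  rw [eq_neg_of_add_eq_zero_right h0] at h1
  simp at h1

/-- The product `∏ (1 + q^(2n+1) e^(2πiz)) (1 + q^(2n+1) e^(-2πiz))`, `q = e^(πiT)`. It has the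
quasi-periods of the theta function `jacobiTheta₂ · T`. -/
def thetaProd (T z : ℂ) : ℂ :=
  thetaHalf (exp (Real.pi * I * T)) (exp (2 * Real.pi * I * z)) *
    thetaHalf (exp (Real.pi * I * T)) (exp (-(2 * Real.pi * I * z)))

lemma norm_exp_pi_I_mul (T : ℂ) : ‖exp (Real.pi * I * T)‖ = Real.exp (-(Real.pi * T.im)) := by
  rw [norm_exp]; simp

lemma norm_exp_two_pi_I_mul (z : ℂ) :
    ‖exp (2 * Real.pi * I * z)‖ = Real.exp (-(2 * Real.pi * z.im)) := by
  rw [norm_exp]; simp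

lemma norm_nome_lt_one {T : ℂ} (hT : 0 < T.im) : ‖exp (Real.pi * I * T)‖ < 1 := by
  rw [norm_exp_pi_I_mul, Real.exp_lt_one_iff]
  have := Real.pi_pos
  nlinarith [mul_pos this hT]

lemma differentiable_thetaProd {T : ℂ} (hT : 0 < T.im) : Differentiable ℂ (thetaProd T) := by
  have h := differentiable_thetaHalf (norm_nome_lt_one hT)
  unfold thetaProd
  exact (h.comp (by fun_prop)).mul (h.comp (by fun_prop))

lemma thetaProd_neg (T z : ℂ) : thetaProd T (-z) = thetaProd T z := by
  simp only [thetaProd, mul_neg, neg_neg]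
  ring

lemma thetaProd_add_one (T z : ℂ) : thetaProd T (z + 1) = thetaProd T z := by
  have h : exp (2 * Real.pi * I * (z + 1)) = exp (2 * Real.pi * I * z) := by
    rw [mul_add, mul_one, exp_periodic]
  simp only [thetaProd, exp_neg, h]

lemma thetaProd_sub_one (T z : ℂ) : thetaProd T (z - 1) = thetaProd T z := by
  simpa using (thetaProd_add_one T (z - 1)).symm

/-- Under `X ↦ q² X` one half product loses its factor `1 + qX` and the other gains `1 + (qX)⁻¹`;
the quotient of these two factors is `(qX)⁻¹`. -/
lemma thetaProd_add_period {T : ℂ} (hT : 0 < T.im) (z : ℂ) :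
    thetaProd T (z + T) = exp (-Real.pi * I * (T + 2 * z)) * thetaProd T z := by
  have hq := norm_nome_lt_one hT
  set q := exp (Real.pi * I * T) with hqd
  have hq0 : q ≠ 0 := exp_ne_zero _
  have e1 : exp (2 * Real.pi * I * (z + T)) = q ^ 2 * exp (2 * Real.pi * I * z) := by
    rw [hqd, ← exp_nat_mul, ← exp_add]; congr 1; push_cast; ring
  have e2 : exp (-Real.pi * I * (T + 2 * z)) = q⁻¹ * (exp (2 * Real.pi * I * z))⁻¹ := by
    rw [hqd, ← exp_neg, ← exp_neg, ← exp_add]; congr 1; ring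
  rw [e2]
  simp only [thetaProd, exp_neg, ← hqd, e1]
  set X := exp (2 * Real.pi * I * z)
  have hX0 : X ≠ 0 := exp_ne_zero _
  rw [thetaHalf_succ hq X, thetaHalf_succ hq (q ^ 2 * X)⁻¹]
  have : q ^ 2 * (q ^ 2 * X)⁻¹ = X⁻¹ := by field_simp
  rw [this]
  field_simp
  ring

/-- The factors of `thetaProd` that vanish at `±1/2 ± T/2` split off. -/
lemma thetaProd_eq_mul {T : ℂ} (hT : 0 < T.im) (z : ℂ) :
    thetaProd T z = (1 + exp (Real.pi * I * T) * exp (2 * Real.pi * I * z)) *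
      ((1 + exp (Real.pi * I * T) * exp (-(2 * Real.pi * I * z))) *
      (thetaHalf (exp (Real.pi * I * T)) (exp (Real.pi * I * T) ^ 2 * exp (2 * Real.pi * I * z)) *
      thetaHalf (exp (Real.pi * I * T))
        (exp (Real.pi * I * T) ^ 2 * exp (-(2 * Real.pi * I * z))))) := by
  have hq := norm_nome_lt_one hT
  rw [thetaProd, thetaHalf_succ hq (exp (2 * Real.pi * I * z)),
    thetaHalf_succ hq (exp (-(2 * Real.pi * I * z)))]
  ring

/-- In the closed strip `|e^{2πiz}| ≤ |q|⁻¹`, so the largest remaining term `q³ e^{2πiz}` has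
modulus at most `|q|² < 1`. -/
lemma thetaHalf_shift_ne_zero {T z : ℂ} (hT : 0 < T.im) (hz : |z.im| ≤ T.im / 2) :
    thetaHalf (exp (Real.pi * I * T)) (exp (Real.pi * I * T) ^ 2 * exp (2 * Real.pi * I * z)) ≠ 0 := by
  refine thetaHalf_ne_zero (norm_nome_lt_one hT) ?_
  rw [norm_mul, norm_mul, norm_pow, norm_exp_pi_I_mul, norm_exp_two_pi_I_mul, ← Real.exp_nat_mul,
    ← Real.exp_add, ← Real.exp_add, Real.exp_lt_one_iff]
  have := abs_le.1 hz
  have hp := Real.pi_pos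
  push_cast
  nlinarith [mul_pos hp hT, mul_nonneg hp.le (by linarith [this.1] : 0 ≤ z.im + T.im / 2)]

/-- In the closed strip `|Im z| ≤ Im T / 2`, the zeros of `thetaProd` lie on the boundary. -/
lemma thetaProd_ne_zero {T z : ℂ} (hT : 0 < T.im) (hz : |z.im| ≤ T.im / 2)
    (h1 : exp (Real.pi * I * T) * exp (2 * Real.pi * I * z) ≠ -1)
    (h2 : exp (Real.pi * I * T) * exp (-(2 * Real.pi * I * z)) ≠ -1) : thetaProd T z ≠ 0 := by
  rw [thetaProd_eq_mul hT]
  have h3 := thetaHalf_shift_ne_zero hT hz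
  have h4 := thetaHalf_shift_ne_zero (z := -z) hT (by simpa using hz)
  rw [mul_neg] at h4
  refine mul_ne_zero (fun h => h1 ?_) (mul_ne_zero (fun h => h2 ?_) (mul_ne_zero h3 h4))
  · linear_combination h
  · linear_combination h

lemma thetaProd_ne_zero_of_abs_im_lt {T z : ℂ} (hT : 0 < T.im) (hz : |z.im| < T.im / 2) :
    thetaProd T z ≠ 0 := by
  have key : ∀ z : ℂ, |z.im| < T.im / 2 →
      exp (Real.pi * I * T) * exp (2 * Real.pi * I * z) ≠ -1 := by
    intro z hz h
    have h' := congrArg norm h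
    rw [norm_mul, norm_exp_pi_I_mul, norm_exp_two_pi_I_mul, ← Real.exp_add, norm_neg, norm_one,
      Real.exp_eq_one_iff] at h'
    have := abs_lt.1 hz
    nlinarith [Real.pi_pos, mul_pos Real.pi_pos (by linarith [this.1] : 0 < z.im + T.im / 2)]
  refine thetaProd_ne_zero hT hz.le (key z hz) ?_
  have := key (-z) (by simpa using hz)
  rwa [mul_neg] at this

/-- On the lower edge of the strip the first split-off factor is `1 + e^{2πix}`, which vanishes only
for half-integers `x`; the terms in all other factors have modulus below 1. This edge carries the
boundary values from the right side of the gap. -/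
lemma thetaProd_ne_zero_of_re {T : ℂ} (hT : 0 < T.im) {x : ℝ} (hx : |x| < 1 / 2) :
    thetaProd T (x - T / 2) ≠ 0 := by
  have hp := Real.pi_pos
  have hq := norm_nome_lt_one hT
  have e1 : exp (Real.pi * I * T) * exp (2 * Real.pi * I * (x - T / 2)) =
      exp ((2 * Real.pi * x : ℝ) * I) := by
    rw [← exp_add]; congr 1; push_cast; ring
  have e2 : exp (Real.pi * I * T) * exp (-(2 * Real.pi * I * (x - T / 2))) =
      exp (Real.pi * I * T) ^ 2 * exp ((-(2 * Real.pi * x) : ℝ) * I) := by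
    rw [← exp_nat_mul, ← exp_add, ← exp_add]; congr 1; push_cast; ring
  rw [thetaProd_eq_mul hT, e1, e2]
  have hx' := abs_lt.1 hx
  refine mul_ne_zero (fun h => ?_) (mul_ne_zero (fun h => ?_)
    (mul_ne_zero (thetaHalf_ne_zero hq ?_) (thetaHalf_ne_zero hq ?_)))
  · have h2 : exp ((2 * Real.pi * x : ℝ) * I) = exp (Real.pi * I) := by
      rw [exp_pi_mul_I]; linear_combination h
    have h3 : exp ((2 * Real.pi * x / 2 : ℝ) * I) ^ 2 = -1 := by
      rw [← exp_nat_mul, ← exp_pi_mul_I, ← h2]; congr 1; push_cast; ring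
    have h4 : Real.cos (2 * Real.pi * x) = -1 := by
      have := congrArg re (h2.trans exp_pi_mul_I)
      rwa [exp_ofReal_mul_I_re] at this
    have h5 : Real.cos (Real.pi * x) = 0 := by
      have := Real.cos_sq (Real.pi * x)
      rw [show 2 * (Real.pi * x) = 2 * Real.pi * x by ring, h4] at this
      nlinarith
    exact (Real.cos_pos_of_mem_Ioo ⟨by nlinarith, by nlinarith⟩).ne' h5
  · have h2 := congrArg norm (eq_neg_of_add_eq_zero_right h)
    rw [norm_mul, norm_pow, norm_exp_ofReal_mul_I, norm_neg, norm_one] at h2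
    nlinarith [norm_nonneg (exp (Real.pi * I * T))]
  · have : exp (Real.pi * I * T) ^ 2 * exp (2 * Real.pi * I * (x - T / 2)) =
        exp (Real.pi * I * T) * exp ((2 * Real.pi * x : ℝ) * I) := by
      rw [← e1]; ring
    rw [this, norm_mul, norm_mul, norm_exp_ofReal_mul_I]
    nlinarith [norm_nonneg (exp (Real.pi * I * T))]
  · have : exp (Real.pi * I * T) ^ 2 * exp (-(2 * Real.pi * I * (x - T / 2))) =
        exp (Real.pi * I * T) ^ 3 * exp ((-(2 * Real.pi * x) : ℝ) * I) := by
      rw [pow_two, mul_assoc, e2]; ring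
    rw [this, norm_mul, norm_mul, norm_pow, norm_exp_ofReal_mul_I, mul_one, ← pow_succ']
    exact pow_lt_one₀ (norm_nonneg _) hq (by norm_num)

/-- `thetaProd` has a zero of order one at `-1/2 - T/2`. -/
lemma isBigO_sub_thetaProd {T : ℂ} (hT : 0 < T.im) :
    (fun z => z - (-(1 / 2) - T / 2)) =O[𝓝 (-(1 / 2) - T / 2)] thetaProd T := by
  set z₀ : ℂ := -(1 / 2) - T / 2 with hz₀
  set q := exp (Real.pi * I * T) with hqd
  have hq := norm_nome_lt_one hT
  have him : z₀.im = -(T.im / 2) := by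
    rw [hz₀, sub_im, div_ofNat_im]; simp
  set r : ℂ → ℂ := fun z => (1 + q * exp (-(2 * Real.pi * I * z))) *
      (thetaHalf q (q ^ 2 * exp (2 * Real.pi * I * z)) *
      thetaHalf q (q ^ 2 * exp (-(2 * Real.pi * I * z))))
  have e1 : q * exp (2 * Real.pi * I * z₀) = -1 := by
    rw [hqd, hz₀, ← exp_add, ← exp_neg_pi_mul_I]; congr 1; ring
  have hr : r z₀ ≠ 0 := by
    have h3 := thetaHalf_shift_ne_zero (z := z₀) hT (by rw [him, abs_neg, abs_of_pos (by linarith)])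
    have h4 := thetaHalf_shift_ne_zero (z := -z₀) hT
      (by rw [neg_im, him, neg_neg, abs_of_pos (by linarith)])
    rw [mul_neg] at h4
    refine mul_ne_zero (fun h => ?_) (mul_ne_zero h3 h4)
    have e2 : q * exp (-(2 * Real.pi * I * z₀)) = -q ^ 2 := by
      have := exp_ne_zero (2 * Real.pi * I * z₀)
      rw [exp_neg]; field_simp; linear_combination q * e1
    rw [e2] at h
    have h2 := congrArg norm (eq_neg_of_add_eq_zero_right h)
    rw [norm_neg, norm_pow, norm_neg, norm_one] at h2
    nlinarith [norm_nonneg q]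
  have hrc : ContinuousAt r z₀ := by
    have h := (differentiable_thetaHalf hq).continuous
    have h1 := h.comp (by fun_prop : Continuous fun z : ℂ => q ^ 2 * exp (2 * Real.pi * I * z))
    have h2 := h.comp (by fun_prop : Continuous fun z : ℂ => q ^ 2 * exp (-(2 * Real.pi * I * z)))
    exact ((by fun_prop : Continuous fun z : ℂ => 1 + q * exp (-(2 * Real.pi * I * z))).mul
      (h1.mul h2)).continuousAt
  have hd : HasDerivAt (fun z => 1 + q * exp (2 * Real.pi * I * z))
      (q * (exp (2 * Real.pi * I * z₀) * (2 * Real.pi * I * 1))) z₀ :=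
    ((((hasDerivAt_id z₀).const_mul (2 * Real.pi * I)).cexp).const_mul q).const_add 1
  have hd0 : q * (exp (2 * Real.pi * I * z₀) * (2 * Real.pi * I * 1)) ≠ 0 := by
    have := exp_ne_zero (2 * Real.pi * I * z₀)
    have := Real.pi_ne_zero
    have : q ≠ 0 := exp_ne_zero _
    simp [*]
  -- Only the factor `1 + q e^{2πiz}` vanishes at `z₀`, and its derivative there is nonzero; the
  -- cofactor `r` is bounded away from 0 nearby.
  have h1 : (fun z => z - z₀) =O[𝓝 z₀] fun z =>
      (1 + q * exp (2 * Real.pi * I * z)) - (1 + q * exp (2 * Real.pi * I * z₀)) :=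
    (HasDerivAtFilter.isTheta_sub hd hd0).isBigO_symm.comp_tendsto
      (tendsto_id.prodMk (tendsto_pure.2 (.of_forall fun _ => rfl)))
  have h2 : (fun _ : ℂ => (1 : ℂ)) =O[𝓝 z₀] r := by
    refine IsBigO.of_bound (‖r z₀‖ / 2)⁻¹ ?_
    have := hrc.norm.eventually_const_lt (half_lt_self (norm_pos_iff.2 hr))
    filter_upwards [this] with z hz
    have h0 : 0 < ‖r z₀‖ / 2 := half_pos (norm_pos_iff.2 hr)
    rw [norm_one, ← div_eq_inv_mul, le_div_iff₀ h0, one_mul]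
    exact hz.le
  refine ((h1.mul h2).congr (fun z => mul_one _) fun z => ?_).trans (isBigO_refl _ _)
  rw [thetaProd_eq_mul hT, e1]
  ring

/-- On the real line the theta function with purely imaginary period is positive. -/
lemma jacobiTheta₂_pos {s : ℝ} (hs : 0 < s) (v : ℝ) :
    ∃ r : ℝ, 0 < r ∧ jacobiTheta₂ v (I * s) = r := by
  have hs0 : (s : ℂ) ≠ 0 := by exact_mod_cast hs.ne'
  -- After the inversion `T ↦ -1/T` the terms of the series are positive reals, whereas the terms of
  -- the original series oscillate.
  have hterm : ∀ n : ℤ, jacobiTheta₂_term n (v / (I * s)) (-1 / (I * s)) =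
      ((Real.exp (-2 * Real.pi * n * (-v / s) - Real.pi * n ^ 2 / s) : ℝ) : ℂ) := by
    intro n
    rw [jacobiTheta₂_term, ofReal_exp]
    congr 1
    push_cast
    field_simp
    ring
  have him : 0 < (-1 / (I * s)).im := by
    have : -1 / (I * s) = I * ((1 / s : ℝ) : ℂ) := by
      push_cast; field_simp; rw [I_sq]
    rw [this]; simpa using hs
  have hsum := hasSum_jacobiTheta₂_term (v / (I * s)) him
  simp_rw [hterm] at hsum
  have hsr : Summable fun n : ℤ => Real.exp (-2 * Real.pi * n * (-v / s) - Real.pi * n ^ 2 / s) := by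
    exact_mod_cast hsum.summable
  have htheta : jacobiTheta₂ (v / (I * s)) (-1 / (I * s)) =
      ((∑' n : ℤ, Real.exp (-2 * Real.pi * n * (-v / s) - Real.pi * n ^ 2 / s) : ℝ) : ℂ) := by
    rw [← hsum.tsum_eq, ofReal_tsum]
  refine ⟨1 / s ^ (1 / 2 : ℝ) * Real.exp (-Real.pi * v ^ 2 / s) *
    ∑' n : ℤ, Real.exp (-2 * Real.pi * n * (-v / s) - Real.pi * n ^ 2 / s), ?_, ?_⟩
  · have := hsr.tsum_pos (fun n => (Real.exp_pos _).le) 0 (Real.exp_pos _)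
    positivity
  · rw [jacobiTheta₂_functional_equation, htheta]
    have h1 : -I * (I * s) = (s : ℂ) := by linear_combination (-s : ℂ) * I_sq
    have h2 : exp (-Real.pi * I * v ^ 2 / (I * s)) = ((Real.exp (-Real.pi * v ^ 2 / s) : ℝ) : ℂ) := by
      rw [ofReal_exp]; congr 1; push_cast; field_simp
    rw [h1, h2]
    push_cast
    rw [ofReal_cpow hs.le]
    push_cast
    ring

/-! ### Holomorphic extension across a segment -/

/-- A continuous function that is holomorphic off the imaginary axis is holomorphic. -/
lemma differentiableOn_ball_of_off_imaginary_axis {f : ℂ → ℂ} {p : ℂ} {r : ℝ}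
    (hc : ContinuousOn f (Metric.ball p r))
    (hd : ∀ z ∈ Metric.ball p r, z.re ≠ 0 → DifferentiableAt ℂ f z) :
    DifferentiableOn ℂ f (Metric.ball p r) := by
  suffices h : IsConservativeOn f (Metric.ball p r) from
    (h.isExactOn_ball hc).differentiableOn Metric.isOpen_ball
  intro z u hzu
  rw [← add_eq_zero_iff_eq_neg, wedgeIntegral_add_wedgeIntegral_eq]
  unfold Rectangle at hzu
  -- The boundary integral over a rectangle vanishes as soon as the function is continuous on it and
  -- holomorphic inside; hence an edge may lie on the imaginary axis.
  have key : ∀ α β : ℝ, uIcc α β ⊆ uIcc z.re u.re → (0 : ℝ) ∉ Ioo (min α β) (max α β) →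
      (∫ x : ℝ in α..β, f (x + z.im * I)) - (∫ x : ℝ in α..β, f (x + u.im * I)) +
      I • (∫ y : ℝ in z.im..u.im, f (β + y * I)) -
      I • (∫ y : ℝ in z.im..u.im, f (α + y * I)) = 0 := by
    intro α β hsub h0
    have := integral_boundary_rect_eq_zero_of_continuousOn_of_differentiableOn f
      ⟨α, z.im⟩ ⟨β, u.im⟩ (hc.mono ((reProdIm_subset_iff.2 (prod_mono hsub subset_rfl)).trans hzu))
      (fun w hw => (hd w (hzu ⟨hsub (Ioo_subset_Icc_self hw.1), Ioo_subset_Icc_self hw.2⟩)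
        fun h => h0 (h ▸ hw.1)).differentiableWithinAt)
    simpa using this
  -- A rectangle that meets the axis is cut along it into two rectangles of the previous kind.
  by_cases h0 : (0 : ℝ) ∈ uIcc z.re u.re
  · have h1 := key z.re 0 (uIcc_subset_uIcc_left h0) (by
      rintro ⟨h1, h2⟩
      rcases le_total z.re 0 with h | h <;> simp [h] at h1 h2)
    have h2 := key 0 u.re (uIcc_subset_uIcc_right h0) (by
      rintro ⟨h1, h2⟩
      rcases le_total 0 u.re with h | h <;> simp [h] at h1 h2)
    have hint : ∀ y ∈ uIcc z.im u.im, ∀ α β : ℝ, uIcc α β ⊆ uIcc z.re u.re →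
        IntervalIntegrable (fun x : ℝ => f (x + y * I)) volume α β := by
      intro y hy α β hsub
      refine ContinuousOn.intervalIntegrable (hc.comp (by fun_prop) fun x hx => hzu ⟨?_, ?_⟩)
      · simpa using hsub hx
      · simpa using hy
    have e := fun y hy => intervalIntegral.integral_add_adjacent_intervals
      (hint y hy z.re 0 (uIcc_subset_uIcc_left h0)) (hint y hy 0 u.re (uIcc_subset_uIcc_right h0))
    rw [← e z.im left_mem_uIcc, ← e u.im right_mem_uIcc]
    linear_combination h1 + h2
  · exact key z.re u.re subset_rfl fun h => h0 (Ioo_subset_Icc_self h)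

lemma isOpen_cutPlane (c : ℝ) : IsOpen (cutPlane c) := by
  have : IsClosed {k : ℂ | k.re = 0 ∧ |k.im| ≤ c} :=
    (isClosed_eq continuous_re continuous_const).inter
      (isClosed_le continuous_im.abs continuous_const)
  exact this.isOpen_compl

lemma dense_re_ne_zero : Dense {k : ℂ | k.re ≠ 0} := by
  have h : Dense ({0}ᶜ : Set ℝ) := dense_compl_singleton 0
  exact h.preimage isOpenMap_re

lemma nhdsWithin_re_ne_zero (z : ℂ) :
    𝓝[{k : ℂ | k.re ≠ 0}] z = 𝓝[{k : ℂ | 0 < k.re}] z ⊔ 𝓝[{k : ℂ | k.re < 0}] z := by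
  rw [← nhdsWithin_union]
  congr 1
  ext k
  simp only [mem_ofPred_eq, mem_union]
  exact ⟨fun h => (lt_or_gt_of_ne h).symm, fun h => h.elim ne_of_gt ne_of_lt⟩

/-- The end points of the bands. -/
def branchPoints (c a : ℝ) : Set ℂ := {I * c, I * a, -(I * a), -(I * c)}

/-- A holomorphic function on `ℂ ∖ [ic, -ic]` with matching one-sided limits on the segment and
weak singularities at the four exceptional points extends to an entire function. -/
lemma exists_entire_extension {c a : ℝ} (ha : 0 ≤ a) (hac : a ≤ c) {f : ℂ → ℂ} (hf : DifferentiableOn ℂ f (cutPlane c))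
    (hj : ∀ y : ℝ, |y| < c → |y| ≠ a → ∃ l : ℂ, Tendsto f (𝓝[{k : ℂ | 0 < k.re}] (I * y)) (𝓝 l) ∧
      Tendsto f (𝓝[{k : ℂ | k.re < 0}] (I * y)) (𝓝 l))
    (hs : ∀ κ ∈ branchPoints c a, Tendsto (fun k => (k - κ) * f k) (𝓝[cutPlane c] κ) (𝓝 0)) :
    ∃ H : ℂ → ℂ, Differentiable ℂ H ∧ EqOn H f (cutPlane c) := by
  classical
  set A : Set ℂ := {k : ℂ | k.re ≠ 0} with hA
  have hAo : IsOpen A := isOpen_ne_fun continuous_re continuous_const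
  have hAc : A ⊆ cutPlane c := fun k hk h => hk h.1
  have hlim : ∀ z ∈ (branchPoints c a)ᶜ, ∃ l, Tendsto f (𝓝[A] z) (𝓝 l) := by
    intro z hz
    by_cases hzc : z ∈ cutPlane c
    · exact ⟨f z, ((hf.differentiableAt ((isOpen_cutPlane c).mem_nhds hzc)).continuousAt.tendsto).mono_left
        nhdsWithin_le_nhds⟩
    · have h1 : z.re = 0 ∧ |z.im| ≤ c := by simpa [cutPlane] using hzc
      have hz1 : z = I * z.im := by
        apply Complex.ext <;> simp [h1.1]
      have hne : |z.im| ≠ c := by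
        intro h
        rcases abs_choice z.im with h2 | h2 <;> apply hz <;> rw [hz1, branchPoints]
        · rw [← h2, h]; simp
        · have : z.im = -c := by linarith
          rw [this]; simp
      have hne2 : |z.im| ≠ a := by
        intro h
        rcases abs_choice z.im with h2 | h2 <;> apply hz <;> rw [hz1, branchPoints]
        · rw [← h2, h]; simp
        · have : z.im = -a := by linarith
          rw [this]; simp
      obtain ⟨l, hl1, hl2⟩ := hj z.im (lt_of_le_of_ne h1.2 hne) hne2
      refine ⟨l, ?_⟩
      rw [hA, nhdsWithin_re_ne_zero, hz1]
      exact hl1.sup hl2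
  set g := extendFrom A f
  have hgc : ContinuousOn g (branchPoints c a)ᶜ :=
    continuousOn_extendFrom (by rw [dense_re_ne_zero.closure_eq]; exact subset_univ _) hlim
  have hgf : EqOn g f (cutPlane c) := fun z hz => extendFrom_eq (dense_re_ne_zero z)
    (((hf.differentiableAt ((isOpen_cutPlane c).mem_nhds hz)).continuousAt.tendsto).mono_left
      nhdsWithin_le_nhds)
  have hfin : (branchPoints c a).Finite := by
    unfold branchPoints; exact Set.toFinite _
  have hBo : IsOpen (branchPoints c a)ᶜ := hfin.isClosed.isOpen_compl
  have hgd : ∀ z ∈ (branchPoints c a)ᶜ, DifferentiableAt ℂ g z := by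
    intro z hz
    obtain ⟨r, hr, hsub⟩ := Metric.isOpen_iff.1 hBo z hz
    refine (differentiableOn_ball_of_off_imaginary_axis (hgc.mono hsub) fun u hu hu0 => ?_).differentiableAt
      (Metric.ball_mem_nhds z hr)
    have hu1 : u ∈ cutPlane c := hAc hu0
    exact (hf.differentiableAt ((isOpen_cutPlane c).mem_nhds hu1)).congr_of_eventuallyEq
      (hgf.eventuallyEq_of_mem ((isOpen_cutPlane c).mem_nhds hu1))
  have hpunct : ∀ κ : ℂ, ∀ᶠ z in 𝓝[≠] κ, z ∈ (branchPoints c a)ᶜ := by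
    intro κ
    have : IsOpen (branchPoints c a \ {κ})ᶜ := (hfin.subset sdiff_subset).isClosed.isOpen_compl
    rw [eventually_nhdsWithin_iff]
    filter_upwards [this.mem_nhds (by simp)] with z hz hzκ hzB
    exact hz ⟨hzB, hzκ⟩
  have hbp : ∀ κ ∈ branchPoints c a, ∃ l, Tendsto g (𝓝[≠] κ) (𝓝 l) := by
    intro κ hκ
    have h1 : ∀ᶠ z in 𝓝[≠] κ, DifferentiableAt ℂ g z := (hpunct κ).mono hgd
    refine ⟨_, tendsto_limUnder_of_differentiable_on_punctured_nhds_of_isLittleO h1 ?_⟩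
    -- The hypothesis controls `f` off the segment only. The bound passes to the values of `g` on
    -- the segment because `g` is continuous there and points off the axis are dense; the loss from
    -- `ε / 2` to `ε` restores strictness.
    have h2 : Tendsto (fun k => (k - κ) * g k) (𝓝[≠] κ) (𝓝 0) := by
      rw [Metric.tendsto_nhds]
      intro ε hε
      have h3 := (Metric.tendsto_nhds.1 (hs κ hκ)) (ε / 2) (half_pos hε)
      rw [eventually_nhdsWithin_iff] at h3
      have h4 := h3.eventually_nhds
      rw [eventually_nhdsWithin_iff]
      have h5 := hpunct κ
      rw [eventually_nhdsWithin_iff] at h5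
      filter_upwards [h4, h5] with z hz hzB hzκ
      have hct : ContinuousAt (fun k => ‖(k - κ) * g k‖) z :=
        (((continuousAt_id.sub continuousAt_const).mul
          ((hgc z (hzB hzκ)).continuousAt (hBo.mem_nhds (hzB hzκ))))).norm
      have hle : ‖(z - κ) * g z‖ ≤ ε / 2 := by
        have : (𝓝[A] z).NeBot := mem_closure_iff_nhdsWithin_neBot.1 (dense_re_ne_zero z)
        refine le_of_tendsto (hct.tendsto.mono_left nhdsWithin_le_nhds : Tendsto _ (𝓝[A] z) _) ?_
        filter_upwards [nhdsWithin_le_nhds hz, self_mem_nhdsWithin] with u hu huA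
        have := hu (hAc huA)
        rw [dist_zero_right] at this
        rw [hgf (hAc huA)]
        exact this.le
      rw [dist_zero_right]
      linarith
    rw [isLittleO_iff_tendsto']
    · have h6 : Tendsto (fun k => (k - κ) * (g k - g κ)) (𝓝[≠] κ) (𝓝 0) := by
        have h7 : Tendsto (fun k : ℂ => (k - κ) * g κ) (𝓝[≠] κ) (𝓝 ((κ - κ) * g κ)) :=
          ((by fun_prop : Continuous fun k : ℂ => (k - κ) * g κ).tendsto κ).mono_left nhdsWithin_le_nhds
        have := h2.sub h7
        simp only [sub_self, zero_mul] at this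
        exact this.congr fun k => by ring
      refine h6.congr fun k => ?_
      rw [div_inv_eq_mul, mul_comm]
    · filter_upwards [self_mem_nhdsWithin] with k hk h
      exact absurd (inv_eq_zero.1 h) (sub_ne_zero.2 hk)
  have hdense : ∀ z, z ∈ closure (branchPoints c a)ᶜ :=
    fun z => hfin.countable.dense_compl ℂ z
  have hlim2 : ∀ z, ∃ l, Tendsto g (𝓝[(branchPoints c a)ᶜ] z) (𝓝 l) := by
    intro z
    by_cases hz : z ∈ branchPoints c a
    · obtain ⟨l, hl⟩ := hbp z hz
      exact ⟨l, hl.mono_left (nhdsWithin_mono _ fun u hu h => hu (h ▸ hz))⟩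
    · exact ⟨g z, hgc z hz⟩
  have hcont : Continuous (extendFrom (branchPoints c a)ᶜ g) := continuous_extendFrom hdense hlim2
  have heq : EqOn (extendFrom (branchPoints c a)ᶜ g) g (branchPoints c a)ᶜ :=
    fun z hz => extendFrom_eq (hdense z) (hgc z hz)
  refine ⟨extendFrom (branchPoints c a)ᶜ g, ?_, ?_⟩
  · intro z
    refine (analyticAt_of_differentiable_on_punctured_nhds_of_continuousAt ?_
      hcont.continuousAt).differentiableAt
    filter_upwards [hpunct z] with u hu
    exact (hgd u hu).congr_of_eventuallyEq (heq.eventuallyEq_of_mem (hBo.mem_nhds hu))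
  · intro z hz
    have hzB : z ∈ (branchPoints c a)ᶜ := by
      intro h
      refine hz ?_
      have hc : 0 ≤ c := ha.trans hac
      simp only [branchPoints, mem_insert_iff, mem_singleton_iff] at h
      rcases h with rfl | rfl | rfl | rfl <;> simp [abs_of_nonneg, *]
    exact (heq hzB).trans (hgf hz)

/-! ### The functions `sqrtRatio` and `w` -/

lemma ne_zero_of_mem_cutPlane {c : ℝ} (hc : 0 < c) {k : ℂ} (hk : k ∈ cutPlane c) : k ≠ 0 := by
  rintro rfl
  exact hk (by simp [hc.le])

lemma neg_mem_cutPlane {c : ℝ} {k : ℂ} (hk : k ∈ cutPlane c) : -k ∈ cutPlane c := by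
  simpa [cutPlane] using hk

lemma mem_cutPlane_of_re_ne_zero {c : ℝ} {k : ℂ} (hk : k.re ≠ 0) : k ∈ cutPlane c :=
  fun h => hk h.1

lemma cutPlane_mem_cobounded (c : ℝ) : cutPlane c ∈ Bornology.cobounded ℂ := by
  have h1 : (Metric.closedBall (0 : ℂ) c)ᶜ ∈ Bornology.cobounded ℂ := by
    rw [Metric.cobounded_eq_cocompact]
    exact (isCompact_closedBall (0 : ℂ) c).compl_mem_cocompact
  refine Filter.mem_of_superset h1 fun k hk h => hk ?_
  rw [mem_closedBall_zero_iff]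
  have : k = I * k.im := by apply Complex.ext <;> simp [h.1]
  rw [this]
  simpa using h.2

/-- `k² ∈ [-c², 0]` only on the segment. -/
lemma not_mem_cutPlane_of_sq {c s : ℝ} (hc : 0 < c) (hs : 0 ≤ s) (hsc : s ≤ c ^ 2) {k : ℂ}
    (hk : k ^ 2 = -(s : ℂ)) : k ∉ cutPlane c := by
  have h1 := congrArg re hk
  have h2 := congrArg im hk
  simp [pow_two] at h1 h2
  refine not_not.2 ?_
  have h3 : k.re * k.im = 0 := by linarith
  rcases mul_eq_zero.1 h3 with h | h
  · refine ⟨h, abs_le_of_sq_le_sq (by nlinarith) hc.le⟩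
  · rw [h] at h1
    have : k.re = 0 := by nlinarith
    exact ⟨this, by rw [h, abs_zero]; exact hc.le⟩

lemma sq_add_sq_ne_zero {c b : ℝ} (hb : 0 ≤ b) (hbc : b ≤ c) (hc : 0 < c) {k : ℂ}
    (hk : k ∈ cutPlane c) : k ^ 2 + (b : ℂ) ^ 2 ≠ 0 := by
  intro h
  refine not_mem_cutPlane_of_sq (s := b ^ 2) hc (by positivity) (by gcongr) ?_ hk
  push_cast
  linear_combination h

/-- If the ratio equals some `r ≤ 0`, then `-k² = (a² - r c²)/(1 - r)` is a convex combination of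
`a²` and `c²`, which places `k` on the segment. -/
lemma ratio_mem_slitPlane {c a : ℝ} (ha : 0 < a) (hac : a < c) {k : ℂ} (hk : k ∈ cutPlane c) :
    (k ^ 2 + (a : ℂ) ^ 2) / (k ^ 2 + (c : ℂ) ^ 2) ∈ slitPlane := by
  have hc := ha.trans hac
  rw [mem_slitPlane_iff_not_le_zero]
  intro h
  obtain ⟨h1, h2⟩ := (Complex.le_def).1 h
  simp only [zero_re, zero_im] at h1 h2
  set r := ((k ^ 2 + (a : ℂ) ^ 2) / (k ^ 2 + (c : ℂ) ^ 2)).re with hr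
  have hz : (k ^ 2 + (a : ℂ) ^ 2) / (k ^ 2 + (c : ℂ) ^ 2) = (r : ℂ) := by
    apply Complex.ext <;> simp [hr, h2]
  rw [div_eq_iff (sq_add_sq_ne_zero hc.le le_rfl hc hk)] at hz
  have hr1 : 0 < 1 - r := by linarith
  refine not_mem_cutPlane_of_sq (s := (a ^ 2 - r * c ^ 2) / (1 - r)) hc ?_ ?_ ?_ hk
  · apply div_nonneg _ hr1.le
    nlinarith [sq_nonneg a, sq_nonneg c]
  · rw [div_le_iff₀ hr1]
    nlinarith
  · have : (1 - r : ℂ) ≠ 0 := by exact_mod_cast hr1.ne'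
    push_cast
    field_simp
    linear_combination hz

lemma sqrtRatio_neg (c a : ℝ) (k : ℂ) : sqrtRatio c a (-k) = sqrtRatio c a k := by
  simp [sqrtRatio]

lemma w_neg (c a : ℝ) (k : ℂ) : w c a (-k) = w c a k := by
  simp [w, sqrtRatio_neg]

lemma cpow_half_sq (z : ℂ) : (z ^ (1 / 2 : ℂ)) ^ 2 = z := by
  rw [one_div]
  exact_mod_cast cpow_nat_inv_pow z (n := 2) (by norm_num)

lemma sqrtRatio_sq (c a : ℝ) (k : ℂ) :
    sqrtRatio c a k ^ 2 = (k ^ 2 + (a : ℂ) ^ 2) / (k ^ 2 + (c : ℂ) ^ 2) := cpow_half_sq _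

lemma w_sq {c : ℝ} (a : ℝ) {k : ℂ} (hk : k ^ 2 + (c : ℂ) ^ 2 ≠ 0) :
    w c a k ^ 2 = (k ^ 2 + (a : ℂ) ^ 2) * (k ^ 2 + (c : ℂ) ^ 2) := by
  rw [w, mul_pow, sqrtRatio_sq]
  field_simp

lemma norm_w_sq_le (c a : ℝ) (k : ℂ) :
    ‖w c a k‖ ^ 2 ≤ ‖k ^ 2 + (a : ℂ) ^ 2‖ * ‖k ^ 2 + (c : ℂ) ^ 2‖ := by
  by_cases h : k ^ 2 + (c : ℂ) ^ 2 = 0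
  · simp [w, h]
  · rw [← norm_pow, w_sq a h, norm_mul]

lemma w_ne_zero {c a : ℝ} (ha : 0 < a) (hac : a < c) {k : ℂ} (hk : k ∈ cutPlane c) :
    w c a k ≠ 0 := by
  have hc := ha.trans hac
  have h1 := sq_add_sq_ne_zero ha.le hac.le hc hk
  have h2 := sq_add_sq_ne_zero hc.le le_rfl hc hk
  intro h
  have := w_sq a h2
  rw [h] at this
  exact mul_ne_zero h1 h2 (by rw [← this]; simp)

lemma sqrtRatio_ne_zero {c a : ℝ} (ha : 0 < a) (hac : a < c) {k : ℂ} (hk : k ∈ cutPlane c) :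
    sqrtRatio c a k ≠ 0 := fun h => w_ne_zero ha hac hk (by rw [w, h, mul_zero])

lemma differentiableOn_sqrtRatio {c a : ℝ} (ha : 0 < a) (hac : a < c) :
    DifferentiableOn ℂ (sqrtRatio c a) (cutPlane c) := by
  have hc := ha.trans hac
  intro k hk
  refine DifferentiableAt.differentiableWithinAt ?_
  unfold sqrtRatio
  refine DifferentiableAt.cpow ?_ (by fun_prop) (ratio_mem_slitPlane ha hac hk)
  exact DifferentiableAt.fun_div (by fun_prop) (by fun_prop) (sq_add_sq_ne_zero hc.le le_rfl hc hk)

lemma differentiableOn_w {c a : ℝ} (ha : 0 < a) (hac : a < c) :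
    DifferentiableOn ℂ (w c a) (cutPlane c) := by
  unfold w
  exact DifferentiableOn.fun_mul (by fun_prop) (differentiableOn_sqrtRatio ha hac)

lemma cpow_half_re_nonneg (z : ℂ) : 0 ≤ (z ^ (1 / 2 : ℂ)).re := by
  by_cases hz : z = 0
  · simp [hz]
  rw [cpow_def_of_ne_zero hz, exp_re]
  refine mul_nonneg (Real.exp_pos _).le (Real.cos_nonneg_of_mem_Icc ?_)
  have h : (log z * (1 / 2)).im = arg z / 2 := by
    rw [show (1 / 2 : ℂ) = ((1 / 2 : ℝ) : ℂ) by push_cast; rfl, im_mul_ofReal, log_im]; ring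
  rw [h]
  constructor
  · linarith [neg_pi_lt_arg z]
  · linarith [arg_le_pi z]

lemma cpow_half_re_pos {z : ℂ} (hz : z ∈ slitPlane) : 0 < (z ^ (1 / 2 : ℂ)).re := by
  rw [cpow_def_of_ne_zero (slitPlane_ne_zero hz), exp_re]
  refine mul_pos (Real.exp_pos _) (Real.cos_pos_of_mem_Ioo ?_)
  have h : (log z * (1 / 2)).im = arg z / 2 := by
    rw [show (1 / 2 : ℂ) = ((1 / 2 : ℝ) : ℂ) by push_cast; rfl, im_mul_ofReal, log_im]; ring
  have hz' := mem_slitPlane_iff_arg.1 hz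
  rw [h]
  constructor
  · linarith [neg_pi_lt_arg z]
  · have := lt_of_le_of_ne (arg_le_pi z) hz'.1
    linarith

lemma cpow_half_conj {z : ℂ} (hz : z ∈ slitPlane) :
    ((starRingEnd ℂ) z) ^ (1 / 2 : ℂ) = (starRingEnd ℂ) (z ^ (1 / 2 : ℂ)) := by
  rw [conj_cpow _ _ (mem_slitPlane_iff_arg.1 hz).1]
  congr 2
  rw [map_div₀, map_one, map_ofNat]

lemma cpow_half_ofReal {r : ℝ} (hr : 0 ≤ r) : (r : ℂ) ^ (1 / 2 : ℂ) = (Real.sqrt r : ℂ) := by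
  rw [Real.sqrt_eq_rpow, ofReal_cpow hr]
  simp

/-- Here `arg z = arg (-z) + π`. The right-hand side is continuous across the negative half-axis, so
it computes the boundary values of the principal root from above. -/
lemma cpow_half_eq_I_mul {z : ℂ} (hz : 0 < z.im ∨ z.re < 0 ∧ z.im = 0) :
    z ^ (1 / 2 : ℂ) = I * (-z) ^ (1 / 2 : ℂ) := by
  have hz0 : z ≠ 0 := by
    rintro rfl; simp at hz
  have hlog : log z = log (-z) + Real.pi * I := by
    rw [log, log, norm_neg]
    have : arg z = arg (-z) + Real.pi := by
      rcases hz with h | ⟨h1, h2⟩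
      · rw [arg_neg_eq_arg_sub_pi_of_im_pos h]; ring
      · have h3 : z = ((z.re : ℝ) : ℂ) := by apply Complex.ext <;> simp [h2]
        rw [h3, arg_ofReal_of_neg h1, ← ofReal_neg, arg_ofReal_of_nonneg (by linarith)]; ring
    rw [this]; push_cast; ring
  rw [cpow_def_of_ne_zero hz0, cpow_def_of_ne_zero (neg_ne_zero.2 hz0), hlog, add_mul, exp_add,
    mul_comm]
  congr 1
  rw [show (Real.pi : ℂ) * I * (1 / 2) = Real.pi / 2 * I by ring, exp_pi_div_two_mul_I]

lemma sqrtRatio_conj {c a : ℝ} (ha : 0 < a) (hac : a < c) {k : ℂ} (hk : k ∈ cutPlane c) :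
    sqrtRatio c a ((starRingEnd ℂ) k) = (starRingEnd ℂ) (sqrtRatio c a k) := by
  rw [sqrtRatio, sqrtRatio, ← cpow_half_conj (ratio_mem_slitPlane ha hac hk)]
  simp

lemma abs_lt_sq {c y : ℝ} (hy : |y| < c) : y ^ 2 < c ^ 2 := by
  rw [← sq_abs y]; nlinarith [abs_nonneg y]

/-- The limits of `sqrtRatio` on the gap. -/
lemma tendsto_sqrtRatio_gap {c a : ℝ} (hac : a < c) {y : ℝ} (hy : |y| < a) :
    Tendsto (sqrtRatio c a) (𝓝 (I * y)) (𝓝 (Real.sqrt ((a ^ 2 - y ^ 2) / (c ^ 2 - y ^ 2)) : ℂ)) := by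
  have h1 := abs_lt_sq hy
  have h2 := abs_lt_sq (hy.trans hac)
  have h0 : 0 < (a ^ 2 - y ^ 2) / (c ^ 2 - y ^ 2) := div_pos (by linarith) (by linarith)
  have hv : ((I * y) ^ 2 + (a : ℂ) ^ 2) / ((I * y) ^ 2 + (c : ℂ) ^ 2) =
      (((a ^ 2 - y ^ 2) / (c ^ 2 - y ^ 2) : ℝ) : ℂ) := by
    push_cast [mul_pow, I_sq]; ring
  have hne : (I * y : ℂ) ^ 2 + (c : ℂ) ^ 2 ≠ 0 := by
    have : (I * y : ℂ) ^ 2 + (c : ℂ) ^ 2 = ((c ^ 2 - y ^ 2 : ℝ) : ℂ) := by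
      push_cast [mul_pow, I_sq]; ring
    rw [this]; exact_mod_cast (by linarith : (c ^ 2 - y ^ 2 : ℝ) ≠ 0)
  rw [← cpow_half_ofReal h0.le, ← hv]
  have h3 : ContinuousAt (fun k : ℂ => (k ^ 2 + (a : ℂ) ^ 2) / (k ^ 2 + (c : ℂ) ^ 2)) (I * y) :=
    ContinuousAt.div (by fun_prop) (by fun_prop) hne
  refine (continuousAt_cpow_const ?_).tendsto.comp h3.tendsto
  rw [hv]
  exact ofReal_mem_slitPlane.2 h0

lemma tendsto_neg_conj (y : ℝ) :
    Tendsto (fun k : ℂ => -(starRingEnd ℂ) k) (𝓝[{k : ℂ | k.re < 0}] (I * y))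
      (𝓝[{k : ℂ | 0 < k.re}] (I * y)) := by
  refine tendsto_nhdsWithin_iff.2 ⟨?_, ?_⟩
  · have h : Continuous fun k : ℂ => -(starRingEnd ℂ) k := continuous_conj.neg
    have := h.tendsto (I * y)
    simp only [map_mul, conj_I, conj_ofReal, neg_mul, neg_neg] at this
    exact this.mono_left nhdsWithin_le_nhds
  · filter_upwards [self_mem_nhdsWithin] with k hk
    simpa using hk

lemma tendsto_neg_right (y : ℝ) :
    Tendsto (fun k : ℂ => -k) (𝓝[{k : ℂ | k.re < 0}] (I * y))
      (𝓝[{k : ℂ | 0 < k.re}] (I * (-y : ℝ))) := by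
  refine tendsto_nhdsWithin_iff.2 ⟨?_, ?_⟩
  · have := (continuous_neg (G := ℂ)).tendsto (I * y)
    simp only [← mul_neg] at this
    rw [ofReal_neg]
    exact this.mono_left nhdsWithin_le_nhds
  · filter_upwards [self_mem_nhdsWithin] with k hk
    simpa using hk

lemma tendsto_neg_left (y : ℝ) :
    Tendsto (fun k : ℂ => -k) (𝓝[{k : ℂ | 0 < k.re}] (I * y))
      (𝓝[{k : ℂ | k.re < 0}] (I * (-y : ℝ))) := by
  refine tendsto_nhdsWithin_iff.2 ⟨?_, ?_⟩
  · have := (continuous_neg (G := ℂ)).tendsto (I * y)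
    simp only [← mul_neg] at this
    rw [ofReal_neg]
    exact this.mono_left nhdsWithin_le_nhds
  · filter_upwards [self_mem_nhdsWithin] with k hk
    simpa using hk

/-- The ratio is `1 - (c² - a²)/(k² + c²)`, and `Im k² > 0` in the first quadrant. Thus the right
side of the upper band is reached through the upper half-plane, where `cpow_half_eq_I_mul` applies.
-/
lemma ratio_im_pos {c a : ℝ} (ha : 0 < a) (hac : a < c) {k : ℂ} (hk : 0 < k.re) (hk' : 0 < k.im)
    (h0 : k ^ 2 + (c : ℂ) ^ 2 ≠ 0) :
    0 < ((k ^ 2 + (a : ℂ) ^ 2) / (k ^ 2 + (c : ℂ) ^ 2)).im := by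
  have e : (k ^ 2 + (a : ℂ) ^ 2) / (k ^ 2 + (c : ℂ) ^ 2) =
      1 - ((c ^ 2 - a ^ 2 : ℝ) : ℂ) * (k ^ 2 + (c : ℂ) ^ 2)⁻¹ := by
    push_cast; field_simp; ring
  have h7 : (k ^ 2 + (c : ℂ) ^ 2).im = 2 * k.re * k.im := by
    rw [← ofReal_pow, add_im, ofReal_im, pow_two, mul_im]; ring
  have h8 : 0 < normSq (k ^ 2 + (c : ℂ) ^ 2) := normSq_pos.2 h0
  rw [e, sub_im, one_im, im_ofReal_mul, inv_im, h7]
  have h9 : 0 < (c ^ 2 - a ^ 2) * (2 * k.re * k.im / normSq (k ^ 2 + (c : ℂ) ^ 2)) :=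
    mul_pos (by nlinarith) (by positivity)
  rw [neg_div]
  linarith

lemma tendsto_sqrtRatio_band_right {c a : ℝ} (ha : 0 < a) {y : ℝ} (hy : a < y)
    (hyc : y < c) :
    Tendsto (sqrtRatio c a) (𝓝[{k : ℂ | 0 < k.re}] (I * y))
      (𝓝 (I * Real.sqrt ((y ^ 2 - a ^ 2) / (c ^ 2 - y ^ 2)))) := by
  have h1 : a ^ 2 < y ^ 2 := by nlinarith
  have h2 : y ^ 2 < c ^ 2 := by nlinarith
  have h0 : 0 < (y ^ 2 - a ^ 2) / (c ^ 2 - y ^ 2) := div_pos (by linarith) (by linarith)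
  have hcy : (I * y : ℂ) ^ 2 + (c : ℂ) ^ 2 = ((c ^ 2 - y ^ 2 : ℝ) : ℂ) := by
    push_cast [mul_pow, I_sq]; ring
  have hv : -(((I * y) ^ 2 + (a : ℂ) ^ 2) / ((I * y) ^ 2 + (c : ℂ) ^ 2)) =
      (((y ^ 2 - a ^ 2) / (c ^ 2 - y ^ 2) : ℝ) : ℂ) := by
    rw [hcy]
    push_cast [mul_pow, I_sq]; ring
  have hne : (I * y : ℂ) ^ 2 + (c : ℂ) ^ 2 ≠ 0 := by
    rw [hcy]; exact_mod_cast (by linarith : (c ^ 2 - y ^ 2 : ℝ) ≠ 0)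
  rw [← cpow_half_ofReal h0.le, ← hv]
  have h3' : ContinuousAt (fun k : ℂ => (k ^ 2 + (a : ℂ) ^ 2) / (k ^ 2 + (c : ℂ) ^ 2)) (I * y) :=
    ContinuousAt.div (by fun_prop) (by fun_prop) hne
  have h3 := h3'.neg
  have h4 : Tendsto (fun k : ℂ => I * (-((k ^ 2 + (a : ℂ) ^ 2) / (k ^ 2 + (c : ℂ) ^ 2))) ^ (1 / 2 : ℂ))
      (𝓝[{k : ℂ | 0 < k.re}] (I * y))
      (𝓝 (I * (-(((I * y) ^ 2 + (a : ℂ) ^ 2) / ((I * y) ^ 2 + (c : ℂ) ^ 2))) ^ (1 / 2 : ℂ))) := by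
    have h5 : ContinuousAt (fun z : ℂ => z ^ (1 / 2 : ℂ))
        (-(((I * y) ^ 2 + (a : ℂ) ^ 2) / ((I * y) ^ 2 + (c : ℂ) ^ 2))) := by
      rw [hv]
      exact continuousAt_cpow_const (ofReal_mem_slitPlane.2 h0)
    exact Tendsto.const_mul I ((h5.tendsto.comp h3.tendsto).mono_left nhdsWithin_le_nhds)
  refine h4.congr' ?_
  have h5 : ∀ᶠ k : ℂ in 𝓝 (I * y), 0 < k.im :=
    continuous_im.continuousAt.eventually_const_lt (by simpa using ha.trans hy)
  have h6 : ∀ᶠ k : ℂ in 𝓝 (I * y), k ^ 2 + (c : ℂ) ^ 2 ≠ 0 :=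
    (by fun_prop : Continuous fun k : ℂ => k ^ 2 + (c : ℂ) ^ 2).continuousAt.eventually_ne hne
  filter_upwards [self_mem_nhdsWithin, nhdsWithin_le_nhds h5, nhdsWithin_le_nhds h6] with k hk hk5 hk6
  have him := ratio_im_pos ha (hy.trans hyc) hk hk5 hk6
  exact (cpow_half_eq_I_mul (Or.inl him)).symm

/-- Reflection `k ↦ -k̄` in the imaginary axis conjugates the root and exchanges the two sides. -/
lemma tendsto_sqrtRatio_band_left {c a : ℝ} (ha : 0 < a) (hac : a < c) {y : ℝ} (hy : a < y)
    (hyc : y < c) :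
    Tendsto (sqrtRatio c a) (𝓝[{k : ℂ | k.re < 0}] (I * y))
      (𝓝 (-(I * Real.sqrt ((y ^ 2 - a ^ 2) / (c ^ 2 - y ^ 2))))) := by
  have h := (continuous_conj.tendsto _).comp
    ((tendsto_sqrtRatio_band_right ha hy hyc).comp (tendsto_neg_conj y))
  rw [map_mul, conj_I, conj_ofReal, neg_mul] at h
  refine h.congr' ?_
  filter_upwards [self_mem_nhdsWithin] with k hk
  have hkc : k ∈ cutPlane c := mem_cutPlane_of_re_ne_zero (ne_of_lt hk)
  simp only [Function.comp, sqrtRatio_neg]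
  rw [sqrtRatio_conj ha hac hkc, conj_conj]

/-- The one-sided limits of `sqrtRatio` on the two bands. -/
lemma tendsto_sqrtRatio_band {c a : ℝ} (ha : 0 < a) (hac : a < c) {y : ℝ} (hy : a < |y|)
    (hyc : |y| < c) : ∃ r : ℝ, 0 < r ∧
    Tendsto (sqrtRatio c a) (𝓝[{k : ℂ | 0 < k.re}] (I * y)) (𝓝 ((if 0 < y then I else -I) * r)) ∧
    Tendsto (sqrtRatio c a) (𝓝[{k : ℂ | k.re < 0}] (I * y))
      (𝓝 (-((if 0 < y then I else -I) * r))) := by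
  have h1 : a ^ 2 < y ^ 2 := by rw [← sq_abs y]; nlinarith
  have h2 := abs_lt_sq hyc
  refine ⟨Real.sqrt ((y ^ 2 - a ^ 2) / (c ^ 2 - y ^ 2)), Real.sqrt_pos.2
    (div_pos (by linarith) (by linarith)), ?_⟩
  by_cases hy0 : 0 < y
  · rw [abs_of_pos hy0] at hy hyc
    simp only [hy0, if_true]
    exact ⟨tendsto_sqrtRatio_band_right ha hy hyc, tendsto_sqrtRatio_band_left ha hac hy hyc⟩
  · rw [abs_of_nonpos (not_lt.1 hy0)] at hy hyc
    simp only [hy0, if_false]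
    have hr := tendsto_sqrtRatio_band_right ha hy hyc
    have hl := tendsto_sqrtRatio_band_left ha hac hy hyc
    rw [neg_sq] at hr hl
    refine ⟨?_, ?_⟩
    · rw [neg_mul]
      exact (hl.comp (tendsto_neg_left y)).congr fun k => sqrtRatio_neg c a k
    · rw [neg_mul, neg_neg]
      exact (hr.comp (tendsto_neg_right y)).congr fun k => sqrtRatio_neg c a k

/-- On the bands the one-sided limits of `w` are opposite. -/
lemma tendsto_w_band {c a : ℝ} (ha : 0 < a) (hac : a < c) {y : ℝ} (hy : a < |y|)
    (hyc : |y| < c) : ∃ l : ℂ, Tendsto (w c a) (𝓝[{k : ℂ | 0 < k.re}] (I * y)) (𝓝 l) ∧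
    Tendsto (w c a) (𝓝[{k : ℂ | k.re < 0}] (I * y)) (𝓝 (-l)) := by
  obtain ⟨r, -, h1, h2⟩ := tendsto_sqrtRatio_band ha hac hy hyc
  have h : Tendsto (fun k : ℂ => k ^ 2 + (c : ℂ) ^ 2) (𝓝 (I * y)) (𝓝 ((I * y) ^ 2 + (c : ℂ) ^ 2)) :=
    (by fun_prop : Continuous fun k : ℂ => k ^ 2 + (c : ℂ) ^ 2).tendsto _
  refine ⟨_, (h.mono_left nhdsWithin_le_nhds).mul h1, ?_⟩
  rw [← mul_neg]
  exact (h.mono_left nhdsWithin_le_nhds).mul h2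

lemma tendsto_w_gap {c a : ℝ} (hac : a < c) {y : ℝ} (hy : |y| < a) :
    ∃ l : ℂ, Tendsto (w c a) (𝓝 (I * y)) (𝓝 l) :=
  ⟨_, ((by fun_prop : Continuous fun k : ℂ => k ^ 2 + (c : ℂ) ^ 2).tendsto _).mul
    (tendsto_sqrtRatio_gap hac hy)⟩

/-- `sqrtRatio` as a function of `1/k²`. -/
lemma sqrtRatio_eq_of_ne_zero (c a : ℝ) {k : ℂ} (hk : k ≠ 0) :
    sqrtRatio c a k = ((1 + (a : ℂ) ^ 2 * (k ^ 2)⁻¹) / (1 + (c : ℂ) ^ 2 * (k ^ 2)⁻¹)) ^ (1 / 2 : ℂ) := by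
  rw [sqrtRatio]
  congr 1
  have h : k ^ 2 ≠ 0 := pow_ne_zero 2 hk
  rw [← mul_div_mul_left (1 + (a : ℂ) ^ 2 * (k ^ 2)⁻¹) _ h]
  congr 1 <;> field_simp

lemma tendsto_inv_sq_cobounded :
    Tendsto (fun k : ℂ => (k ^ 2)⁻¹) (Bornology.cobounded ℂ) (𝓝 0) :=
  tendsto_inv₀_cobounded.comp (tendsto_pow_cobounded_cobounded (by norm_num))

lemma eventually_ne_zero_cobounded : ∀ᶠ k : ℂ in Bornology.cobounded ℂ, k ≠ 0 :=
  Filter.mem_of_superset (cutPlane_mem_cobounded 1) fun _ hk => ne_zero_of_mem_cutPlane one_pos hk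

lemma tendsto_sqrtRatio_cobounded (c a : ℝ) :
    Tendsto (sqrtRatio c a) (Bornology.cobounded ℂ) (𝓝 1) := by
  have h : ContinuousAt (fun X : ℂ => ((1 + (a : ℂ) ^ 2 * X) / (1 + (c : ℂ) ^ 2 * X)) ^ (1 / 2 : ℂ)) 0 := by
    refine ContinuousAt.comp (g := fun z : ℂ => z ^ (1 / 2 : ℂ)) (continuousAt_cpow_const (by simp))
      (ContinuousAt.div (by fun_prop) (by fun_prop) (by simp))
  have h2 := h.tendsto.comp tendsto_inv_sq_cobounded
  simp only [mul_zero, add_zero, div_one, one_cpow] at h2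
  refine h2.congr' ?_
  filter_upwards [eventually_ne_zero_cobounded] with k hk
  exact (sqrtRatio_eq_of_ne_zero c a hk).symm

lemma tendsto_w_div_sq (c a : ℝ) :
    Tendsto (fun k => w c a k / k ^ 2) (Bornology.cobounded ℂ) (𝓝 1) := by
  have h1 : Tendsto (fun k : ℂ => 1 + (c : ℂ) ^ 2 * (k ^ 2)⁻¹) (Bornology.cobounded ℂ) (𝓝 1) := by
    simpa using (tendsto_inv_sq_cobounded.const_mul ((c : ℂ) ^ 2)).const_add 1
  have h2 := h1.mul (tendsto_sqrtRatio_cobounded c a)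
  rw [mul_one] at h2
  refine h2.congr' ?_
  filter_upwards [eventually_ne_zero_cobounded] with k hk
  rw [w]
  field_simp

/-! ### The product of two model solutions -/

lemma vecMul_modelJump_band {a : ℝ} (ha : 0 < a) (Λ : ℂ) {y : ℝ} (hy : a < |y|) (m : Fin 2 → ℂ) :
    Matrix.vecMul m (modelJump a Λ y) =
      ![(if 0 < y then I else -I) * m 1, (if 0 < y then I else -I) * m 0] := by
  rcases lt_abs.1 hy with h | h
  · have h0 : 0 < y := ha.trans h
    funext i
    fin_cases i <;> simp [modelJump, h, h0, Matrix.vecMul, dotProduct, mul_comm]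
  · have h0 : ¬ 0 < y := by linarith
    have h1 : ¬ a < y := by linarith
    have h2 : y < -a := by linarith
    funext i
    fin_cases i <;> simp [modelJump, h0, h1, h2, Matrix.vecMul, dotProduct, mul_comm]

lemma vecMul_modelJump_gap {a : ℝ} (Λ : ℂ) {y : ℝ} (hy : |y| < a) (m : Fin 2 → ℂ) :
    Matrix.vecMul m (modelJump a Λ y) = ![exp (-I * Λ) * m 0, exp (I * Λ) * m 1] := by
  have h := abs_lt.1 hy
  have h1 : ¬ a < y := by linarith
  have h2 : ¬ y < -a := by linarith
  funext i
  fin_cases i <;> simp [modelJump, h1, h2, Matrix.vecMul, dotProduct, mul_comm]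

lemma symmetry_apply {c a : ℝ} {Λ : ℂ} {m : ℂ → Fin 2 → ℂ} (hm : IsModelSolution c a Λ m) {k : ℂ}
    (hk : k ∈ cutPlane c) : m (-k) 0 = m k 1 ∧ m (-k) 1 = m k 0 := by
  rw [hm.symmetry k hk]
  constructor <;> simp [Matrix.vecMul, dotProduct]

/-- Two singularities of order 1/4 multiply to order 1/2, which is below 1 and hence removable. -/
lemma tendsto_sub_mul_of_isBigO {c : ℝ} {κ : ℂ} {f g h : ℂ → ℂ}
    (hf : f =O[𝓝[cutPlane c] κ] fun k => ‖k - κ‖ ^ (-(1 / 4) : ℝ))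
    (hg : g =O[𝓝[cutPlane c] κ] fun k => ‖k - κ‖ ^ (-(1 / 4) : ℝ))
    (hh : h =O[𝓝[cutPlane c] κ] fun _ => (1 : ℝ)) :
    Tendsto (fun k => (k - κ) * (f k * g k * h k)) (𝓝[cutPlane c] κ) (𝓝 0) := by
  have h1 : (fun k : ℂ => k - κ) =O[𝓝[cutPlane c] κ] fun k => ‖k - κ‖ :=
    (isBigO_refl _ _).norm_right
  have h2 := h1.mul ((hf.mul hg).mul hh)
  have h3 : (fun k : ℂ => ‖k - κ‖ * (‖k - κ‖ ^ (-(1 / 4) : ℝ) * ‖k - κ‖ ^ (-(1 / 4) : ℝ) * 1))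
      = fun k : ℂ => ‖k - κ‖ ^ (1 / 2 : ℝ) := by
    funext k
    rcases (norm_nonneg (k - κ)).eq_or_lt with h0 | h0
    · rw [← h0]; norm_num
    · nth_rw 1 [← Real.rpow_one ‖k - κ‖]
      rw [mul_one, ← Real.rpow_add h0, ← Real.rpow_add h0]; norm_num
  rw [h3] at h2
  refine h2.trans_tendsto ?_
  have h4 : Continuous fun k : ℂ => ‖k - κ‖ ^ (1 / 2 : ℝ) :=
    (by fun_prop : Continuous fun k : ℂ => ‖k - κ‖).rpow_const fun _ => Or.inr (by norm_num)
  have h5 := (h4.tendsto κ).mono_left (nhdsWithin_le_nhds (s := cutPlane c))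
  simpa using h5

lemma singularity_apply {c a : ℝ} {Λ : ℂ} {m : ℂ → Fin 2 → ℂ} (hm : IsModelSolution c a Λ m)
    {κ : ℂ} (hκ : κ ∈ branchPoints c a) (i : Fin 2) :
    (fun k => m k i) =O[𝓝[cutPlane c] κ] fun k => ‖k - κ‖ ^ (-(1 / 4) : ℝ) :=
  (IsBigO.of_bound 1 (.of_forall fun k => by
    rw [one_mul]; exact norm_le_pi_norm (m k) i)).trans (hm.singularity κ hκ)

lemma holomorphic_apply {c a : ℝ} {Λ : ℂ} {m : ℂ → Fin 2 → ℂ} (hm : IsModelSolution c a Λ m)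
    (i : Fin 2) : DifferentiableOn ℂ (fun k => m k i) (cutPlane c) :=
  differentiableOn_pi.1 hm.holomorphic i

lemma normalization_apply {c a : ℝ} {Λ : ℂ} {m : ℂ → Fin 2 → ℂ} (hm : IsModelSolution c a Λ m)
    (i : Fin 2) : Tendsto (fun k => m k i) (Bornology.cobounded ℂ) (𝓝 1) := by
  have := tendsto_pi_nhds.1 hm.normalization i
  fin_cases i <;> simpa using this

/-- Two model solutions are pointwise proportional. -/
lemma det_eq_zero {c a : ℝ} {Λ : ℂ} (ha : 0 < a) (hac : a < c) {m n : ℂ → Fin 2 → ℂ}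
    (hm : IsModelSolution c a Λ m) (hn : IsModelSolution c a Λ n) :
    EqOn (fun k => m k 0 * n k 1) (fun k => m k 1 * n k 0) (cutPlane c) := by
  obtain ⟨H, hH, hHf⟩ := exists_entire_extension (c := c) (a := a) ha.le hac.le
    (f := fun k => m k 0 * n k 1 - m k 1 * n k 0)
    (((holomorphic_apply hm 0).mul (holomorphic_apply hn 1)).sub
      ((holomorphic_apply hm 1).mul (holomorphic_apply hn 0))) (by
    intro y hy hya
    obtain ⟨mp, mm, hmp, hmm, hmj⟩ := hm.jump y hy hya
    obtain ⟨np, nm, hnp, hnm, hnj⟩ := hn.jump y hy hya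
    rw [tendsto_pi_nhds] at hmp hmm hnp hnm
    refine ⟨mm 0 * nm 1 - mm 1 * nm 0, ?_, ((hmm 0).mul (hnm 1)).sub ((hmm 1).mul (hnm 0))⟩
    -- Both kinds of jump matrices have determinant one: `e^{-iΛ} e^{iΛ} = 1` on the gap, `-(±i)² =
    -- 1` on the bands.
    have e : mm 0 * nm 1 - mm 1 * nm 0 = mp 0 * np 1 - mp 1 * np 0 := by
      rcases lt_or_gt_of_ne hya with h | h
      · rw [vecMul_modelJump_gap Λ h] at hmj hnj
        have he : exp (-I * Λ) * exp (I * Λ) = 1 := by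
          rw [← exp_add]; simp
        simp only [hmj, hnj, Matrix.cons_val_zero, Matrix.cons_val_one]
        linear_combination (mm 1 * nm 0 - mm 0 * nm 1) * he
      · rw [vecMul_modelJump_band ha Λ h] at hmj hnj
        simp only [hmj, hnj, Matrix.cons_val_zero, Matrix.cons_val_one]
        have he : (if 0 < y then I else -I) ^ 2 = -1 := by split_ifs <;> simp
        linear_combination (mm 0 * nm 1 - mm 1 * nm 0) * he
    rw [e]
    exact ((hmp 0).mul (hnp 1)).sub ((hmp 1).mul (hnp 0))) (by
    intro κ hκ
    have h1 := tendsto_sub_mul_of_isBigO (singularity_apply hm hκ 0) (singularity_apply hn hκ 1)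
      (h := fun _ => 1) (isBigO_refl _ _ |>.trans (isBigO_const_const _ one_ne_zero _))
    have h2 := tendsto_sub_mul_of_isBigO (singularity_apply hm hκ 1) (singularity_apply hn hκ 0)
      (h := fun _ => 1) (isBigO_refl _ _ |>.trans (isBigO_const_const _ one_ne_zero _))
    have := h1.sub h2
    rw [sub_zero] at this
    exact this.congr fun k => by ring)
  have hlim : Tendsto H (cocompact ℂ) (𝓝 0) := by
    rw [← Metric.cobounded_eq_cocompact]
    have := ((normalization_apply hm 0).mul (normalization_apply hn 1)).sub
      ((normalization_apply hm 1).mul (normalization_apply hn 0))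
    simp only [mul_one, sub_self] at this
    refine this.congr' ?_
    filter_upwards [cutPlane_mem_cobounded c] with k hk
    exact (hHf hk).symm
  intro k hk
  have := hH.apply_eq_of_tendsto_cocompact k hlim
  rw [hHf hk] at this
  exact sub_eq_zero.1 this

lemma differentiable_dslope {H : ℂ → ℂ} (hH : Differentiable ℂ H) (z : ℂ) :
    Differentiable ℂ (dslope H z) := by
  rw [← differentiableOn_univ] at hH ⊢
  exact (differentiableOn_dslope univ_mem).2 hH

/-- An even entire function asymptotic to `k²` is `k² - μ`. -/
lemma exists_eq_sq_sub {H : ℂ → ℂ} (hH : Differentiable ℂ H) (heven : H (-1) = H 1)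
    (hlim : Tendsto (fun k => H k / k ^ 2) (Bornology.cobounded ℂ) (𝓝 1)) :
    ∃ μ : ℂ, ∀ k, H k = k ^ 2 - μ := by
  set G := dslope H 0
  set G' := dslope G 0
  have h1 : ∀ k, k ≠ 0 → H k = H 0 + k * G 0 + k ^ 2 * G' k := by
    intro k hk
    have e1 : G k = k⁻¹ * (H k - H 0) := by
      simp [G, dslope_of_ne _ hk, slope_def_field, div_eq_inv_mul]
    have e2 : G' k = k⁻¹ * (G k - G 0) := by
      simp [G', dslope_of_ne _ hk, slope_def_field, div_eq_inv_mul]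
    rw [e2, e1]
    field_simp
    ring
  have hinv : Tendsto (fun k : ℂ => k⁻¹) (Bornology.cobounded ℂ) (𝓝 0) := tendsto_inv₀_cobounded
  have h2 : Tendsto G' (Bornology.cobounded ℂ) (𝓝 1) := by
    have h3 := hlim.sub ((tendsto_inv_sq_cobounded.const_mul (H 0)).add (hinv.const_mul (G 0)))
    simp only [mul_zero, add_zero, sub_zero] at h3
    refine h3.congr' ?_
    filter_upwards [eventually_ne_zero_cobounded] with k hk
    rw [h1 k hk]
    field_simp
    ring
  rw [Metric.cobounded_eq_cocompact] at h2
  -- `G'` is what remains of `H / k²` after the constant and linear Taylor terms are removed; it is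
  -- entire with limit 1 at infinity, so Liouville's theorem applies.
  have h4 : ∀ k, G' k = 1 := fun k =>
    (differentiable_dslope (differentiable_dslope hH 0) 0).apply_eq_of_tendsto_cocompact k h2
  have h5 : G 0 = 0 := by
    have e1 := h1 1 one_ne_zero
    have e2 := h1 (-1) (by norm_num)
    rw [h4] at e1 e2
    linear_combination (-1 / 2 : ℂ) * e1 + (1 / 2 : ℂ) * e2 - (1 / 2 : ℂ) * heven
  refine ⟨-H 0, fun k => ?_⟩
  by_cases hk : k = 0
  · simp [hk]
  · rw [h1 k hk, h4, h5]; ring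

/-- For two model solutions `m`, `n`, the function `m₁ n₂ w` is a polynomial `k² - μ`. -/
lemma exists_mul_mul_w_eq {c a : ℝ} {Λ : ℂ} (ha : 0 < a) (hac : a < c) {m n : ℂ → Fin 2 → ℂ}
    (hm : IsModelSolution c a Λ m) (hn : IsModelSolution c a Λ n) :
    ∃ μ : ℂ, ∀ k ∈ cutPlane c, m k 0 * n k 1 * w c a k = k ^ 2 - μ := by
  have hdet := det_eq_zero ha hac hm hn
  obtain ⟨H, hH, hHf⟩ := exists_entire_extension (c := c) (a := a) ha.le hac.le
    (f := fun k => m k 0 * n k 1 * w c a k)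
    (((holomorphic_apply hm 0).mul (holomorphic_apply hn 1)).mul (differentiableOn_w ha hac)) (by
    intro y hy hya
    obtain ⟨mp, mm, hmp, hmm, hmj⟩ := hm.jump y hy hya
    obtain ⟨np, nm, hnp, hnm, hnj⟩ := hn.jump y hy hya
    rw [tendsto_pi_nhds] at hmp hmm hnp hnm
    rcases lt_or_gt_of_ne hya with h | h
    · rw [vecMul_modelJump_gap Λ h] at hmj hnj
      obtain ⟨l, hl⟩ := tendsto_w_gap hac h
      refine ⟨mm 0 * nm 1 * l, ?_, ((hmm 0).mul (hnm 1)).mul (hl.mono_left nhdsWithin_le_nhds)⟩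
      have he : exp (-I * Λ) * exp (I * Λ) = 1 := by
        rw [← exp_add]; simp
      have e : mm 0 * nm 1 = mp 0 * np 1 := by
        simp only [hmj, hnj, Matrix.cons_val_zero, Matrix.cons_val_one]
        linear_combination (-(mm 0 * nm 1)) * he
      rw [e]
      exact ((hmp 0).mul (hnp 1)).mul (hl.mono_left nhdsWithin_le_nhds)
    · rw [vecMul_modelJump_band ha Λ h] at hmj hnj
      obtain ⟨l, hl1, hl2⟩ := tendsto_w_band ha hac h hy
      refine ⟨mm 0 * nm 1 * (-l), ?_, ((hmm 0).mul (hnm 1)).mul hl2⟩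
      have hne : (𝓝[{k : ℂ | k.re < 0}] (I * y)).NeBot := by
        have := closure_setOfPred_re_lt 0
        rw [← mem_closure_iff_nhdsWithin_neBot, this]
        simp
      -- The jump on a band turns `m₁ n₂` into `-m₂ n₁`. Proportionality of the two solutions turns
      -- this back into `-m₁ n₂`, and the sign is absorbed by `w`.
      have hd : mm 0 * nm 1 = mm 1 * nm 0 := by
        refine tendsto_nhds_unique ((hmm 0).mul (hnm 1)) (((hmm 1).mul (hnm 0)).congr' ?_)
        filter_upwards [self_mem_nhdsWithin] with k hk
        exact (hdet (mem_cutPlane_of_re_ne_zero (ne_of_lt hk))).symm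
      have he : (if 0 < y then I else -I) ^ 2 = -1 := by split_ifs <;> simp
      have e : mm 0 * nm 1 * (-l) = mp 0 * np 1 * l := by
        simp only [hmj, hnj, Matrix.cons_val_zero, Matrix.cons_val_one]
        linear_combination (-l) * hd - (mm 1 * nm 0 * l) * he
      rw [e]
      exact ((hmp 0).mul (hnp 1)).mul hl1) (by
    intro κ hκ
    refine tendsto_sub_mul_of_isBigO (singularity_apply hm hκ 0) (singularity_apply hn hκ 1) ?_
    have hcont : Continuous fun k : ℂ => Real.sqrt (‖k ^ 2 + (a : ℂ) ^ 2‖ * ‖k ^ 2 + (c : ℂ) ^ 2‖) := by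
      fun_prop
    refine IsBigO.trans (IsBigO.of_bound 1 (.of_forall fun k => ?_))
      (((hcont.tendsto κ).mono_left nhdsWithin_le_nhds).isBigO_one ℝ)
    rw [one_mul, Real.norm_of_nonneg (Real.sqrt_nonneg _)]
    exact Real.le_sqrt_of_sq_le (norm_w_sq_le c a k))
  have heven : H (-1) = H 1 := by
    have h1 : (1 : ℂ) ∈ cutPlane c := mem_cutPlane_of_re_ne_zero (by simp)
    rw [hHf h1, hHf (neg_mem_cutPlane h1)]
    simp only [(symmetry_apply hm h1).1, (symmetry_apply hn h1).2, w_neg]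
    have := hdet h1
    simp only at this
    rw [this]
  have hlim : Tendsto (fun k => H k / k ^ 2) (Bornology.cobounded ℂ) (𝓝 1) := by
    have := ((normalization_apply hm 0).mul (normalization_apply hn 1)).mul (tendsto_w_div_sq c a)
    simp only [mul_one] at this
    refine this.congr' ?_
    filter_upwards [cutPlane_mem_cobounded c] with k hk
    rw [hHf hk, mul_div_assoc]
  obtain ⟨μ, hμ⟩ := exists_eq_sq_sub hH heven hlim
  exact ⟨μ, fun k hk => by rw [← hμ k]; exact (hHf hk).symm⟩

/-- The zero of the product `m₁ m₂` is the same for all model solutions. -/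
lemma zero_unique {c a : ℝ} {Λ : ℂ} (ha : 0 < a) (hac : a < c) {m n : ℂ → Fin 2 → ℂ}
    (hm : IsModelSolution c a Λ m) (hn : IsModelSolution c a Λ n) {μ ν : ℂ}
    (hμ : ∀ k ∈ cutPlane c, m k 0 * m k 1 * w c a k = k ^ 2 - μ)
    (hν : ∀ k ∈ cutPlane c, n k 0 * n k 1 * w c a k = k ^ 2 - ν) : μ = ν := by
  obtain ⟨κ, hκ⟩ := exists_mul_mul_w_eq ha hac hm hn
  have hdet := det_eq_zero ha hac hm hn
  -- Proportionality gives `(m₁ n₂)² = (m₁ m₂)(n₁ n₂)`. The resulting identity of polynomials in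
  -- `k²`, evaluated at `k² = 1` and `k² = 4`, yields `2κ = μ + ν` and then `(μ - ν)² = 0`.
  have key : ∀ x : ℝ, x ≠ 0 → ((x : ℂ) ^ 2 - κ) ^ 2 = ((x : ℂ) ^ 2 - μ) * ((x : ℂ) ^ 2 - ν) := by
    intro x hx
    have hk : (x : ℂ) ∈ cutPlane c := mem_cutPlane_of_re_ne_zero (by simpa using hx)
    rw [← hκ _ hk, ← hμ _ hk, ← hν _ hk]
    have := hdet hk
    simp only at this
    linear_combination (m x 0 * n x 1 * w c a x ^ 2) * this
  have h1 := key 1 one_ne_zero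
  have h2 := key 2 two_ne_zero
  push_cast at h1 h2
  have h3 : 2 * κ = μ + ν := by linear_combination (1 / 3 : ℂ) * (h1 - h2)
  have h4 : (μ - ν) ^ 2 = 0 := by
    linear_combination (4 - (2 * κ + μ + ν)) * h3 + 4 * h1
  exact sub_eq_zero.1 (pow_eq_zero_iff two_ne_zero |>.1 h4)

/-! ### The elliptic integral on the unit disc -/


/-- The principal branch of `√(1 - E η²)`. -/
def root (E η : ℂ) : ℂ := (1 - E * η ^ 2) ^ (1 / 2 : ℂ)

/-- `√((1 - E η²)(1 - conj E η²))`, holomorphic in the unit disc for `|E| = 1`. -/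
def quarticRoot (E η : ℂ) : ℂ := root E η * root ((starRingEnd ℂ) E) η

/-- The elliptic integral `∫_0^η dζ / √((1 - E ζ²)(1 - conj E ζ²))`. -/
def ellInt (E η : ℂ) : ℂ := ∫ s in (0 : ℝ)..1, η / quarticRoot E (s * η)

lemma root_sq (E η : ℂ) : root E η ^ 2 = 1 - E * η ^ 2 := cpow_half_sq _

lemma root_neg (E η : ℂ) : root E (-η) = root E η := by simp [root]

lemma quarticRoot_neg (E η : ℂ) : quarticRoot E (-η) = quarticRoot E η := by
  simp [quarticRoot, root_neg]

lemma quarticRoot_zero (E : ℂ) : quarticRoot E 0 = 1 := by simp [quarticRoot, root]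

lemma quarticRoot_conj_left (E : ℂ) : quarticRoot ((starRingEnd ℂ) E) = quarticRoot E := by
  funext η
  rw [quarticRoot, conj_conj, mul_comm, quarticRoot]

lemma ellInt_conj_left (E : ℂ) : ellInt ((starRingEnd ℂ) E) = ellInt E := by
  funext η
  rw [ellInt, quarticRoot_conj_left, ellInt]

lemma quarticRoot_sq (E η : ℂ) :
    quarticRoot E η ^ 2 = (1 - E * η ^ 2) * (1 - (starRingEnd ℂ) E * η ^ 2) := by
  rw [quarticRoot, mul_pow, root_sq, root_sq]

lemma ellInt_neg (E η : ℂ) : ellInt E (-η) = -ellInt E η := by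
  rw [ellInt, ellInt, ← intervalIntegral.integral_neg]
  congr 1
  funext s
  rw [mul_neg, quarticRoot_neg, neg_div]

lemma ellInt_zero (E : ℂ) : ellInt E 0 = 0 := by simp [ellInt]

lemma norm_mul_sq_le {E : ℂ} (hE : ‖E‖ = 1) {η : ℂ} (hη : η ∈ 𝔻c) : ‖E * η ^ 2‖ ≤ 1 := by
  rw [norm_mul, hE, norm_pow, one_mul]
  exact pow_le_one₀ (norm_nonneg _) (mem_closedBall_zero_iff.1 hη)

lemma one_sub_re_nonneg {E : ℂ} (hE : ‖E‖ = 1) {η : ℂ} (hη : η ∈ 𝔻c) : 0 ≤ (1 - E * η ^ 2).re := by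
  have := (re_le_norm (E * η ^ 2)).trans (norm_mul_sq_le hE hη)
  simp only [sub_re, one_re]
  linarith

lemma one_sub_mem_slitPlane {E : ℂ} (hE : ‖E‖ = 1) {η : ℂ} (hη : η ∈ 𝔻c) (h : E * η ^ 2 ≠ 1) :
    1 - E * η ^ 2 ∈ slitPlane := by
  rw [mem_slitPlane_iff]
  by_contra! h0
  have h1 := one_sub_re_nonneg hE hη
  refine h ?_
  have h2 : (1 - E * η ^ 2) = 0 := by
    apply Complex.ext
    · exact le_antisymm h0.1 h1
    · exact h0.2
  exact (sub_eq_zero.1 h2).symm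

lemma mul_sq_ne_one {E : ℂ} (hE : ‖E‖ = 1) {η : ℂ} (hη : η ∈ 𝔻) : E * η ^ 2 ≠ 1 := by
  intro h
  have h2 := congrArg norm h
  rw [norm_mul, hE, norm_pow, norm_one, one_mul] at h2
  have := pow_lt_one₀ (norm_nonneg η) (mem_ball_zero_iff.1 hη) two_ne_zero
  linarith

lemma continuousOn_root {E : ℂ} (hE : ‖E‖ = 1) : ContinuousOn (root E) 𝔻c := by
  intro η hη
  refine ContinuousAt.continuousWithinAt ?_
  refine ContinuousAt.comp (g := fun z : ℂ => z ^ (1 / 2 : ℂ))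
    (continuousAt_cpow_const_of_re_pos (Or.inl (one_sub_re_nonneg hE hη)) (by simp)) (by fun_prop)

lemma hasDerivAt_root {E : ℂ} (hE : ‖E‖ = 1) {η : ℂ} (hη : η ∈ 𝔻c) (h : E * η ^ 2 ≠ 1) :
    HasDerivAt (root E) (-(E * η) / root E η) η := by
  have hs := one_sub_mem_slitPlane hE hη h
  have h1 : HasDerivAt (fun η : ℂ => 1 - E * η ^ 2) (-(E * (2 * η))) η := by
    simpa using ((hasDerivAt_pow 2 η).const_mul E).const_sub 1
  have h2 := h1.cpow_const (c := (1 / 2 : ℂ)) hs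
  have hr : root E η ≠ 0 := by
    intro h0
    have := root_sq E η
    rw [h0] at this
    exact slitPlane_ne_zero hs (by rw [← this]; simp)
  refine h2.congr_deriv ?_
  have h3 : (1 - E * η ^ 2) ^ (1 / 2 - 1 : ℂ) = (root E η)⁻¹ := by
    rw [cpow_sub _ _ (slitPlane_ne_zero hs), cpow_one, ← root_sq E η, root_sq, ← root]
    rw [div_eq_iff (slitPlane_ne_zero hs), ← root_sq E η]
    field_simp
  rw [h3]
  field_simp

lemma norm_conj_eq_one {E : ℂ} (hE : ‖E‖ = 1) : ‖(starRingEnd ℂ) E‖ = 1 := by rw [norm_conj, hE]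

lemma continuousOn_quarticRoot {E : ℂ} (hE : ‖E‖ = 1) : ContinuousOn (quarticRoot E) 𝔻c :=
  (continuousOn_root hE).mul (continuousOn_root (norm_conj_eq_one hE))

lemma quarticRoot_ne_zero_iff {E : ℂ} {η : ℂ} : quarticRoot E η ≠ 0 ↔
    E * η ^ 2 ≠ 1 ∧ (starRingEnd ℂ) E * η ^ 2 ≠ 1 := by
  rw [← pow_ne_zero_iff two_ne_zero, quarticRoot_sq, mul_ne_zero_iff, sub_ne_zero, sub_ne_zero,
    ne_comm, ne_comm (a := (1 : ℂ))]

lemma quarticRoot_ne_zero {E : ℂ} (hE : ‖E‖ = 1) {η : ℂ} (hη : η ∈ 𝔻) : quarticRoot E η ≠ 0 :=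
  quarticRoot_ne_zero_iff.2 ⟨mul_sq_ne_one hE hη, mul_sq_ne_one (norm_conj_eq_one hE) hη⟩

lemma differentiableOn_quarticRoot {E : ℂ} (hE : ‖E‖ = 1) : DifferentiableOn ℂ (quarticRoot E) 𝔻 := by
  intro η hη
  have h1 := hasDerivAt_root hE (Metric.ball_subset_closedBall hη) (mul_sq_ne_one hE hη)
  have h2 := hasDerivAt_root (norm_conj_eq_one hE) (Metric.ball_subset_closedBall hη)
    (mul_sq_ne_one (norm_conj_eq_one hE) hη)
  exact (h1.differentiableAt.mul h2.differentiableAt).differentiableWithinAt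

lemma root_conj {E : ℂ} (hE : ‖E‖ = 1) {η : ℂ} (hη : η ∈ 𝔻c) :
    root ((starRingEnd ℂ) E) ((starRingEnd ℂ) η) = (starRingEnd ℂ) (root E η) := by
  have e : 1 - (starRingEnd ℂ) E * (starRingEnd ℂ) η ^ 2 = (starRingEnd ℂ) (1 - E * η ^ 2) := by
    simp
  rw [root, root, e]
  by_cases h : E * η ^ 2 = 1
  · simp [h]
  · exact cpow_half_conj (one_sub_mem_slitPlane hE hη h)

lemma quarticRoot_conj {E : ℂ} (hE : ‖E‖ = 1) {η : ℂ} (hη : η ∈ 𝔻c) :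
    quarticRoot E ((starRingEnd ℂ) η) = (starRingEnd ℂ) (quarticRoot E η) := by
  rw [quarticRoot, quarticRoot, map_mul, ← root_conj hE hη,
    ← root_conj (norm_conj_eq_one hE) hη, conj_conj, mul_comm]

lemma real_mul_mem {η : ℂ} (hη : η ∈ 𝔻c) {s : ℝ} (hs : s ∈ Icc (0 : ℝ) 1) : (s * η : ℂ) ∈ 𝔻c := by
  rw [mem_closedBall_zero_iff] at *
  rw [norm_mul, norm_real, Real.norm_of_nonneg hs.1]
  exact mul_le_one₀ hs.2 (norm_nonneg _) hη

lemma ellInt_conj {E : ℂ} (hE : ‖E‖ = 1) {η : ℂ} (hη : η ∈ 𝔻c) :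
    ellInt E ((starRingEnd ℂ) η) = (starRingEnd ℂ) (ellInt E η) := by
  rw [ellInt, ellInt, intervalIntegral.integral_of_le zero_le_one,
    intervalIntegral.integral_of_le zero_le_one, ← integral_conj]
  refine setIntegral_congr_fun measurableSet_Ioc fun s hs => ?_
  replace hs : s ∈ Icc (0 : ℝ) 1 := Ioc_subset_Icc_self hs
  have := quarticRoot_conj hE (real_mul_mem hη hs)
  simp only [map_mul, conj_ofReal, map_div₀] at this ⊢
  rw [this]

/-- The two factors of the quartic cannot both be small: `E - Ē = E(1 - Ēu) - Ē(1 - Eu)`, so the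
larger one is at least `|E - Ē|/2`, while each is at least `1 - s`. This provides the integrable
majorant `(1 - s)^(-1/2)`, uniformly in `η`. -/
lemma le_norm_quarticRoot_sq {E : ℂ} (hE : ‖E‖ = 1) {η : ℂ} (hη : η ∈ 𝔻c) {s : ℝ} (hs : s ∈ Icc (0 : ℝ) 1) :
    ‖E - (starRingEnd ℂ) E‖ / 2 * (1 - s) ≤ ‖quarticRoot E (s * η)‖ ^ 2 := by
  rw [← norm_pow, quarticRoot_sq, norm_mul]
  set u : ℂ := (s * η) ^ 2
  have hu : ‖u‖ ≤ s := by
    have : ‖(s : ℂ) * η‖ ≤ s := by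
      rw [norm_mul, norm_real, Real.norm_of_nonneg hs.1]
      exact mul_le_of_le_one_right hs.1 (mem_closedBall_zero_iff.1 hη)
    rw [norm_pow]
    nlinarith [norm_nonneg ((s : ℂ) * η), hs.2]
  have key : ∀ e : ℂ, ‖e‖ = 1 → 1 - s ≤ ‖1 - e * u‖ := by
    intro e he
    have := norm_sub_norm_le (1 : ℂ) (e * u)
    rw [norm_one, norm_mul, he, one_mul] at this
    linarith
  have h1 := key E hE
  have h2 := key _ (norm_conj_eq_one hE)
  have h3 : ‖E - (starRingEnd ℂ) E‖ ≤ ‖1 - E * u‖ + ‖1 - (starRingEnd ℂ) E * u‖ := by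
    have e : E - (starRingEnd ℂ) E = E * (1 - (starRingEnd ℂ) E * u) -
        (starRingEnd ℂ) E * (1 - E * u) := by ring
    rw [e]
    refine (norm_sub_le _ _).trans ?_
    rw [norm_mul, norm_mul, hE, norm_conj_eq_one hE]
    linarith
  have hs1 : 0 ≤ 1 - s := by linarith [hs.2]
  rcases le_total ‖1 - E * u‖ ‖1 - (starRingEnd ℂ) E * u‖ with h | h
  · have : ‖E - (starRingEnd ℂ) E‖ / 2 ≤ ‖1 - (starRingEnd ℂ) E * u‖ := by linarith
    rw [mul_comm ‖1 - E * u‖]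
    exact mul_le_mul this h1 hs1 (norm_nonneg _)
  · have : ‖E - (starRingEnd ℂ) E‖ / 2 ≤ ‖1 - E * u‖ := by linarith
    exact mul_le_mul this h2 hs1 (norm_nonneg _)

/-- Dominated convergence on the radial segment works up to the unit circle, corners included. -/
lemma continuousOn_ellInt {E : ℂ} (hE : ‖E‖ = 1) (hE' : E ≠ (starRingEnd ℂ) E) : ContinuousOn (ellInt E) 𝔻c := by
  set δ := ‖E - (starRingEnd ℂ) E‖ / 2 with hδ
  have hδ0 : 0 < δ := half_pos (norm_pos_iff.2 (sub_ne_zero.2 hE'))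
  have hpos : ∀ η ∈ 𝔻c, ∀ s ∈ Ioo (0 : ℝ) 1, Real.sqrt (δ * (1 - s)) ≤ ‖quarticRoot E (s * η)‖ := by
    intro η hη s hs
    exact Real.sqrt_le_iff.2 ⟨norm_nonneg _, le_norm_quarticRoot_sq hE hη (Ioo_subset_Icc_self hs)⟩
  have hne1 : ∀ᵐ s : ℝ, s ≠ 1 := by
    rw [ae_iff]; simp
  intro η₀ hη₀
  refine intervalIntegral.continuousWithinAt_of_dominated_interval
    (bound := fun s => (Real.sqrt δ)⁻¹ * (1 - s) ^ (-(1 / 2) : ℝ)) ?_ ?_ ?_ ?_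
  · refine .of_forall fun η => ?_
    refine Measurable.aestronglyMeasurable ?_
    unfold quarticRoot root
    fun_prop
  · filter_upwards [self_mem_nhdsWithin] with η hη
    filter_upwards [hne1] with s hs1 hs
    rw [uIoc_of_le zero_le_one] at hs
    have hs' : s ∈ Ioo (0 : ℝ) 1 := ⟨hs.1, lt_of_le_of_ne hs.2 hs1⟩
    have h1 := hpos η hη s hs'
    have h2 : 0 < 1 - s := by linarith [hs'.2]
    rw [Real.rpow_neg h2.le, ← Real.sqrt_eq_rpow, ← mul_inv, ← Real.sqrt_mul hδ0.le, norm_div]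
    rw [div_eq_mul_inv]
    have h3 : 0 < Real.sqrt (δ * (1 - s)) := Real.sqrt_pos.2 (by positivity)
    calc ‖η‖ * ‖quarticRoot E (s * η)‖⁻¹ ≤ 1 * (Real.sqrt (δ * (1 - s)))⁻¹ := by
          gcongr
          exact mem_closedBall_zero_iff.1 hη
      _ = _ := one_mul _
  · have := intervalIntegral.intervalIntegrable_rpow' (r := (-(1 / 2) : ℝ)) (a := 0) (b := 1) (by norm_num)
    have h2 := (this.comp_sub_left 1).symm
    simp only [sub_zero, sub_self] at h2
    exact h2.const_mul _
  · filter_upwards [hne1] with s hs1 hs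
    rw [uIoc_of_le zero_le_one] at hs
    have hs' : s ∈ Ioo (0 : ℝ) 1 := ⟨hs.1, lt_of_le_of_ne hs.2 hs1⟩
    have h1 := hpos η₀ hη₀ s hs'
    have h3 : 0 < Real.sqrt (δ * (1 - s)) := Real.sqrt_pos.2 (mul_pos hδ0 (by linarith [hs'.2]))
    refine ContinuousWithinAt.div continuousWithinAt_id ?_ (norm_pos_iff.1 (h3.trans_le h1))
    exact ((continuousOn_quarticRoot hE).comp (by fun_prop : ContinuousOn (fun η : ℂ => (s : ℂ) * η) 𝔻c)
      fun η hη => real_mul_mem hη (Ioo_subset_Icc_self hs')) η₀ hη₀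

lemma hasDerivAt_ellInt {E : ℂ} (hE : ‖E‖ = 1) {η : ℂ} (hη : η ∈ 𝔻) :
    HasDerivAt (ellInt E) (1 / quarticRoot E η) η := by
  have hd : DifferentiableOn ℂ (fun η => 1 / quarticRoot E η) 𝔻 :=
    DifferentiableOn.fun_div (differentiableOn_const 1) (differentiableOn_quarticRoot hE)
      fun z hz => quarticRoot_ne_zero hE hz
  obtain ⟨G, hG0, hG⟩ := hd.isExactOn_ball.with_val_at 0 0
  have heq : ∀ z ∈ 𝔻, ellInt E z = G z := by
    intro z hz
    have hmem : ∀ s ∈ uIcc (0 : ℝ) 1, (s * z : ℂ) ∈ 𝔻 := by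
      intro s hs
      rw [uIcc_of_le zero_le_one] at hs
      rw [mem_ball_zero_iff] at *
      rw [norm_mul, norm_real, Real.norm_of_nonneg hs.1]
      exact (mul_le_of_le_one_left (norm_nonneg _) hs.2).trans_lt hz
    have hder : ∀ s ∈ uIcc (0 : ℝ) 1, HasDerivAt (fun s : ℝ => G (s * z)) (z / quarticRoot E (s * z)) s := by
      intro s hs
      have h1 : HasDerivAt (fun s : ℝ => (s * z : ℂ)) z s := by
        simpa using (ofRealCLM.hasDerivAt (x := s)).mul_const z
      have h2 := (hG _ (hmem s hs)).comp s h1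
      refine h2.congr_deriv ?_
      ring
    have hcont : ContinuousOn (fun s : ℝ => z / quarticRoot E (s * z)) (uIcc 0 1) := by
      refine ContinuousOn.div continuousOn_const ?_ fun s hs => quarticRoot_ne_zero hE (hmem s hs)
      exact (differentiableOn_quarticRoot hE).continuousOn.comp (by fun_prop) hmem
    rw [ellInt, intervalIntegral.integral_eq_sub_of_hasDerivAt hder hcont.intervalIntegrable]
    simp [hG0]
  exact (hG η hη).congr_of_eventuallyEq
    (Filter.eventuallyEq_of_mem (Metric.isOpen_ball.mem_nhds hη) heq)

/-- The derivative `1/S` extends continuously to boundary points other than the corners, and on a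
convex set such a limit of derivatives is the derivative at the boundary point. It serves to
differentiate along the unit circle. -/
lemma hasFDerivWithinAt_ellInt {E : ℂ} (hE : ‖E‖ = 1) (hE' : E ≠ (starRingEnd ℂ) E) {η : ℂ} (hη : η ∈ 𝔻c)
    (h : quarticRoot E η ≠ 0) :
    HasFDerivWithinAt (ellInt E) (ContinuousLinearMap.mul ℝ ℂ (1 / quarticRoot E η)) 𝔻c η := by
  have hcl : closure 𝔻 = 𝔻c := closure_ball _ one_ne_zero
  have hfd : ∀ z ∈ 𝔻, HasFDerivAt (ellInt E) (ContinuousLinearMap.mul ℝ ℂ (1 / quarticRoot E z)) z := by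
    intro z hz
    have := (hasDerivAt_ellInt hE hz).hasFDerivAt.restrictScalars ℝ
    refine this.congr_fderiv ?_
    ext x
    simp [mul_comm]
  have := hasFDerivWithinAt_closure_of_tendsto_fderiv (f := ellInt E) (s := 𝔻) (x := η)
    (f' := ContinuousLinearMap.mul ℝ ℂ (1 / quarticRoot E η))
    (fun z hz => (hfd z hz).differentiableAt.differentiableWithinAt) (convex_ball 0 1)
    Metric.isOpen_ball (fun y hy => by
      rw [hcl] at hy
      exact (continuousOn_ellInt hE hE' y hy).mono Metric.ball_subset_closedBall) (by
      have h1 : Tendsto (fun z => 1 / quarticRoot E z) (𝓝[𝔻] η) (𝓝 (1 / quarticRoot E η)) :=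
        (tendsto_const_nhds.div ((continuousOn_quarticRoot hE η hη).mono
          Metric.ball_subset_closedBall) h)
      refine (((ContinuousLinearMap.mul ℝ ℂ).continuous.tendsto _).comp h1).congr' ?_
      filter_upwards [self_mem_nhdsWithin] with z hz
      exact (hfd z hz).fderiv.symm)
  rwa [hcl] at this

/-- The derivative of the elliptic integral along a curve in the closed disc. -/
lemma hasDerivAt_ellInt_comp {E : ℂ} (hE : ‖E‖ = 1) (hE' : E ≠ (starRingEnd ℂ) E) {γ : ℝ → ℂ} {γ' : ℂ} {y : ℝ}
    (hγ : HasDerivAt γ γ' y) (hmem : ∀ᶠ x in 𝓝 y, γ x ∈ 𝔻c) (h : quarticRoot E (γ y) ≠ 0) :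
    HasDerivAt (fun x => ellInt E (γ x)) (γ' / quarticRoot E (γ y)) y := by
  have h1 := hasFDerivWithinAt_ellInt hE hE' hmem.self_of_nhds h
  have h2 := h1.comp_hasDerivWithinAt (t := 𝔻c) (s := {x | γ x ∈ 𝔻c}) y hγ.hasDerivWithinAt
    (fun x hx => hx)
  have h3 := h2.hasDerivAt hmem
  refine h3.congr_deriv ?_
  simp [div_eq_inv_mul]

/-- Near a corner `ρ` the elliptic integral behaves like a square root. -/
lemma quarticRoot_isBigO_of_mul_sq_eq_one {E ρ : ℂ} (hE : ‖E‖ = 1) (hE' : E ≠ (starRingEnd ℂ) E)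
    (hρ : E * ρ ^ 2 = 1) :
    quarticRoot E =O[𝓝[𝔻c] ρ] fun η => ellInt E η - ellInt E ρ := by
  have hEc := norm_conj_eq_one hE
  have hρ1 : ‖ρ‖ = 1 := by
    have := congrArg norm hρ
    rw [norm_mul, hE, one_mul, norm_pow, norm_one] at this
    exact (pow_eq_one_iff_of_nonneg (norm_nonneg _) two_ne_zero).1 this
  have hρc : ρ ∈ 𝔻c := by rw [mem_closedBall_zero_iff, hρ1]
  have hρ0 : ρ ≠ 0 := by rintro rfl; simp at hρ1
  have hE0 : E ≠ 0 := by rintro rfl; simp at hE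
  have h2ρ : (starRingEnd ℂ) E * ρ ^ 2 ≠ 1 := by
    intro h
    exact hE' (mul_right_cancel₀ (pow_ne_zero 2 hρ0) (hρ.trans h.symm))
  set r₂ := root ((starRingEnd ℂ) E) with hr₂
  have hr₂ρ : r₂ ρ ≠ 0 := by
    intro h0
    have := root_sq ((starRingEnd ℂ) E) ρ
    rw [← hr₂, h0] at this
    exact h2ρ (by linear_combination this)
  -- `φ / q` is the derivative of the elliptic integral minus its leading part `-(ρ / r₂ ρ) q`. The
  -- constant is chosen so that `φ ρ = 0`, using `E ρ² = 1`.
  set φ : ℂ → ℂ := fun η => 1 / r₂ η - ρ * E * η / r₂ ρ with hφ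
  have hφρ : φ ρ = 0 := by
    simp only [hφ]
    rw [show ρ * E * ρ = 1 by linear_combination hρ, sub_self]
  have hφd : DifferentiableAt ℂ φ ρ := by
    have := (hasDerivAt_root hEc hρc h2ρ).differentiableAt
    exact ((differentiableAt_const 1).fun_div this hr₂ρ).sub (by fun_prop)
  obtain ⟨M, hM0, hM⟩ := hφd.isBigO_sub.exists_pos
  rw [isBigOWith_iff] at hM
  simp only [hφρ, sub_zero] at hM
  obtain ⟨r, hr0, hr⟩ := Metric.eventually_nhds_iff_ball.1 hM
  set r' := min r 1 with hr'
  have hr'0 : 0 < r' := lt_min hr0 one_pos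
  set q := root E with hq
  have hqn : ∀ η ∈ Metric.ball ρ r', ‖η - ρ‖ ≤ ‖q η‖ ^ 2 := by
    intro η hη
    have hη1 : ‖η - ρ‖ < 1 := by
      rw [← dist_eq_norm]; exact (Metric.mem_ball.1 hη).trans_le (min_le_right _ _)
    rw [← norm_pow, hq, root_sq]
    have e : 1 - E * η ^ 2 = E * ((ρ - η) * (2 * ρ + (η - ρ))) := by
      linear_combination -hρ
    rw [e, norm_mul, hE, one_mul, norm_mul, norm_sub_rev ρ η]
    have h1 : 1 ≤ ‖2 * ρ + (η - ρ)‖ := by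
      have := norm_sub_norm_le (2 * ρ) (-(η - ρ))
      rw [sub_neg_eq_add, norm_mul, hρ1, norm_neg] at this
      norm_num at this
      linarith
    exact le_mul_of_one_le_right (norm_nonneg _) h1
  set G : ℂ → ℂ := fun η => ellInt E η + ρ / r₂ ρ * q η with hG
  have hGd : ∀ η ∈ Metric.ball ρ r' ∩ 𝔻, HasDerivWithinAt G (φ η / q η) (Metric.ball ρ r' ∩ 𝔻) η := by
    intro η hη
    have h1 := hasDerivAt_ellInt hE hη.2
    have h2 := hasDerivAt_root hE (Metric.ball_subset_closedBall hη.2) (mul_sq_ne_one hE hη.2)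
    refine ((h1.add (h2.const_mul (ρ / r₂ ρ))).congr_deriv ?_).hasDerivWithinAt
    have h3 := quarticRoot_ne_zero hE hη.2
    rw [quarticRoot, mul_ne_zero_iff] at h3
    have h4 := h3.1
    have h5 := h3.2
    rw [← hq] at h4
    rw [← hr₂] at h5
    simp only [hφ, quarticRoot, ← hq, ← hr₂]
    field_simp
    ring
  have hGc : ContinuousOn G 𝔻c :=
    (continuousOn_ellInt hE hE').add (continuousOn_const.mul (continuousOn_root hE))
  -- `|φ| ≤ M |η - ρ|`, and `|η - ρ| ≤ |q|²` with `|η - ρ| < 1` gives `|η - ρ| ≤ |q|`; so `φ / q` is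
  -- bounded by `M`.
  have hlip : LipschitzOnWith M.toNNReal G (Metric.ball ρ r' ∩ 𝔻) := by
    refine Convex.lipschitzOnWith_of_nnnorm_hasDerivWithin_le
      ((convex_ball _ _).inter (convex_ball _ _)) hGd fun η hη => ?_
    rw [← NNReal.coe_le_coe, coe_nnnorm, Real.coe_toNNReal _ hM0.le, norm_div]
    have h1 := hr η (Metric.ball_subset_ball (min_le_left _ _) hη.1)
    have h2 := hqn η hη.1
    have h3 : ‖η - ρ‖ < 1 := by
      rw [← dist_eq_norm]; exact (Metric.mem_ball.1 hη.1).trans_le (min_le_right _ _)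
    refine div_le_of_le_mul₀ (norm_nonneg _) hM0.le (h1.trans (mul_le_mul_of_nonneg_left ?_ hM0.le))
    by_contra! h4
    nlinarith [norm_nonneg (q η), norm_nonneg (η - ρ)]
  have hsub : Metric.ball ρ r' ∩ 𝔻c ⊆ closure (Metric.ball ρ r' ∩ 𝔻) := by
    rw [← closure_ball (0 : ℂ) one_ne_zero]
    exact Metric.isOpen_ball.inter_closure
  have hsub2 : closure (Metric.ball ρ r' ∩ 𝔻) ⊆ 𝔻c := by
    rw [← closure_ball (0 : ℂ) one_ne_zero]
    exact closure_mono inter_subset_right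
  have hlip2 := hlip.closure (hGc.mono hsub2)
  have hqρ : q ρ = 0 := by simp [hq, root, hρ]
  set β := ‖ρ / r₂ ρ‖ with hβ
  have hβ0 : 0 < β := norm_pos_iff.2 (div_ne_zero hρ0 hr₂ρ)
  have hq0 : Tendsto (fun η => ‖q η‖) (𝓝[𝔻c] ρ) (𝓝 0) := by
    have := (continuousOn_root hE ρ hρc).norm.tendsto
    rwa [← hq, hqρ, norm_zero] at this
  have hqO : q =O[𝓝[𝔻c] ρ] fun η => ellInt E η - ellInt E ρ := by
    refine IsBigO.of_bound (β / 2)⁻¹ ?_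
    filter_upwards [self_mem_nhdsWithin, nhdsWithin_le_nhds (Metric.ball_mem_nhds ρ hr'0),
      hq0.eventually_lt_const (show 0 < β / (2 * M) by positivity)] with η hη hηr hηq
    have h1 := hlip2.dist_le_mul η (hsub ⟨hηr, hη⟩) ρ (hsub ⟨Metric.mem_ball_self hr'0, hρc⟩)
    rw [Real.coe_toNNReal _ hM0.le, dist_eq_norm, dist_eq_norm] at h1
    simp only [hG, hqρ, mul_zero, add_zero] at h1
    have h2 : ‖ρ / r₂ ρ * q η‖ ≤ ‖ellInt E η - ellInt E ρ‖ +
        ‖ellInt E η + ρ / r₂ ρ * q η - ellInt E ρ‖ := by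
      have := norm_sub_le (ellInt E η + ρ / r₂ ρ * q η - ellInt E ρ) (ellInt E η - ellInt E ρ)
      rw [add_comm]
      refine le_trans (le_of_eq ?_) this
      congr 1
      ring
    rw [norm_mul, ← hβ] at h2
    have h3 := hqn η hηr
    rw [lt_div_iff₀ (by positivity)] at hηq
    -- The Lipschitz error is at most `M |q|²`, which is absorbed by half of the leading term `β
    -- |q|` once `|q| < β / (2M)`.
    have h4 : M * ‖η - ρ‖ ≤ β / 2 * ‖q η‖ := by
      nlinarith [mul_le_mul_of_nonneg_left h3 hM0.le, norm_nonneg (q η)]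
    rw [← div_eq_inv_mul, le_div_iff₀ (by positivity)]
    nlinarith
  have hr₂O : r₂ =O[𝓝[𝔻c] ρ] fun _ => (1 : ℝ) :=
    (continuousOn_root hEc ρ hρc).isBigO_one ℝ
  have := hqO.mul (hr₂O.trans (isBigO_const_const (1 : ℝ) (one_ne_zero (α := ℂ)) _))
  simpa [quarticRoot, ← hq, ← hr₂] using! this

lemma quarticRoot_isBigO {E ρ : ℂ} (hE : ‖E‖ = 1) (hE' : E ≠ (starRingEnd ℂ) E)
    (hρ : quarticRoot E ρ = 0) :
    quarticRoot E =O[𝓝[𝔻c] ρ] fun η => ellInt E η - ellInt E ρ := by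
  have h := mt quarticRoot_ne_zero_iff.2 (not_not.2 hρ)
  rw [not_and_or, not_not, not_not] at h
  rcases h with h | h
  · exact quarticRoot_isBigO_of_mul_sq_eq_one hE hE' h
  · have := quarticRoot_isBigO_of_mul_sq_eq_one (norm_conj_eq_one hE)
      (by rw [conj_conj]; exact hE'.symm) h
    rwa [quarticRoot_conj_left, ellInt_conj_left] at this

/-! ### The conformal map of `ℂ ∖ [ic, -ic]` onto the punctured unit disc -/

/-- The inverse of `η ↦ (c/2)(1/η - η)` with values in the unit disc. -/
def discMap (c : ℝ) (k : ℂ) : ℂ := c / (k * ((1 + (c : ℂ) ^ 2 / k ^ 2) ^ (1 / 2 : ℂ) + 1))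

lemma one_add_div_mem_slitPlane {c : ℝ} (hc : 0 < c) {k : ℂ} (hk : k ∈ cutPlane c) :
    1 + (c : ℂ) ^ 2 / k ^ 2 ∈ slitPlane := by
  have hk0 := ne_zero_of_mem_cutPlane hc hk
  rw [mem_slitPlane_iff_not_le_zero]
  intro h
  obtain ⟨h1, h2⟩ := (Complex.le_def).1 h
  simp only [zero_re, zero_im] at h1 h2
  set r := (1 + (c : ℂ) ^ 2 / k ^ 2).re with hr
  have hz : 1 + (c : ℂ) ^ 2 / k ^ 2 = (r : ℂ) := by
    apply Complex.ext
    · rw [hr, ofReal_re]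
    · rw [h2, ofReal_im]
  have hr1 : 0 < 1 - r := by linarith
  refine not_mem_cutPlane_of_sq (s := c ^ 2 / (1 - r)) hc (by positivity) ?_ ?_ hk
  · exact div_le_self (by positivity) (by linarith)
  · have : (1 - r : ℂ) ≠ 0 := by exact_mod_cast hr1.ne'
    push_cast
    field_simp at hz ⊢
    linear_combination hz

section
variable {c : ℝ}

lemma discMap_aux (hc : 0 < c) {k : ℂ} (hk : k ∈ cutPlane c) :
    ∃ r : ℂ, 0 < r.re ∧ r ^ 2 = 1 + (c : ℂ) ^ 2 / k ^ 2 ∧ r + 1 ≠ 0 ∧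
      discMap c k = c / (k * (r + 1)) := by
  refine ⟨_, cpow_half_re_pos (one_add_div_mem_slitPlane hc hk), cpow_half_sq _, ?_, rfl⟩
  intro h
  have h1 := congrArg re h
  have h2 := cpow_half_re_pos (one_add_div_mem_slitPlane hc hk)
  simp only [add_re, one_re, zero_re] at h1
  linarith

lemma discMap_ne_zero (hc : 0 < c) {k : ℂ} (hk : k ∈ cutPlane c) : discMap c k ≠ 0 := by
  obtain ⟨r, -, -, h1, h⟩ := discMap_aux hc hk
  rw [h]
  exact div_ne_zero (by exact_mod_cast hc.ne') (mul_ne_zero (ne_zero_of_mem_cutPlane hc hk) h1)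

lemma two_mul_discMap (hc : 0 < c) {k : ℂ} (hk : k ∈ cutPlane c) :
    2 * k * discMap c k = c * (1 - discMap c k ^ 2) := by
  obtain ⟨r, -, h2, h1, h⟩ := discMap_aux hc hk
  have hk0 := ne_zero_of_mem_cutPlane hc hk
  rw [h]
  field_simp at h2 ⊢
  linear_combination (-c : ℂ) * h2

/-- With `r = √(1 + c²/k²)` one has `η² = (r - 1)/(r + 1)`, and this Cayley transform takes `Re r >
0` into the unit disc. -/
lemma discMap_mem (hc : 0 < c) {k : ℂ} (hk : k ∈ cutPlane c) : discMap c k ∈ 𝔻 := by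
  obtain ⟨r, h0, h2, h1, h⟩ := discMap_aux hc hk
  have hk0 := ne_zero_of_mem_cutPlane hc hk
  have hsq : discMap c k ^ 2 * (r + 1) = r - 1 := by
    rw [h]
    field_simp at h2 ⊢
    linear_combination -h2
  have hn := congrArg norm hsq
  rw [norm_mul, norm_pow] at hn
  have h3 : ‖r - 1‖ < ‖r + 1‖ := by
    rw [← sq_lt_sq₀ (norm_nonneg _) (norm_nonneg _), ← normSq_eq_norm_sq, ← normSq_eq_norm_sq,
      normSq_apply, normSq_apply]
    simp
    nlinarith
  rw [mem_ball_zero_iff]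
  by_contra! h4
  have h5 : 1 ≤ ‖discMap c k‖ ^ 2 := one_le_pow₀ h4
  nlinarith [norm_nonneg (r + 1)]

lemma discMap_neg (k : ℂ) : discMap c (-k) = -discMap c k := by
  simp [discMap, div_neg]

lemma differentiableOn_discMap (hc : 0 < c) : DifferentiableOn ℂ (discMap c) (cutPlane c) := by
  intro k hk
  have hk0 := ne_zero_of_mem_cutPlane hc hk
  have hs := one_add_div_mem_slitPlane hc hk
  have h1 : DifferentiableAt ℂ (fun k : ℂ => 1 + (c : ℂ) ^ 2 / k ^ 2) k :=
    by
    fun_prop (disch := exact pow_ne_zero 2 hk0)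
  have h2 : DifferentiableAt ℂ (fun k : ℂ => (1 + (c : ℂ) ^ 2 / k ^ 2) ^ (1 / 2 : ℂ)) k :=
    h1.cpow (by fun_prop) hs
  have h3 : k * ((1 + (c : ℂ) ^ 2 / k ^ 2) ^ (1 / 2 : ℂ) + 1) ≠ 0 := by
    intro h
    exact discMap_ne_zero hc hk (by rw [discMap, h, div_zero])
  have h4 : DifferentiableAt ℂ (fun k : ℂ => k * ((1 + (c : ℂ) ^ 2 / k ^ 2) ^ (1 / 2 : ℂ) + 1)) k :=
    differentiableAt_id.mul (h2.add_const 1)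
  exact ((differentiableAt_const (c : ℂ)).fun_div h4 h3).differentiableWithinAt

lemma tendsto_mul_discMap (c : ℝ) :
    Tendsto (fun k => k * discMap c k) (Bornology.cobounded ℂ) (𝓝 (c / 2)) := by
  have h : ContinuousAt (fun X : ℂ => (c : ℂ) / ((1 + (c : ℂ) ^ 2 * X) ^ (1 / 2 : ℂ) + 1)) 0 := by
    have h1 : ContinuousAt (fun X : ℂ => (1 + (c : ℂ) ^ 2 * X) ^ (1 / 2 : ℂ)) 0 :=
      ContinuousAt.comp (g := fun z : ℂ => z ^ (1 / 2 : ℂ)) (continuousAt_cpow_const (by simp))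
        (by fun_prop)
    refine ContinuousAt.div continuousAt_const (h1.add continuousAt_const) ?_
    norm_num
  have h2 := h.tendsto.comp tendsto_inv_sq_cobounded
  have e : (1 + 1 : ℂ) = 2 := by norm_num
  simp only [mul_zero, add_zero, one_cpow, e] at h2
  refine h2.congr' ?_
  filter_upwards [eventually_ne_zero_cobounded] with k hk
  simp only [Function.comp, discMap, ← div_eq_mul_inv]
  rw [← mul_div_assoc, mul_div_mul_left _ _ hk]

lemma tendsto_discMap_cobounded (c : ℝ) : Tendsto (discMap c) (Bornology.cobounded ℂ) (𝓝 0) := by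
  have h := (tendsto_inv₀_cobounded (α := ℂ)).mul (tendsto_mul_discMap c)
  rw [zero_mul] at h
  refine h.congr' ?_
  filter_upwards [eventually_ne_zero_cobounded] with k hk
  field_simp

/-- For `k = iy` the real and imaginary parts of the relation leave two cases, `Re η = 0` or `y = -c
Im η`. Inside the disc the first forces `|y| > c`, and the second forces `|η| = 1`. -/
lemma mem_cutPlane_of_disc (hc : 0 < c) {k η : ℂ} (hη : η ∈ 𝔻) (h : 2 * k * η = c * (1 - η ^ 2)) :
    k ∈ cutPlane c := by
  rintro ⟨h1, h2⟩
  have hk : k = I * k.im := by apply Complex.ext <;> simp [h1]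
  rw [hk] at h
  have hre := congrArg re h
  have him := congrArg im h
  simp [pow_two] at hre him
  set y := k.im
  set u := η.re
  set v := η.im
  have hn : u ^ 2 + v ^ 2 < 1 := by
    have := mem_ball_zero_iff.1 hη
    have h3 : ‖η‖ ^ 2 < 1 := pow_lt_one₀ (norm_nonneg _) this two_ne_zero
    rw [← normSq_eq_norm_sq, normSq_apply] at h3
    nlinarith
  have hy := abs_le.1 h2
  have h4 : u * (y + c * v) = 0 := by linarith
  rcases mul_eq_zero.1 h4 with h5 | h5
  · rw [h5] at hre hn
    rcases le_total 0 v with hv | hv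
    · have h6 : 0 < (1 - v) ^ 2 := by
        have : 1 - v ≠ 0 := by intro h; nlinarith
        positivity
      nlinarith [mul_nonneg hv (by linarith [hy.1] : 0 ≤ y + c), mul_pos hc h6]
    · have h6 : 0 < (1 + v) ^ 2 := by
        have : 1 + v ≠ 0 := by intro h; nlinarith
        positivity
      nlinarith [mul_nonneg (neg_nonneg.2 hv) (by linarith [hy.2] : 0 ≤ c - y), mul_pos hc h6]
  · have h6 : y = -(c * v) := by linarith
    rw [h6] at hre
    have : c * (1 - u ^ 2 - v ^ 2) = 0 := by nlinarith
    rcases mul_eq_zero.1 this with h7 | h7 <;> linarith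

/-! ### Boundary values of the conformal map -/

/-- The point of the unit circle that corresponds to `iy` on the right side of the segment. -/
def rightPt (c y : ℝ) : ℂ := (Real.sqrt (c ^ 2 - y ^ 2) - I * y) / c

lemma two_mul_rightPt (hc : 0 < c) {y : ℝ} (hy : |y| ≤ c) :
    2 * (I * y) * rightPt c y = c * (1 - rightPt c y ^ 2) := by
  have h0 : 0 ≤ c ^ 2 - y ^ 2 := by
    rw [← sq_abs y]; nlinarith [abs_nonneg y]
  have h : (Real.sqrt (c ^ 2 - y ^ 2) : ℂ) ^ 2 = c ^ 2 - y ^ 2 := by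
    exact_mod_cast Real.sq_sqrt h0
  have hc0 : (c : ℂ) ≠ 0 := by exact_mod_cast hc.ne'
  rw [rightPt]
  field_simp
  linear_combination h - y ^ 2 * I_sq

lemma norm_rightPt (hc : 0 < c) {y : ℝ} (hy : |y| ≤ c) : ‖rightPt c y‖ = 1 := by
  have h0 : 0 ≤ c ^ 2 - y ^ 2 := by
    rw [← sq_abs y]; nlinarith [abs_nonneg y]
  rw [rightPt, norm_div, norm_real, Real.norm_of_nonneg hc.le, div_eq_one_iff_eq hc.ne']
  rw [← sq_eq_sq₀ (norm_nonneg _) hc.le, ← normSq_eq_norm_sq, normSq_apply]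
  simp
  rw [Real.mul_self_sqrt h0]
  ring

lemma rightPt_mem (hc : 0 < c) {y : ℝ} (hy : |y| ≤ c) : rightPt c y ∈ 𝔻c := by
  rw [mem_closedBall_zero_iff, norm_rightPt hc hy]

lemma rightPt_ne_zero (hc : 0 < c) {y : ℝ} (hy : |y| ≤ c) : rightPt c y ≠ 0 := by
  rw [← norm_ne_zero_iff, norm_rightPt hc hy]; exact one_ne_zero

lemma rightPt_conj (c y : ℝ) : (starRingEnd ℂ) (rightPt c y) = rightPt c (-y) := by
  simp [rightPt]

lemma continuous_rightPt (c : ℝ) : Continuous (rightPt c) := by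
  unfold rightPt
  fun_prop

lemma hasDerivAt_rightPt (hc : 0 < c) {y : ℝ} (hy : |y| < c) :
    HasDerivAt (rightPt c) (-I * rightPt c y / Real.sqrt (c ^ 2 - y ^ 2)) y := by
  have h0 : 0 < c ^ 2 - y ^ 2 := by have := abs_lt_sq hy; linarith
  have hs := (Real.sqrt_pos.2 h0).ne'
  have hc0 : (c : ℂ) ≠ 0 := by exact_mod_cast hc.ne'
  have hs0 : (Real.sqrt (c ^ 2 - y ^ 2) : ℂ) ≠ 0 := by exact_mod_cast hs
  have h1 : HasDerivAt (fun y : ℝ => Real.sqrt (c ^ 2 - y ^ 2)) (-(2 * y) / (2 * Real.sqrt (c ^ 2 - y ^ 2))) y := by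
    have : HasDerivAt (fun y : ℝ => c ^ 2 - y ^ 2) (-(2 * y)) y := by
      simpa using (hasDerivAt_pow 2 y).const_sub (c ^ 2)
    exact this.sqrt h0.ne'
  have h2 := (h1.ofReal_comp.sub ((hasDerivAt_id y).ofReal_comp.const_mul I)).div_const (c : ℂ)
  refine h2.congr_deriv ?_
  have h : (Real.sqrt (c ^ 2 - y ^ 2) : ℂ) ^ 2 = c ^ 2 - y ^ 2 := by
    exact_mod_cast Real.sq_sqrt h0.le
  rw [rightPt]
  push_cast
  field_simp
  linear_combination (-y : ℂ) * I_sq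

lemma exists_eq_rightPt (hc : 0 < c) {η : ℂ} (hη : ‖η‖ = 1) (hre : 0 ≤ η.re) :
    ∃ y : ℝ, |y| ≤ c ∧ η = rightPt c y := by
  have h1 : η.re ^ 2 + η.im ^ 2 = 1 := by
    have : ‖η‖ ^ 2 = 1 := by rw [hη, one_pow]
    rw [← normSq_eq_norm_sq, normSq_apply] at this
    nlinarith
  have h2 : Real.sqrt (c ^ 2 - (-(c * η.im)) ^ 2) = c * η.re := by
    rw [show c ^ 2 - (-(c * η.im)) ^ 2 = (c * η.re) ^ 2 by linear_combination (-c ^ 2) * h1]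
    exact Real.sqrt_sq (by positivity)
  have hc0 : (c : ℂ) ≠ 0 := by exact_mod_cast hc.ne'
  refine ⟨-(c * η.im), ?_, ?_⟩
  · rw [abs_neg, abs_mul, abs_of_pos hc]
    have : |η.im| ≤ 1 := by
      rw [abs_le]; constructor <;> nlinarith
    nlinarith
  · rw [rightPt, h2]
    push_cast
    field_simp
    nth_rw 1 [← re_add_im η]
    ring

/-- The quadratic for `η` has two roots. In the right half-plane `|η| < 1` forces `Re η > 0`,
whereas the other root would satisfy `c(1 + |η|²) Re η = -2|η|² Re s ≤ 0`. The resulting formula is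
continuous at interior points of the segment and yields the right limits. -/
lemma discMap_eq_of_re_pos (hc : 0 < c) {k : ℂ} (hk : 0 < k.re) :
    discMap c k = ((k ^ 2 + (c : ℂ) ^ 2) ^ (1 / 2 : ℂ) - k) / c := by
  have hkc : k ∈ cutPlane c := mem_cutPlane_of_re_ne_zero hk.ne'
  have hc0 : (c : ℂ) ≠ 0 := by exact_mod_cast hc.ne'
  have h1 := two_mul_discMap hc hkc
  have h2 := discMap_ne_zero hc hkc
  have h3 := discMap_mem hc hkc
  set η := discMap c k
  set s := (k ^ 2 + (c : ℂ) ^ 2) ^ (1 / 2 : ℂ)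
  have hs : s ^ 2 = k ^ 2 + (c : ℂ) ^ 2 := cpow_half_sq _
  have hsre : 0 ≤ s.re := cpow_half_re_nonneg _
  have h4 : (c * η + k - s) * (c * η + k + s) = 0 := by linear_combination c * h1 - hs
  rcases mul_eq_zero.1 h4 with h | h
  · field_simp
    linear_combination h
  · exfalso
    have h5 : c * (1 + η ^ 2) = -(2 * s * η) := by linear_combination 2 * η * h - h1
    have e1 := congrArg re (congrArg (fun z => z * (starRingEnd ℂ) η) h1)
    have e2 := congrArg re (congrArg (fun z => z * (starRingEnd ℂ) η) h5)
    have hns : 0 < normSq η := normSq_pos.2 h2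
    have hns1 : normSq η < 1 := by
      rw [normSq_eq_norm_sq]
      exact pow_lt_one₀ (norm_nonneg _) (mem_ball_zero_iff.1 h3) two_ne_zero
    have e3 : (2 * k * η * (starRingEnd ℂ) η).re = 2 * normSq η * k.re := by
      rw [mul_assoc, mul_conj, show 2 * k * (normSq η : ℂ) = ((2 * normSq η : ℝ) : ℂ) * k by
        push_cast; ring, re_ofReal_mul]
    have e4 : (c * (1 - η ^ 2) * (starRingEnd ℂ) η).re = c * (1 - normSq η) * η.re := by
      have : c * (1 - η ^ 2) * (starRingEnd ℂ) η = (c : ℂ) * ((starRingEnd ℂ) η - (normSq η : ℂ) * η) := by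
        rw [← mul_conj]; ring
      rw [this, re_ofReal_mul, sub_re, re_ofReal_mul, conj_re]; ring
    have e5 : (c * (1 + η ^ 2) * (starRingEnd ℂ) η).re = c * (1 + normSq η) * η.re := by
      have : c * (1 + η ^ 2) * (starRingEnd ℂ) η = (c : ℂ) * ((starRingEnd ℂ) η + (normSq η : ℂ) * η) := by
        rw [← mul_conj]; ring
      rw [this, re_ofReal_mul, add_re, re_ofReal_mul, conj_re]; ring
    have e6 : (-(2 * s * η) * (starRingEnd ℂ) η).re = -(2 * normSq η * s.re) := by
      rw [neg_mul, neg_re, mul_assoc, mul_conj, show 2 * s * (normSq η : ℂ) = ((2 * normSq η : ℝ) : ℂ) * s by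
        push_cast; ring, re_ofReal_mul]
    rw [e3, e4] at e1
    rw [e5, e6] at e2
    have hη0 : 0 < η.re := by
      have : 0 < c * (1 - normSq η) * η.re := by rw [← e1]; positivity
      exact pos_of_mul_pos_right this (by nlinarith)
    have : 0 < c * (1 + normSq η) * η.re := by positivity
    have : 0 ≤ 2 * normSq η * s.re := by positivity
    linarith

lemma tendsto_discMap_right (hc : 0 < c) {y : ℝ} (hy : |y| < c) :
    Tendsto (discMap c) (𝓝[{k : ℂ | 0 < k.re}] (I * y)) (𝓝 (rightPt c y)) := by
  have h0 : 0 < c ^ 2 - y ^ 2 := by have := abs_lt_sq hy; linarith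
  have hv : (I * y : ℂ) ^ 2 + (c : ℂ) ^ 2 = ((c ^ 2 - y ^ 2 : ℝ) : ℂ) := by
    push_cast [mul_pow, I_sq]; ring
  have h1 : ContinuousAt (fun k : ℂ => (k ^ 2 + (c : ℂ) ^ 2) ^ (1 / 2 : ℂ)) (I * y) := by
    refine ContinuousAt.comp (g := fun z : ℂ => z ^ (1 / 2 : ℂ)) (continuousAt_cpow_const ?_)
      (by fun_prop)
    rw [hv]
    exact ofReal_mem_slitPlane.2 h0
  have h2 := ((h1.sub continuousAt_id).div_const (c : ℂ)).tendsto
  have e : ((I * y : ℂ) ^ 2 + (c : ℂ) ^ 2) ^ (1 / 2 : ℂ) = Real.sqrt (c ^ 2 - y ^ 2) := by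
    rw [hv, cpow_half_ofReal h0.le]
  have h3 : Tendsto (fun k : ℂ => ((k ^ 2 + (c : ℂ) ^ 2) ^ (1 / 2 : ℂ) - k) / c) (𝓝 (I * y))
      (𝓝 (rightPt c y)) := by
    rw [rightPt, ← e]
    exact h2
  refine (h3.mono_left nhdsWithin_le_nhds).congr' ?_
  filter_upwards [self_mem_nhdsWithin] with k hk
  exact (discMap_eq_of_re_pos hc hk).symm

lemma tendsto_discMap_left (hc : 0 < c) {y : ℝ} (hy : |y| < c) :
    Tendsto (discMap c) (𝓝[{k : ℂ | k.re < 0}] (I * y)) (𝓝 (-rightPt c (-y))) := by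
  have := ((tendsto_discMap_right hc (y := -y) (by rwa [abs_neg])).comp (tendsto_neg_right y)).neg
  refine this.congr fun k => ?_
  change -discMap c (-k) = discMap c k
  rw [discMap_neg, neg_neg]

end

/-! ### Values of the quartic root -/

/-- `e^(2iφ)` with `sin φ = a/c`. -/
def nodeE (c a : ℝ) : ℂ := (Real.sqrt (1 - (a / c) ^ 2) + I * (a / c : ℝ)) ^ 2

section
variable {c a : ℝ}

lemma div_lt_one' (ha : 0 < a) (hac : a < c) : 0 < 1 - (a / c) ^ 2 := by
  have h1 : a / c < 1 := (div_lt_one (ha.trans hac)).2 hac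
  have h2 : 0 < a / c := div_pos ha (ha.trans hac)
  nlinarith

lemma norm_nodeE (ha : 0 < a) (hac : a < c) : ‖nodeE c a‖ = 1 := by
  have h := div_lt_one' ha hac
  rw [nodeE, norm_pow, ← normSq_eq_norm_sq, normSq_apply]
  simp only [add_re, add_im, ofReal_re, ofReal_im, mul_re, mul_im, I_re, I_im]
  have := Real.mul_self_sqrt h.le
  nlinarith

lemma nodeE_eq (ha : 0 < a) (hac : a < c) : nodeE c a =
    ((1 - 2 * (a / c) ^ 2 : ℝ) : ℂ) + I * (2 * (a / c) * Real.sqrt (1 - (a / c) ^ 2) : ℝ) := by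
  have h := div_lt_one' ha hac
  have h2 : (Real.sqrt (1 - (a / c) ^ 2) : ℂ) ^ 2 = ((1 - (a / c) ^ 2 : ℝ) : ℂ) := by
    exact_mod_cast Real.sq_sqrt h.le
  rw [nodeE]
  push_cast at h2 ⊢
  linear_combination h2 + (a / c : ℂ) ^ 2 * I_sq

lemma nodeE_add_conj (ha : 0 < a) (hac : a < c) :
    nodeE c a + (starRingEnd ℂ) (nodeE c a) = 2 - 4 * (a / c : ℂ) ^ 2 := by
  rw [nodeE_eq ha hac]
  simp only [map_add, map_mul, conj_I, conj_ofReal]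
  push_cast
  ring

lemma nodeE_mul_conj (ha : 0 < a) (hac : a < c) :
    nodeE c a * (starRingEnd ℂ) (nodeE c a) = 1 := by
  rw [mul_conj, normSq_eq_norm_sq, norm_nodeE ha hac]; simp

lemma nodeE_ne_conj (ha : 0 < a) (hac : a < c) : nodeE c a ≠ (starRingEnd ℂ) (nodeE c a) := by
  intro h
  have h1 := (conj_eq_iff_im.1 h.symm)
  rw [nodeE_eq ha hac] at h1
  simp only [add_im, ofReal_im, mul_im, I_re, I_im, ofReal_re, zero_mul, one_mul, zero_add] at h1
  have h2 := Real.sqrt_pos.2 (div_lt_one' ha hac)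
  have h3 : 0 < a / c := div_pos ha (ha.trans hac)
  have : 0 < 2 * (a / c) * Real.sqrt (1 - (a / c) ^ 2) := by positivity
  linarith

/-- In terms of `k = (c/2)(1/η - η)` the quartic polynomial is `(4η²/c²)(k² + a²)`. -/
lemma quarticRoot_sq_eq (ha : 0 < a) (hac : a < c) {k η : ℂ} (h : 2 * k * η = c * (1 - η ^ 2)) :
    quarticRoot (nodeE c a) η ^ 2 = 4 * η ^ 2 / c ^ 2 * (k ^ 2 + a ^ 2) := by
  have hc0 : (c : ℂ) ≠ 0 := by exact_mod_cast (ha.trans hac).ne'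
  have h1 := nodeE_add_conj ha hac
  have h2 := nodeE_mul_conj ha hac
  rw [quarticRoot_sq]
  have e : (1 - nodeE c a * η ^ 2) * (1 - (starRingEnd ℂ) (nodeE c a) * η ^ 2) =
      1 - (2 - 4 * (a / c : ℂ) ^ 2) * η ^ 2 + η ^ 4 := by
    rw [← h1]; linear_combination η ^ 4 * h2
  rw [e]
  field_simp
  linear_combination -(2 * k * η + c * (1 - η ^ 2)) * h

lemma one_add_sq_sq_eq {c : ℝ} (hc : 0 < c) {k η : ℂ} (h : 2 * k * η = c * (1 - η ^ 2)) :
    (1 + η ^ 2) ^ 2 = 4 * η ^ 2 / c ^ 2 * (k ^ 2 + c ^ 2) := by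
  have hc0 : (c : ℂ) ≠ 0 := by exact_mod_cast hc.ne'
  field_simp
  linear_combination -(2 * k * η + c * (1 - η ^ 2)) * h

lemma one_add_sq_ne_zero {η : ℂ} (hη : η ∈ 𝔻) : 1 + η ^ 2 ≠ 0 := by
  intro h
  have h2 := congrArg norm (eq_neg_of_add_eq_zero_right h)
  rw [norm_neg, norm_one, norm_pow] at h2
  have := pow_lt_one₀ (norm_nonneg η) (mem_ball_zero_iff.1 hη) two_ne_zero
  linarith

/-- In the disc coordinate `sqrtRatio` is the quartic root over `1 + η²`. -/
lemma quarticRoot_discMap (ha : 0 < a) (hac : a < c) {k : ℂ} (hk : k ∈ cutPlane c) :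
    quarticRoot (nodeE c a) (discMap c k) = sqrtRatio c a k * (1 + discMap c k ^ 2) := by
  have hc := ha.trans hac
  have hc0 : (c : ℂ) ≠ 0 := by exact_mod_cast hc.ne'
  have hE := norm_nodeE ha hac
  set ρ : ℂ → ℂ := fun η => (quarticRoot (nodeE c a) η ^ 2 / (1 + η ^ 2) ^ 2) with hρ
  have hρs : ∀ η ∈ 𝔻, ρ η ∈ slitPlane := by
    intro η hη
    by_cases h0 : η = 0
    · simp [hρ, h0, quarticRoot_zero]
    · set k' : ℂ := c / 2 * (1 / η - η) with hk'
      have h1 : 2 * k' * η = c * (1 - η ^ 2) := by rw [hk']; field_simp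
      have h2 := mem_cutPlane_of_disc hc hη h1
      have h3 := ratio_mem_slitPlane ha hac h2
      have h4 := sq_add_sq_ne_zero hc.le le_rfl hc h2
      convert h3 using 1
      simp only [hρ]
      rw [quarticRoot_sq_eq ha hac h1, one_add_sq_sq_eq hc h1, mul_div_mul_left]
      exact div_ne_zero (mul_ne_zero (by norm_num) (pow_ne_zero 2 h0)) (pow_ne_zero 2 hc0)
  have hρc : ContinuousOn ρ 𝔻 := by
    refine ContinuousOn.div (((continuousOn_quarticRoot hE).mono Metric.ball_subset_closedBall).pow 2)
      (by fun_prop) fun η hη => pow_ne_zero 2 (one_add_sq_ne_zero hη)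
  -- Both sides have the same square, the right-hand side has no zeros, and they agree at `η = 0`,
  -- that is at `k = ∞`; connectedness of the disc excludes a change of sign.
  have key : EqOn (quarticRoot (nodeE c a)) (fun η => ρ η ^ (1 / 2 : ℂ) * (1 + η ^ 2)) 𝔻 := by
    refine (convex_ball (0 : ℂ) 1).isPreconnected.eq_of_sq_eq
      ((continuousOn_quarticRoot hE).mono Metric.ball_subset_closedBall) ?_ ?_ ?_
      (Metric.mem_ball_self one_pos) ?_
    · refine ContinuousOn.mul (fun η hη => ?_) (by fun_prop)
      exact (continuousAt_cpow_const (hρs η hη)).comp_continuousWithinAt (hρc η hη)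
    · intro η hη
      have := pow_ne_zero 2 (one_add_sq_ne_zero hη)
      simp only [Pi.pow_apply, mul_pow, cpow_half_sq, hρ]
      exact (div_mul_cancel₀ _ this).symm
    · intro η hη
      refine mul_ne_zero (fun h => ?_) (one_add_sq_ne_zero hη)
      have h1 := cpow_half_sq (ρ η)
      rw [h] at h1
      exact slitPlane_ne_zero (hρs η hη) (by rw [← h1]; simp)
    · simp [hρ, quarticRoot_zero]
  have h1 := two_mul_discMap hc hk
  have h2 : (discMap c k) ^ 2 ≠ 0 := pow_ne_zero 2 (discMap_ne_zero hc hk)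
  rw [key (discMap_mem hc hk)]
  simp only [hρ]
  rw [quarticRoot_sq_eq ha hac h1, one_add_sq_sq_eq hc h1, mul_div_mul_left, sqrtRatio]
  exact div_ne_zero (mul_ne_zero (by norm_num) h2) (pow_ne_zero 2 hc0)

lemma w_discMap (ha : 0 < a) (hac : a < c) {k : ℂ} (hk : k ∈ cutPlane c) :
    4 * discMap c k ^ 2 * w c a k =
      c ^ 2 * (1 + discMap c k ^ 2) * quarticRoot (nodeE c a) (discMap c k) := by
  have hc := ha.trans hac
  have hc0 : (c : ℂ) ≠ 0 := by exact_mod_cast hc.ne'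
  have h := one_add_sq_sq_eq hc (two_mul_discMap hc hk)
  field_simp at h
  rw [quarticRoot_discMap ha hac hk, w]
  linear_combination (-sqrtRatio c a k) * h

lemma quarticRoot_rightPt_sq (ha : 0 < a) (hac : a < c) {y : ℝ} (hy : |y| ≤ c) :
    quarticRoot (nodeE c a) (rightPt c y) ^ 2 = 4 * rightPt c y ^ 2 / c ^ 2 * (a ^ 2 - y ^ 2) := by
  rw [quarticRoot_sq_eq ha hac (two_mul_rightPt (ha.trans hac) hy), mul_pow, I_sq]
  ring

/-- At real or purely imaginary points the two root factors are complex conjugates. This fixes the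
sign of the quartic root at `η = 1` and `η = -i`, from which it propagates along the gap and the
band. -/
lemma quarticRoot_eq_normSq {η : ℂ} {E : ℂ} (hE : ‖E‖ = 1) (hη : η ∈ 𝔻c)
    (h : (starRingEnd ℂ) η = η ∨ (starRingEnd ℂ) η = -η) :
    quarticRoot E η = (normSq (root E η) : ℂ) := by
  have : root ((starRingEnd ℂ) E) η = (starRingEnd ℂ) (root E η) := by
    rw [← root_conj hE hη]
    rcases h with h | h
    · rw [h]
    · rw [h, root_neg]
  rw [quarticRoot, this, mul_conj]

lemma sqrt_sq_complex {r : ℝ} (hr : 0 ≤ r) : (Real.sqrt r : ℂ) ^ 2 = (r : ℂ) := by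
  exact_mod_cast Real.sq_sqrt hr

/-- The square is known and has no zero on the open gap, so the sign is constant there and can be
read off at `y = 0`, where `η = 1`. -/
lemma quarticRoot_gap (ha : 0 < a) (hac : a < c) {y : ℝ} (hy : |y| < a) :
    quarticRoot (nodeE c a) (rightPt c y) = 2 * rightPt c y * Real.sqrt (a ^ 2 - y ^ 2) / c := by
  have hc := ha.trans hac
  have hc0 : (c : ℂ) ≠ 0 := by exact_mod_cast hc.ne'
  have hle : ∀ x ∈ Ioo (-a) a, |x| ≤ c := fun x hx => (abs_lt.2 hx).le.trans hac.le
  have hpos : ∀ x ∈ Ioo (-a) a, 0 < a ^ 2 - x ^ 2 := fun x hx => by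
    have := abs_lt_sq (abs_lt.2 hx); linarith
  have hE := norm_nodeE ha hac
  have hr0 : rightPt c 0 = 1 := by
    rw [rightPt]; simp [Real.sqrt_sq hc.le, hc0]
  refine isPreconnected_Ioo.eq_of_sq_eq (f := fun x => quarticRoot (nodeE c a) (rightPt c x))
    (g := fun x => 2 * rightPt c x * Real.sqrt (a ^ 2 - x ^ 2) / c) (S := Ioo (-a) a) (y := 0)
    ?_ ?_ ?_ ?_ ⟨by linarith, ha⟩ ?_ (abs_lt.1 hy)
  · exact (continuousOn_quarticRoot hE).comp (continuous_rightPt c).continuousOn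
      fun x hx => rightPt_mem hc (hle x hx)
  · have := continuous_rightPt c
    fun_prop
  · intro x hx
    simp only [Pi.pow_apply]
    rw [quarticRoot_rightPt_sq ha hac (hle x hx), div_pow, mul_pow, sqrt_sq_complex (hpos x hx).le]
    push_cast
    ring
  · intro x hx
    have h1 := rightPt_ne_zero hc (hle x hx)
    have h2 : (Real.sqrt (a ^ 2 - x ^ 2) : ℂ) ≠ 0 := by
      exact_mod_cast (Real.sqrt_pos.2 (hpos x hx)).ne'
    exact div_ne_zero (mul_ne_zero (mul_ne_zero two_ne_zero h1) h2) hc0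
  · have h1 := quarticRoot_eq_normSq hE (η := 1) (by simp) (Or.inl (by simp))
    have h2 := quarticRoot_rightPt_sq ha hac (y := 0) (by simp [hc.le])
    simp only [hr0] at h2 ⊢
    rw [h1] at h2 ⊢
    have h3 : normSq (root (nodeE c a) 1) = 2 * a / c := by
      have h4 : normSq (root (nodeE c a) 1) ^ 2 = (2 * a / c) ^ 2 := by
        have : ((normSq (root (nodeE c a) 1) ^ 2 : ℝ) : ℂ) = (((2 * a / c) ^ 2 : ℝ) : ℂ) := by
          push_cast
          push_cast at h2
          rw [h2]; field_simp; ring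
        exact_mod_cast this
      exact (sq_eq_sq₀ (normSq_nonneg _) (by positivity)).1 h4
    rw [h3]
    simp [Real.sqrt_sq ha.le]

/-- As on the gap, with the sign now read off at the end `y = c`, where `η = -i`. The interval must
contain `c` for this reason. -/
lemma quarticRoot_band (ha : 0 < a) (hac : a < c) {y : ℝ} (hy : a < y) (hyc : y ≤ c) :
    quarticRoot (nodeE c a) (rightPt c y) =
      2 * I * rightPt c y * Real.sqrt (y ^ 2 - a ^ 2) / c := by
  have hc := ha.trans hac
  have hc0 : (c : ℂ) ≠ 0 := by exact_mod_cast hc.ne'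
  have hle : ∀ x ∈ Ioc a c, |x| ≤ c := fun x hx => by
    rw [abs_of_pos (ha.trans hx.1)]; exact hx.2
  have hpos : ∀ x ∈ Ioc a c, 0 < x ^ 2 - a ^ 2 := fun x hx => by nlinarith [hx.1]
  have hE := norm_nodeE ha hac
  have hr0 : rightPt c c = -I := by
    rw [rightPt]; simp; field_simp
  refine isPreconnected_Ioc.eq_of_sq_eq (f := fun x => quarticRoot (nodeE c a) (rightPt c x))
    (g := fun x => 2 * I * rightPt c x * Real.sqrt (x ^ 2 - a ^ 2) / c) (S := Ioc a c) (y := c)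
    ?_ ?_ ?_ ?_ ⟨hac, le_rfl⟩ ?_ ⟨hy, hyc⟩
  · exact (continuousOn_quarticRoot hE).comp (continuous_rightPt c).continuousOn
      fun x hx => rightPt_mem hc (hle x hx)
  · have := continuous_rightPt c
    fun_prop
  · intro x hx
    simp only [Pi.pow_apply]
    rw [quarticRoot_rightPt_sq ha hac (hle x hx), div_pow, mul_pow, sqrt_sq_complex (hpos x hx).le,
      mul_pow, mul_pow, I_sq]
    push_cast
    ring
  · intro x hx
    have h1 := rightPt_ne_zero hc (hle x hx)
    have h2 : (Real.sqrt (x ^ 2 - a ^ 2) : ℂ) ≠ 0 := by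
      exact_mod_cast (Real.sqrt_pos.2 (hpos x hx)).ne'
    exact div_ne_zero (mul_ne_zero (mul_ne_zero (mul_ne_zero two_ne_zero I_ne_zero) h1) h2) hc0
  · have h1 := quarticRoot_eq_normSq hE (η := -I) (by simp) (Or.inr (by simp))
    have h2 := quarticRoot_rightPt_sq ha hac (y := c) (by rw [abs_of_pos hc])
    have hca : 0 ≤ c ^ 2 - a ^ 2 := by nlinarith
    simp only [hr0] at h2 ⊢
    rw [h1] at h2 ⊢
    have h3 : normSq (root (nodeE c a) (-I)) = 2 * Real.sqrt (c ^ 2 - a ^ 2) / c := by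
      have h4 : normSq (root (nodeE c a) (-I)) ^ 2 = (2 * Real.sqrt (c ^ 2 - a ^ 2) / c) ^ 2 := by
        have : ((normSq (root (nodeE c a) (-I)) ^ 2 : ℝ) : ℂ) =
            (((2 * Real.sqrt (c ^ 2 - a ^ 2) / c) ^ 2 : ℝ) : ℂ) := by
          push_cast
          rw [h2, div_pow, mul_pow, sqrt_sq_complex hca, neg_sq, I_sq]
          push_cast
          ring
        exact_mod_cast this
      exact (sq_eq_sq₀ (normSq_nonneg _) (by positivity)).1 h4
    rw [h3]
    push_cast
    linear_combination (2 * Real.sqrt (c ^ 2 - a ^ 2) / c : ℂ) * I_sq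
end

/-! ### Boundary values of the elliptic integral and the periods -/

/-- `√((a² - y²)(c² - y²))`, the absolute value of `w(iy)` on the gap. -/
def gapW (c a y : ℝ) : ℝ := Real.sqrt ((a ^ 2 - y ^ 2) * (c ^ 2 - y ^ 2))

/-- `√((y² - a²)(c² - y²))`, the absolute value of `w(iy)` on the bands. -/
def bandW (c a y : ℝ) : ℝ := Real.sqrt ((y ^ 2 - a ^ 2) * (c ^ 2 - y ^ 2))

/-- `∫_0^y ds/√((a² - s²)(c² - s²))`. -/
def gapInt (c a y : ℝ) : ℝ := ∫ s in (0 : ℝ)..y, 1 / gapW c a s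

/-- `∫_a^y ds/√((s² - a²)(c² - s²))`. -/
def bandInt (c a y : ℝ) : ℝ := ∫ s in a..y, 1 / bandW c a s

section
variable {c a : ℝ}

lemma gapW_pos (hac : a < c) {y : ℝ} (hy : |y| < a) : 0 < gapW c a y := by
  have h1 := abs_lt_sq hy
  have h2 := abs_lt_sq (hy.trans hac)
  exact Real.sqrt_pos.2 (mul_pos (by linarith) (by linarith))

lemma bandW_pos (ha : 0 < a) {y : ℝ} (hy : a < y) (hyc : y < c) : 0 < bandW c a y :=
  Real.sqrt_pos.2 (mul_pos (by nlinarith) (by nlinarith))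

/-- In the variable `k` the elliptic integral is that of `-(c/2) dk/w`; here `k = iy` and `w` is
real, while on the upper band `w` is imaginary and the derivative real. -/
lemma hasDerivAt_ellInt_gap (ha : 0 < a) (hac : a < c) {y : ℝ} (hy : |y| < a) :
    HasDerivAt (fun y => ellInt (nodeE c a) (rightPt c y)) (-(I * c / 2) * (1 / gapW c a y : ℝ)) y := by
  have hc := ha.trans hac
  have hyc := hy.trans hac
  have hc0 : (c : ℂ) ≠ 0 := by exact_mod_cast hc.ne'
  have h1 := abs_lt_sq hy
  have h2 := abs_lt_sq hyc
  have hs1 : (Real.sqrt (a ^ 2 - y ^ 2) : ℂ) ≠ 0 := by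
    exact_mod_cast (Real.sqrt_pos.2 (by linarith)).ne'
  have hs2 : (Real.sqrt (c ^ 2 - y ^ 2) : ℂ) ≠ 0 := by
    exact_mod_cast (Real.sqrt_pos.2 (by linarith)).ne'
  have hr := rightPt_ne_zero hc hyc.le
  have hq := quarticRoot_gap ha hac hy
  have hmem : ∀ᶠ x in 𝓝 y, rightPt c x ∈ 𝔻c := by
    filter_upwards [continuous_abs.continuousAt.eventually_lt_const hyc] with x hx
    exact rightPt_mem hc hx.le
  refine (hasDerivAt_ellInt_comp (norm_nodeE ha hac) (nodeE_ne_conj ha hac)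
    (hasDerivAt_rightPt hc hyc) hmem ?_).congr_deriv ?_
  · rw [hq]
    exact div_ne_zero (mul_ne_zero (mul_ne_zero two_ne_zero hr) hs1) hc0
  · rw [hq, gapW, Real.sqrt_mul (by linarith)]
    push_cast
    field_simp

lemma hasDerivAt_ellInt_band (ha : 0 < a) {y : ℝ} (hy : a < y) (hyc : y < c) :
    HasDerivAt (fun y => ellInt (nodeE c a) (rightPt c y)) (-(c / 2) * (1 / bandW c a y : ℝ)) y := by
  have hac := hy.trans hyc
  have hc := ha.trans hac
  have hyc' : |y| < c := by rwa [abs_of_pos (ha.trans hy)]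
  have hc0 : (c : ℂ) ≠ 0 := by exact_mod_cast hc.ne'
  have hs1 : (Real.sqrt (y ^ 2 - a ^ 2) : ℂ) ≠ 0 := by
    exact_mod_cast (Real.sqrt_pos.2 (by nlinarith)).ne'
  have hs2 : (Real.sqrt (c ^ 2 - y ^ 2) : ℂ) ≠ 0 := by
    exact_mod_cast (Real.sqrt_pos.2 (by nlinarith)).ne'
  have hr := rightPt_ne_zero hc hyc'.le
  have hq := quarticRoot_band ha hac hy hyc.le
  have hmem : ∀ᶠ x in 𝓝 y, rightPt c x ∈ 𝔻c := by
    filter_upwards [continuous_abs.continuousAt.eventually_lt_const hyc'] with x hx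
    exact rightPt_mem hc hx.le
  refine (hasDerivAt_ellInt_comp (norm_nodeE ha hac) (nodeE_ne_conj ha hac)
    (hasDerivAt_rightPt hc hyc') hmem ?_).congr_deriv ?_
  · rw [hq]
    exact div_ne_zero (mul_ne_zero (mul_ne_zero (mul_ne_zero two_ne_zero I_ne_zero) hr) hs1) hc0
  · have hI := I_ne_zero
    rw [hq, bandW, Real.sqrt_mul (by nlinarith)]
    push_cast
    field_simp

lemma continuousOn_ellInt_rightPt (ha : 0 < a) (hac : a < c) :
    ContinuousOn (fun y => ellInt (nodeE c a) (rightPt c y)) (Icc (-c) c) :=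
  (continuousOn_ellInt (norm_nodeE ha hac) (nodeE_ne_conj ha hac)).comp
    (continuous_rightPt c).continuousOn fun _ hy => rightPt_mem (ha.trans hac) (abs_le.2 hy)

/-- The singular integrand is nonnegative and is the derivative of a function continuous up to the
end points, a multiple of the imaginary part of the elliptic integral on the circle. -/
lemma intervalIntegrable_gapW (ha : 0 < a) (hac : a < c) :
    IntervalIntegrable (fun y => 1 / gapW c a y) volume (-a) a := by
  have hc := ha.trans hac
  refine intervalIntegral.intervalIntegrable_deriv_of_nonneg
    (g := fun y => -(2 / c) * (ellInt (nodeE c a) (rightPt c y)).im) ?_ ?_ ?_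
  · rw [uIcc_of_le (by linarith)]
    exact continuousOn_const.mul (continuous_im.comp_continuousOn
      ((continuousOn_ellInt_rightPt ha hac).mono (Icc_subset_Icc (by linarith) hac.le)))
  · rw [min_eq_left (by linarith), max_eq_right (by linarith)]
    intro y hy
    have h := (imCLM.hasFDerivAt.comp_hasDerivAt y
      (hasDerivAt_ellInt_gap ha hac (abs_lt.2 hy))).const_mul (-(2 / c))
    refine h.congr_deriv ?_
    have e : -(I * (c : ℂ) / 2) * (1 / gapW c a y : ℝ) = ((-(c / 2) * (1 / gapW c a y) : ℝ) : ℂ) * I := by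
      push_cast; ring
    rw [e, imCLM_apply, im_ofReal_mul, I_im]
    field_simp
  · rw [min_eq_left (by linarith), max_eq_right (by linarith)]
    intro y hy
    exact (one_div_pos.2 (gapW_pos hac (abs_lt.2 hy))).le

lemma intervalIntegrable_bandW (ha : 0 < a) (hac : a < c) :
    IntervalIntegrable (fun y => 1 / bandW c a y) volume a c := by
  have hc := ha.trans hac
  refine intervalIntegral.intervalIntegrable_deriv_of_nonneg
    (g := fun y => -(2 / c) * (ellInt (nodeE c a) (rightPt c y)).re) ?_ ?_ ?_
  · rw [uIcc_of_le hac.le]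
    exact continuousOn_const.mul (continuous_re.comp_continuousOn
      ((continuousOn_ellInt_rightPt ha hac).mono (Icc_subset_Icc (by linarith) le_rfl)))
  · rw [min_eq_left hac.le, max_eq_right hac.le]
    intro y hy
    have h := (reCLM.hasFDerivAt.comp_hasDerivAt y
      (hasDerivAt_ellInt_band ha hy.1 hy.2)).const_mul (-(2 / c))
    refine h.congr_deriv ?_
    have e : -((c : ℂ) / 2) * (1 / bandW c a y : ℝ) = ((-(c / 2) * (1 / bandW c a y) : ℝ) : ℂ) := by
      push_cast; ring
    rw [e, reCLM_apply, ofReal_re]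
    field_simp
  · rw [min_eq_left hac.le, max_eq_right hac.le]
    intro y hy
    exact (one_div_pos.2 (bandW_pos ha hy.1 hy.2)).le

lemma intervalIntegrable_gapW_of_mem (ha : 0 < a) (hac : a < c) {y z : ℝ} (hy : y ∈ Icc (-a) a)
    (hz : z ∈ Icc (-a) a) : IntervalIntegrable (fun y => 1 / gapW c a y) volume y z := by
  refine (intervalIntegrable_gapW ha hac).mono_set ?_
  rw [uIcc_of_le (by linarith : -a ≤ a)]
  exact uIcc_subset_Icc hy hz

lemma intervalIntegrable_bandW_of_mem (ha : 0 < a) (hac : a < c) {y z : ℝ} (hy : y ∈ Icc a c)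
    (hz : z ∈ Icc a c) : IntervalIntegrable (fun y => 1 / bandW c a y) volume y z := by
  refine (intervalIntegrable_bandW ha hac).mono_set ?_
  rw [uIcc_of_le hac.le]
  exact uIcc_subset_Icc hy hz

lemma ellInt_gap_sub (ha : 0 < a) (hac : a < c) {y : ℝ} (hy : |y| ≤ a) :
    ellInt (nodeE c a) (rightPt c y) - ellInt (nodeE c a) (rightPt c 0) =
      -(I * c / 2) * gapInt c a y := by
  have hy' := abs_le.1 hy
  have h0 : (0 : ℝ) ∈ Icc (-a) a := ⟨by linarith, ha.le⟩
  have hsub : uIcc 0 y ⊆ Icc (-a) a := uIcc_subset_Icc h0 hy'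
  have hint := intervalIntegrable_gapW_of_mem ha hac h0 hy'
  have := intervalIntegral.integral_eq_sub_of_hasDeriv_right
    (f := fun y => ellInt (nodeE c a) (rightPt c y)) (a := 0) (b := y)
    (f' := fun y => -(I * c / 2) * (1 / gapW c a y : ℝ))
    ((continuousOn_ellInt_rightPt ha hac).mono (hsub.trans (Icc_subset_Icc (by linarith) hac.le)))
    (fun x hx => by
      refine (hasDerivAt_ellInt_gap ha hac (abs_lt.2 ⟨?_, ?_⟩)).hasDerivWithinAt
      · exact lt_of_le_of_lt (le_min (by linarith) hy'.1) hx.1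
      · exact lt_of_lt_of_le hx.2 (max_le ha.le hy'.2))
    (IntervalIntegrable.const_mul (f := fun y => ((1 / gapW c a y : ℝ) : ℂ)) ⟨hint.1.ofReal, hint.2.ofReal⟩ _)
  rw [← this, intervalIntegral.integral_const_mul, gapInt, intervalIntegral.integral_ofReal]

lemma ellInt_band_sub (ha : 0 < a) (hac : a < c) {y : ℝ} (hy : a ≤ y) (hyc : y ≤ c) :
    ellInt (nodeE c a) (rightPt c y) - ellInt (nodeE c a) (rightPt c a) =
      -(c / 2) * bandInt c a y := by
  have hint := intervalIntegrable_bandW_of_mem ha hac (y := a) (z := y) ⟨le_rfl, hac.le⟩ ⟨hy, hyc⟩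
  have := intervalIntegral.integral_eq_sub_of_hasDeriv_right
    (f := fun y => ellInt (nodeE c a) (rightPt c y)) (a := a) (b := y)
    (f' := fun y => -(c / 2) * (1 / bandW c a y : ℝ))
    ((continuousOn_ellInt_rightPt ha hac).mono (by
      rw [uIcc_of_le hy]; exact Icc_subset_Icc (by linarith) hyc))
    (fun x hx => by
      rw [min_eq_left hy, max_eq_right hy] at hx
      exact (hasDerivAt_ellInt_band ha hx.1 (hx.2.trans_le hyc)).hasDerivWithinAt)
    (IntervalIntegrable.const_mul (f := fun y => ((1 / bandW c a y : ℝ) : ℂ)) ⟨hint.1.ofReal, hint.2.ofReal⟩ _)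
  rw [← this, intervalIntegral.integral_const_mul, bandInt, intervalIntegral.integral_ofReal]

lemma gapInt_a_pos (ha : 0 < a) (hac : a < c) : 0 < gapInt c a a := by
  refine intervalIntegral.intervalIntegral_pos_of_pos_on
    (intervalIntegrable_gapW_of_mem ha hac ⟨by linarith, ha.le⟩ ⟨by linarith, le_rfl⟩)
    (fun y hy => one_div_pos.2 (gapW_pos hac ?_)) ha
  rw [abs_of_pos hy.1]; exact hy.2

lemma bandInt_c_pos (ha : 0 < a) (hac : a < c) : 0 < bandInt c a c :=
  intervalIntegral.intervalIntegral_pos_of_pos_on (intervalIntegrable_bandW ha hac)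
    (fun _ hy => one_div_pos.2 (bandW_pos ha hy.1 hy.2)) hac

lemma gapInt_zero : gapInt c a 0 = 0 := by simp [gapInt]

lemma gapW_neg (y : ℝ) : gapW c a (-y) = gapW c a y := by simp [gapW]

lemma gapInt_neg (y : ℝ) : gapInt c a (-y) = -gapInt c a y := by
  have := intervalIntegral.integral_comp_neg (fun s => 1 / gapW c a s) (a := 0) (b := y)
  simp only [gapW_neg, neg_zero] at this
  rw [gapInt, gapInt, this, intervalIntegral.integral_symm]

lemma gapInt_lt (ha : 0 < a) (hac : a < c) {y z : ℝ} (hy : y ∈ Icc (-a) a) (hz : z ∈ Icc (-a) a)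
    (h : y < z) : gapInt c a y < gapInt c a z := by
  have h0 : (0 : ℝ) ∈ Icc (-a) a := ⟨by linarith, ha.le⟩
  have := intervalIntegral.integral_add_adjacent_intervals
    (intervalIntegrable_gapW_of_mem ha hac h0 hy) (intervalIntegrable_gapW_of_mem ha hac hy hz)
  rw [gapInt, gapInt, ← this]
  have : 0 < ∫ s in y..z, 1 / gapW c a s :=
    intervalIntegral.intervalIntegral_pos_of_pos_on (intervalIntegrable_gapW_of_mem ha hac hy hz)
      (fun s hs => one_div_pos.2 (gapW_pos hac (abs_lt.2 ⟨hy.1.trans_lt hs.1, hs.2.trans_le hz.2⟩))) h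
  linarith

lemma continuousOn_gapInt (ha : 0 < a) (hac : a < c) : ContinuousOn (gapInt c a) (Icc (-a) a) := by
  have h := intervalIntegral.continuousOn_primitive_interval' (b₁ := -a) (b₂ := a) (a := 0)
    (intervalIntegrable_gapW ha hac) (by rw [uIcc_of_le (by linarith)]; exact ⟨by linarith, ha.le⟩)
  rwa [uIcc_of_le (by linarith)] at h

lemma bandInt_nonneg (c a : ℝ) {y : ℝ} (hy : a ≤ y) : 0 ≤ bandInt c a y :=
  intervalIntegral.integral_nonneg hy fun _ _ => one_div_nonneg.2 (Real.sqrt_nonneg _)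

lemma bandInt_pos (ha : 0 < a) (hac : a < c) {y : ℝ} (hy : a < y) (hyc : y ≤ c) :
    0 < bandInt c a y :=
  intervalIntegral.intervalIntegral_pos_of_pos_on
    (intervalIntegrable_bandW_of_mem ha hac ⟨le_rfl, hac.le⟩ ⟨hy.le, hyc⟩)
    (fun _ hs => one_div_pos.2 (bandW_pos ha hs.1 (hs.2.trans_le hyc))) hy

lemma bandInt_le (ha : 0 < a) (hac : a < c) {y : ℝ} (hy : a ≤ y) (hyc : y ≤ c) :
    bandInt c a y ≤ bandInt c a c := by
  have := intervalIntegral.integral_add_adjacent_intervals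
    (intervalIntegrable_bandW_of_mem ha hac ⟨le_rfl, hac.le⟩ ⟨hy, hyc⟩)
    (intervalIntegrable_bandW_of_mem ha hac ⟨hy, hyc⟩ ⟨hac.le, le_rfl⟩)
  rw [bandInt, bandInt, ← this]
  have : 0 ≤ ∫ s in y..c, 1 / bandW c a s :=
    intervalIntegral.integral_nonneg hyc fun s _ => one_div_nonneg.2 (Real.sqrt_nonneg _)
  linarith

lemma rightPt_zero (hc : 0 < c) : rightPt c 0 = 1 := by
  have hc0 : (c : ℂ) ≠ 0 := by exact_mod_cast hc.ne'
  rw [rightPt]; simp [Real.sqrt_sq hc.le, hc0]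

lemma rightPt_self (hc : 0 < c) : rightPt c c = -I := by
  have hc0 : (c : ℂ) ≠ 0 := by exact_mod_cast hc.ne'
  rw [rightPt]; simp; field_simp

/-- By symmetry the elliptic integral is real at `1` and imaginary at `-i`. Along the arc from `1`
to `-i` the gap contributes an imaginary amount and the band the real amount `-(c/2) bandInt c a c`,
so comparing real parts determines the value at `1`. -/
lemma ellInt_one (ha : 0 < a) (hac : a < c) :
    ellInt (nodeE c a) 1 = (c / 2 : ℂ) * bandInt c a c := by
  have hc := ha.trans hac
  have hE := norm_nodeE ha hac
  have h1 := ellInt_gap_sub ha hac (y := a) (by rw [abs_of_pos ha])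
  have h2 := ellInt_band_sub ha hac hac.le le_rfl
  rw [rightPt_zero hc] at h1
  rw [rightPt_self hc] at h2
  have h3 := ellInt_conj hE (η := 1) (by simp)
  have h4 := ellInt_conj hE (η := -I) (by simp)
  rw [map_one] at h3
  rw [map_neg, conj_I, neg_neg] at h4
  have h5 : ellInt (nodeE c a) I = -ellInt (nodeE c a) (-I) := by rw [ellInt_neg, neg_neg]
  have him : (ellInt (nodeE c a) 1).im = 0 := conj_eq_iff_im.1 h3.symm
  have hre : (ellInt (nodeE c a) (-I)).re = 0 := by
    have := congrArg re (h5.symm.trans h4)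
    simp only [neg_re, conj_re] at this
    linarith
  have h6 : ellInt (nodeE c a) (-I) = ellInt (nodeE c a) 1 + ((-(c / 2 * gapInt c a a) : ℝ) : ℂ) * I +
      ((-(c / 2 * bandInt c a c) : ℝ) : ℂ) := by
    push_cast
    linear_combination h1 + h2
  have h7 := congrArg re h6
  rw [hre, add_re, add_re, re_ofReal_mul, I_re, ofReal_re] at h7
  apply Complex.ext
  · have : ((c / 2 : ℂ) * bandInt c a c) = ((c / 2 * bandInt c a c : ℝ) : ℂ) := by push_cast; ring
    rw [this, ofReal_re]; linarith
  · have : ((c / 2 : ℂ) * bandInt c a c) = ((c / 2 * bandInt c a c : ℝ) : ℂ) := by push_cast; ring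
    rw [this, ofReal_im, him]

/-! ### The normalized Abel map on the closed disc -/

/-- The period `2τ`, as a positive multiple of `i`. -/
def period (c a : ℝ) : ℂ := I * ((bandInt c a c / gapInt c a a : ℝ) : ℂ)

lemma period_im (c a : ℝ) : (period c a).im = bandInt c a c / gapInt c a a := by
  rw [period, mul_comm, im_ofReal_mul, I_im, mul_one]

lemma period_im_pos (ha : 0 < a) (hac : a < c) : 0 < (period c a).im := by
  rw [period_im]; exact div_pos (bandInt_c_pos ha hac) (gapInt_a_pos ha hac)

/-- Twice the normalized Abel map, as a function on the unit disc. -/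
def abelMap (c a : ℝ) (η : ℂ) : ℂ := -(I / (c * gapInt c a a)) * ellInt (nodeE c a) η

lemma abelMap_neg (η : ℂ) : abelMap c a (-η) = -abelMap c a η := by
  rw [abelMap, ellInt_neg, abelMap]; ring

lemma abelMap_zero : abelMap c a 0 = 0 := by rw [abelMap, ellInt_zero, mul_zero]

lemma abelMap_conj (ha : 0 < a) (hac : a < c) {η : ℂ} (hη : η ∈ 𝔻c) :
    abelMap c a ((starRingEnd ℂ) η) = -(starRingEnd ℂ) (abelMap c a η) := by
  rw [abelMap, ellInt_conj (norm_nodeE ha hac) hη, abelMap]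
  simp [neg_div]

/-- The right side of the gap becomes the lower edge of the rectangle: `y = a` gives the corner
`-1/2 - T/2` and `y = -a` the corner `1/2 - T/2`. -/
lemma abelMap_gap (ha : 0 < a) (hac : a < c) {y : ℝ} (hy : |y| ≤ a) :
    abelMap c a (rightPt c y) =
      ((-(gapInt c a y / (2 * gapInt c a a)) : ℝ) : ℂ) - period c a / 2 := by
  have hc := ha.trans hac
  have hc0 : (c : ℂ) ≠ 0 := by exact_mod_cast hc.ne'
  have hg : (gapInt c a a : ℂ) ≠ 0 := by exact_mod_cast (gapInt_a_pos ha hac).ne'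
  have h1 := ellInt_gap_sub ha hac hy
  rw [rightPt_zero hc, ellInt_one ha hac] at h1
  rw [abelMap, eq_add_of_sub_eq h1, period]
  push_cast
  field_simp
  linear_combination (gapInt c a y : ℂ) * I_sq

lemma abelMap_band (ha : 0 < a) (hac : a < c) {y : ℝ} (hy : a ≤ y) (hyc : y ≤ c) :
    abelMap c a (rightPt c y) = -(1 / 2) +
      I * ((bandInt c a y / (2 * gapInt c a a) - bandInt c a c / (2 * gapInt c a a) : ℝ) : ℂ) := by
  have hc := ha.trans hac
  have hc0 : (c : ℂ) ≠ 0 := by exact_mod_cast hc.ne'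
  have hg : (gapInt c a a : ℂ) ≠ 0 := by exact_mod_cast (gapInt_a_pos ha hac).ne'
  have h1 := ellInt_gap_sub ha hac (y := a) (by rw [abs_of_pos ha])
  have h2 := ellInt_band_sub ha hac hy hyc
  rw [rightPt_zero hc, ellInt_one ha hac] at h1
  rw [abelMap, eq_add_of_sub_eq h2, eq_add_of_sub_eq h1]
  push_cast
  field_simp
  linear_combination (gapInt c a a : ℂ) * I_sq

lemma continuousOn_abelMap (ha : 0 < a) (hac : a < c) : ContinuousOn (abelMap c a) 𝔻c :=
  continuousOn_const.mul (continuousOn_ellInt (norm_nodeE ha hac) (nodeE_ne_conj ha hac))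

lemma hasDerivAt_abelMap (ha : 0 < a) (hac : a < c) {η : ℂ} (hη : η ∈ 𝔻) :
    HasDerivAt (abelMap c a)
      (-(I / (c * gapInt c a a)) * (1 / quarticRoot (nodeE c a) η)) η :=
  (hasDerivAt_ellInt (norm_nodeE ha hac) hη).const_mul _

lemma abelMap_const_ne_zero (ha : 0 < a) (hac : a < c) : -(I / (c * gapInt c a a) : ℂ) ≠ 0 := by
  have hc0 : (c : ℂ) ≠ 0 := by exact_mod_cast (ha.trans hac).ne'
  have hg : (gapInt c a a : ℂ) ≠ 0 := by exact_mod_cast (gapInt_a_pos ha hac).ne'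
  exact neg_ne_zero.2 (div_ne_zero I_ne_zero (mul_ne_zero hc0 hg))

/-- On the right half of the unit circle. -/
lemma abs_abelMap_im_rightPt_le (ha : 0 < a) (hac : a < c) {y : ℝ} (hy : |y| ≤ c) :
    |(abelMap c a (rightPt c y)).im| ≤ (period c a).im / 2 := by
  have hg := gapInt_a_pos ha hac
  have hT := period_im_pos ha hac
  rcases le_total |y| a with h | h
  · rw [abelMap_gap ha hac h, sub_im, ofReal_im, zero_sub, abs_neg, div_ofNat_im,
      abs_of_pos (by linarith)]
  · have key : ∀ z : ℝ, a ≤ z → z ≤ c → |(abelMap c a (rightPt c z)).im| ≤ (period c a).im / 2 := by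
      intro z h1 h2
      rw [abelMap_band ha hac h1 h2, add_im, mul_comm I, im_ofReal_mul, I_im, period_im]
      have e1 := bandInt_nonneg c a h1
      have e2 := bandInt_le ha hac h1 h2
      have e3 : (-(1 / 2) : ℂ).im = 0 := by norm_num
      rw [e3, zero_add, mul_one, ← sub_div, abs_div, abs_of_nonpos (by linarith),
        abs_of_pos (by positivity)]
      rw [div_div, mul_comm (2 : ℝ)]
      gcongr
      linarith
    rcases abs_choice y with h2 | h2
    · rw [h2] at h hy
      exact key y h hy
    · rw [h2] at h hy
      have h3 := key (-y) h hy
      have h4 : rightPt c (-y) ∈ 𝔻c :=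
        rightPt_mem (ha.trans hac) (by rw [abs_neg, h2]; exact hy)
      rw [← neg_neg y, ← rightPt_conj, abelMap_conj ha hac h4]
      simpa using h3

lemma abs_abelMap_im_sphere_le (ha : 0 < a) (hac : a < c) {η : ℂ} (hη : ‖η‖ = 1) :
    |(abelMap c a η).im| ≤ (period c a).im / 2 := by
  have hc := ha.trans hac
  rcases le_total 0 η.re with h | h
  · obtain ⟨y, hy, rfl⟩ := exists_eq_rightPt hc hη h
    exact abs_abelMap_im_rightPt_le ha hac hy
  · obtain ⟨y, hy, hy2⟩ := exists_eq_rightPt hc (η := -η) (by rwa [norm_neg]) (by simpa using h)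
    have := abs_abelMap_im_rightPt_le ha hac hy
    rw [← hy2, abelMap_neg, neg_im, abs_neg] at this
    exact this

/-- Maximum principle for `exp(∓i Z)`, whose modulus is `exp(± Im Z)`, with the bound on the circle
known from the explicit boundary values. -/
lemma abs_abelMap_im_le (ha : 0 < a) (hac : a < c) {η : ℂ} (hη : η ∈ 𝔻c) :
    |(abelMap c a η).im| ≤ (period c a).im / 2 := by
  have key : ∀ s : ℝ, |s| = 1 → s * (abelMap c a η).im ≤ (period c a).im / 2 := by
    intro s hs
    have hd : DiffContOnCl ℂ (fun z => exp (-(s * I) * abelMap c a z)) 𝔻 := by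
      refine ⟨fun z hz => ?_, ?_⟩
      · exact (((hasDerivAt_abelMap ha hac hz).const_mul _).cexp).differentiableAt.differentiableWithinAt
      · rw [closure_ball _ one_ne_zero]
        exact (continuousOn_const.mul (continuousOn_abelMap ha hac)).cexp
    have hn : ∀ z : ℂ, ‖exp (-(s * I) * abelMap c a z)‖ = Real.exp (s * (abelMap c a z).im) := by
      intro z
      rw [norm_exp]
      congr 1
      simp
    have := norm_le_of_forall_mem_frontier_norm_le Metric.isBounded_ball hd
      (C := Real.exp ((period c a).im / 2)) (fun z hz => by
        rw [frontier_ball _ one_ne_zero, mem_sphere_zero_iff_norm] at hz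
        rw [hn, Real.exp_le_exp]
        refine (le_abs_self _).trans ?_
        rw [abs_mul, hs, one_mul]
        exact abs_abelMap_im_sphere_le ha hac hz) (by rwa [closure_ball _ one_ne_zero])
    rwa [hn, Real.exp_le_exp] at this
  rw [abs_le]
  have h1 := key 1 (by simp)
  have h2 := key (-1) (by simp)
  constructor <;> linarith

/-- The Abel map takes the open disc into the open strip. -/
lemma abs_abelMap_im_lt (ha : 0 < a) (hac : a < c) {η : ℂ} (hη : η ∈ 𝔻) :
    |(abelMap c a η).im| < (period c a).im / 2 := by
  have hd : DifferentiableOn ℂ (abelMap c a) 𝔻 := fun z hz =>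
    (hasDerivAt_abelMap ha hac hz).differentiableAt.differentiableWithinAt
  have han := hd.analyticAt (Metric.isOpen_ball.mem_nhds hη)
  have hs := han.hasStrictDerivAt
  have hne : deriv (abelMap c a) η ≠ 0 := by
    rw [(hasDerivAt_abelMap ha hac hη).deriv]
    exact mul_ne_zero (abelMap_const_ne_zero ha hac)
      (one_div_ne_zero (quarticRoot_ne_zero (norm_nodeE ha hac) hη))
  -- `Z` has nonzero derivative and is therefore open, so a point on the edge of the strip would
  -- have image points outside the closed strip nearby.
  have hmap := hs.map_nhds_eq hne
  have h1 : ∀ᶠ z in 𝓝 (abelMap c a η), |z.im| ≤ (period c a).im / 2 := by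
    rw [← hmap, eventually_map]
    filter_upwards [Metric.isOpen_ball.mem_nhds hη] with z hz
    exact abs_abelMap_im_le ha hac (Metric.ball_subset_closedBall hz)
  obtain ⟨r, hr, hball⟩ := Metric.eventually_nhds_iff_ball.1 h1
  have h2 : ∀ s : ℝ, |s| = r / 2 → |(abelMap c a η).im + s| ≤ (period c a).im / 2 := by
    intro s hs
    have := hball (abelMap c a η + s * I) (by
      rw [Metric.mem_ball, dist_eq_norm, add_sub_cancel_left, norm_mul, norm_I, mul_one, norm_real,
        Real.norm_eq_abs, hs]
      linarith)
    simpa using this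
  have h3 := abs_le.1 (h2 (r / 2) (abs_of_pos (by linarith)))
  have h4 := abs_le.1 (h2 (-(r / 2)) (by rw [abs_neg, abs_of_pos (by linarith)]))
  rw [abs_lt]
  constructor <;> linarith
end

/-! ### The theta-function solution of the model problem -/

section
variable {c a : ℝ}

lemma abs_abelMap_im_lt_band (ha : 0 < a) (hac : a < c) {y : ℝ} (hy : a < |y|) (hyc : |y| ≤ c) :
    |(abelMap c a (rightPt c y)).im| < (period c a).im / 2 := by
  have hg := gapInt_a_pos ha hac
  have hT := period_im_pos ha hac
  have key : ∀ z : ℝ, a < z → z ≤ c → |(abelMap c a (rightPt c z)).im| < (period c a).im / 2 := by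
    intro z h1 h2
    rw [abelMap_band ha hac h1.le h2, add_im, mul_comm I, im_ofReal_mul, I_im, period_im]
    have e1 := bandInt_pos ha hac h1 h2
    have e2 := bandInt_le ha hac h1.le h2
    have e3 : (-(1 / 2) : ℂ).im = 0 := by norm_num
    rw [e3, zero_add, mul_one, ← sub_div, abs_div, abs_of_nonpos (by linarith),
      abs_of_pos (by positivity)]
    rw [div_div, mul_comm (2 : ℝ)]
    gcongr
    linarith
  rcases abs_choice y with h2 | h2
  · rw [h2] at hy hyc
    exact key y hy hyc
  · rw [h2] at hy hyc
    have h3 := key (-y) hy hyc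
    have h4 : rightPt c (-y) ∈ 𝔻c := rightPt_mem (ha.trans hac) (by rw [abs_neg, h2]; exact hyc)
    rw [← neg_neg y, ← rightPt_conj, abelMap_conj ha hac h4]
    simpa using h3

lemma thetaProd_abelMap_gap_ne_zero (ha : 0 < a) (hac : a < c) {y : ℝ} (hy : |y| < a) :
    thetaProd (period c a) (abelMap c a (rightPt c y)) ≠ 0 := by
  have hg := gapInt_a_pos ha hac
  rw [abelMap_gap ha hac hy.le]
  refine thetaProd_ne_zero_of_re (period_im_pos ha hac) ?_
  have h := abs_lt.1 hy
  have h1 := gapInt_lt ha hac (y := y) (z := a) ⟨h.1.le, h.2.le⟩ ⟨by linarith, le_rfl⟩ h.2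
  have h2 := gapInt_lt ha hac (y := -a) (z := y) ⟨le_rfl, by linarith⟩ ⟨h.1.le, h.2.le⟩ h.1
  rw [gapInt_neg] at h2
  rw [abs_neg, abs_div, abs_of_pos (by positivity : 0 < 2 * gapInt c a a),
    div_lt_div_iff₀ (by positivity) two_pos, one_mul]
  have := abs_lt.2 ⟨h2, h1⟩
  linarith

/-- Away from the corners, the theta product does not vanish on the image of the disc. -/
lemma isBigO_quarticRoot_of_ne_zero (ha : 0 < a) (hac : a < c) {ρ : ℂ} (hρ : ρ ∈ 𝔻c)
    (h : thetaProd (period c a) (abelMap c a ρ) ≠ 0) :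
    quarticRoot (nodeE c a) =O[𝓝[𝔻c] ρ] fun η => thetaProd (period c a) (abelMap c a η) := by
  have h1 : ContinuousWithinAt (fun η => thetaProd (period c a) (abelMap c a η)) 𝔻c ρ :=
    (differentiable_thetaProd (period_im_pos ha hac)).continuous.continuousAt.comp_continuousWithinAt
      (continuousOn_abelMap ha hac ρ hρ)
  have h2 := continuousOn_quarticRoot (norm_nodeE ha hac) ρ hρ
  have h3 : ∀ᶠ η in 𝓝[𝔻c] ρ, thetaProd (period c a) (abelMap c a η) ≠ 0 := h1.eventually_ne h
  exact isBigO_of_div_tendsto_nhds (h3.mono fun η h h' => absurd h' h) _ (h2.tendsto.div h1.tendsto h)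

/-- At a corner both sides vanish to the same order: `S` is bounded by the increment of the elliptic
integral, and `P` has a simple zero in the variable `Z`. The two corners considered are congruent
modulo the period 1 of `P`. -/
lemma isBigO_quarticRoot_corner (ha : 0 < a) (hac : a < c) {y : ℝ} (hy : y = a ∨ y = -a) :
    quarticRoot (nodeE c a) =O[𝓝[𝔻c] (rightPt c y)]
      fun η => thetaProd (period c a) (abelMap c a η) := by
  have hE := norm_nodeE ha hac
  have hg : (gapInt c a a : ℂ) ≠ 0 := by exact_mod_cast (gapInt_a_pos ha hac).ne'
  have hT := period_im_pos ha hac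
  have hya : |y| = a := by rcases hy with rfl | rfl <;> simp [abs_of_pos ha]
  have hmem : rightPt c y ∈ 𝔻c := rightPt_mem (ha.trans hac) (by rw [hya]; exact hac.le)
  have hS : quarticRoot (nodeE c a) (rightPt c y) = 0 := by
    have := quarticRoot_rightPt_sq ha hac (y := y) (by rw [hya]; exact hac.le)
    have h2 : (a : ℂ) ^ 2 - (y : ℂ) ^ 2 = 0 := by rcases hy with rfl | rfl <;> simp
    rw [h2, mul_zero] at this
    exact pow_eq_zero_iff two_ne_zero |>.1 this
  have h1 := quarticRoot_isBigO hE (nodeE_ne_conj ha hac) hS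
  have h2 : (fun η => ellInt (nodeE c a) η - ellInt (nodeE c a) (rightPt c y)) =O[𝓝[𝔻c] (rightPt c y)]
      fun η => abelMap c a η - abelMap c a (rightPt c y) := by
    have hne := abelMap_const_ne_zero ha hac
    have e : (fun η => abelMap c a η - abelMap c a (rightPt c y)) = fun η =>
        -(I / (c * gapInt c a a) : ℂ) * (ellInt (nodeE c a) η - ellInt (nodeE c a) (rightPt c y)) := by
      funext η; simp only [abelMap]; ring
    rw [e]
    exact isBigO_self_const_mul hne _ _
  refine (h1.trans h2).trans ?_
  have hcont : Tendsto (abelMap c a) (𝓝[𝔻c] (rightPt c y)) (𝓝 (abelMap c a (rightPt c y))) :=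
    continuousOn_abelMap ha hac _ hmem
  have hO := isBigO_sub_thetaProd hT
  have hZ := abelMap_gap ha hac hya.le
  rcases hy with rfl | rfl
  · have e : abelMap c y (rightPt c y) = -(1 / 2) - period c y / 2 := by
      rw [hZ]; push_cast; field_simp
    rw [e] at hcont ⊢
    exact hO.comp_tendsto hcont
  · have e : abelMap c a (rightPt c (-a)) = -(1 / 2) - period c a / 2 + 1 := by
      rw [hZ, gapInt_neg]; push_cast; field_simp; ring
    rw [e] at hcont ⊢
    have ht : Tendsto (fun η => abelMap c a η - 1) (𝓝[𝔻c] (rightPt c (-a)))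
        (𝓝 (-(1 / 2) - period c a / 2)) := by
      simpa using hcont.sub_const 1
    have := hO.comp_tendsto ht
    refine this.congr (fun η => ?_) (fun η => ?_)
    · simp only [Function.comp]; ring
    · simp only [Function.comp, thetaProd_sub_one]

lemma isBigO_quarticRoot_rightPt (ha : 0 < a) (hac : a < c) {y : ℝ} (hy : |y| ≤ c) :
    quarticRoot (nodeE c a) =O[𝓝[𝔻c] (rightPt c y)]
      fun η => thetaProd (period c a) (abelMap c a η) := by
  have hmem := rightPt_mem (ha.trans hac) hy
  rcases lt_trichotomy |y| a with h | h | h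
  · exact isBigO_quarticRoot_of_ne_zero ha hac hmem (thetaProd_abelMap_gap_ne_zero ha hac h)
  · exact isBigO_quarticRoot_corner ha hac ((abs_eq ha.le).1 h)
  · exact isBigO_quarticRoot_of_ne_zero ha hac hmem
      (thetaProd_ne_zero_of_abs_im_lt (period_im_pos ha hac) (abs_abelMap_im_lt_band ha hac h hy))

lemma isBigO_quarticRoot_thetaProd (ha : 0 < a) (hac : a < c) {ρ : ℂ} (hρ : ρ ∈ 𝔻c) :
    quarticRoot (nodeE c a) =O[𝓝[𝔻c] ρ] fun η => thetaProd (period c a) (abelMap c a η) := by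
  have hc := ha.trans hac
  rcases lt_or_eq_of_le (mem_closedBall_zero_iff.1 hρ) with h | h
  · exact isBigO_quarticRoot_of_ne_zero ha hac hρ (thetaProd_ne_zero_of_abs_im_lt
      (period_im_pos ha hac) (abs_abelMap_im_lt ha hac (mem_ball_zero_iff.2 h)))
  · rcases le_total 0 ρ.re with h0 | h0
    · obtain ⟨y, hy, rfl⟩ := exists_eq_rightPt hc h h0
      exact isBigO_quarticRoot_rightPt ha hac hy
    · obtain ⟨y, hy, hy2⟩ := exists_eq_rightPt hc (η := -ρ) (by rwa [norm_neg]) (by simpa using h0)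
      have ht : Tendsto (fun η : ℂ => -η) (𝓝[𝔻c] ρ) (𝓝[𝔻c] (rightPt c y)) := by
        rw [← hy2]
        refine tendsto_nhdsWithin_of_tendsto_nhds_of_eventually_within _
          (continuous_neg.continuousAt.tendsto.mono_left nhdsWithin_le_nhds) ?_
        filter_upwards [self_mem_nhdsWithin] with η hη
        simpa using hη
      refine ((isBigO_quarticRoot_rightPt ha hac hy).comp_tendsto ht).congr (fun η => ?_) fun η => ?_
      · simp only [Function.comp, quarticRoot_neg]
      · simp only [Function.comp, abelMap_neg, thetaProd_neg]

/-- The theta product vanishes at most to the order of the quartic root. -/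
lemma exists_norm_quarticRoot_le (ha : 0 < a) (hac : a < c) : ∃ C : ℝ, ∀ η ∈ 𝔻c,
    ‖quarticRoot (nodeE c a) η‖ ≤ C * ‖thetaProd (period c a) (abelMap c a η)‖ := by
  refine (isCompact_closedBall (0 : ℂ) 1).induction_on (p := fun s => ∃ C : ℝ, ∀ η ∈ s,
    ‖quarticRoot (nodeE c a) η‖ ≤ C * ‖thetaProd (period c a) (abelMap c a η)‖) ?_ ?_ ?_ ?_
  · exact ⟨0, by simp⟩
  · rintro s t hst ⟨C, hC⟩
    exact ⟨C, fun η hη => hC η (hst hη)⟩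
  · rintro s t ⟨C, hC⟩ ⟨D, hD⟩
    refine ⟨max C D, fun η hη => ?_⟩
    rcases hη with h | h
    · exact (hC η h).trans (by gcongr; exact le_max_left _ _)
    · exact (hD η h).trans (by gcongr; exact le_max_right _ _)
  · intro ρ hρ
    obtain ⟨C, hC⟩ := (isBigO_quarticRoot_thetaProd ha hac hρ).bound
    exact ⟨_, hC, C, fun η h => h⟩

/-- The normalized quotient `P(0) θ₃(z - v)/(θ₃(v) P(z))`, with `P` the theta product. -/
def thetaQuot (T : ℂ) (v : ℝ) (z : ℂ) : ℂ :=
  thetaProd T 0 / jacobiTheta₂ v T * (jacobiTheta₂ (z - v) T / thetaProd T z)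

lemma thetaQuot_add_one (T : ℂ) (v : ℝ) (z : ℂ) : thetaQuot T v (z + 1) = thetaQuot T v z := by
  rw [thetaQuot, thetaProd_add_one, add_sub_right_comm, jacobiTheta₂_add_left, thetaQuot]

lemma thetaQuot_sub_one (T : ℂ) (v : ℝ) (z : ℂ) : thetaQuot T v (z - 1) = thetaQuot T v z := by
  rw [← thetaQuot_add_one T v (z - 1), sub_add_cancel]

/-- Numerator and denominator have the same quasi-periods, so only the contribution of the shift `v`
survives. With `Λ = 2πv` the multiplier is `e^{iΛ}`. -/
lemma thetaQuot_add_period {T : ℂ} (hT : 0 < T.im) (v : ℝ) (z : ℂ) :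
    thetaQuot T v (z + T) = exp (I * (2 * Real.pi * v)) * thetaQuot T v z := by
  rw [thetaQuot, thetaProd_add_period hT, add_sub_right_comm, jacobiTheta₂_add_left', thetaQuot]
  have e : exp (-Real.pi * I * (T + 2 * (z - v))) =
      exp (I * (2 * Real.pi * v)) * exp (-Real.pi * I * (T + 2 * z)) := by
    rw [← exp_add]; congr 1; ring
  rw [e]
  have := exp_ne_zero (-Real.pi * I * (T + 2 * z))
  field_simp

lemma period_eq (c a : ℝ) : period c a = I * ((bandInt c a c / gapInt c a a : ℝ) : ℂ) := rfl

lemma jacobiTheta₂_period_ne_zero (ha : 0 < a) (hac : a < c) (v : ℝ) :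
    jacobiTheta₂ v (period c a) ≠ 0 := by
  obtain ⟨r, hr, h⟩ := jacobiTheta₂_pos (div_pos (bandInt_c_pos ha hac) (gapInt_a_pos ha hac)) v
  rw [period_eq, h]
  exact_mod_cast hr.ne'

lemma thetaProd_zero_ne_zero {T : ℂ} (hT : 0 < T.im) : thetaProd T 0 ≠ 0 :=
  thetaProd_ne_zero_of_abs_im_lt hT (by simpa using hT)

lemma thetaQuot_zero (ha : 0 < a) (hac : a < c) (v : ℝ) : thetaQuot (period c a) v 0 = 1 := by
  have h1 := jacobiTheta₂_period_ne_zero ha hac v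
  have h2 := thetaProd_zero_ne_zero (period_im_pos ha hac)
  rw [thetaQuot, zero_sub, jacobiTheta₂_neg_left]
  field_simp

lemma differentiableAt_thetaQuot {T : ℂ} (hT : 0 < T.im) (v : ℝ) {z : ℂ} (hz : thetaProd T z ≠ 0) :
    DifferentiableAt ℂ (thetaQuot T v) z := by
  have h1 : DifferentiableAt ℂ (fun z => jacobiTheta₂ (z - v) T) z :=
    (differentiableAt_jacobiTheta₂_fst (z - v) hT).comp z (differentiableAt_id.sub_const _)
  exact (h1.div (differentiable_thetaProd hT z) hz).const_mul _

/-- The theta-function solution of the model problem with `Λ = 2πv`. -/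
def modelSol (c a v : ℝ) (k : ℂ) : Fin 2 → ℂ :=
  ![sqrtRatio c a k ^ (1 / 2 : ℂ) * thetaQuot (period c a) v (abelMap c a (discMap c k)),
    sqrtRatio c a k ^ (1 / 2 : ℂ) * thetaQuot (period c a) v (-abelMap c a (discMap c k))]

lemma thetaProd_abelMap_ne_zero (ha : 0 < a) (hac : a < c) {η : ℂ} (hη : η ∈ 𝔻) :
    thetaProd (period c a) (abelMap c a η) ≠ 0 :=
  thetaProd_ne_zero_of_abs_im_lt (period_im_pos ha hac) (abs_abelMap_im_lt ha hac hη)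

lemma sqrtRatio_mem_slitPlane (ha : 0 < a) (hac : a < c) {k : ℂ} (hk : k ∈ cutPlane c) :
    sqrtRatio c a k ∈ slitPlane :=
  Or.inl (cpow_half_re_pos (ratio_mem_slitPlane ha hac hk))

lemma modelSol_holomorphic (ha : 0 < a) (hac : a < c) (v : ℝ) :
    DifferentiableOn ℂ (modelSol c a v) (cutPlane c) := by
  have hc := ha.trans hac
  have hT := period_im_pos ha hac
  intro k hk
  have hη := discMap_mem hc hk
  have hP := thetaProd_abelMap_ne_zero ha hac hη
  have h1 : DifferentiableWithinAt ℂ (fun k => sqrtRatio c a k ^ (1 / 2 : ℂ)) (cutPlane c) k :=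
    (differentiableOn_sqrtRatio ha hac k hk).cpow_const (sqrtRatio_mem_slitPlane ha hac hk)
  have h2 : DifferentiableWithinAt ℂ (fun k => abelMap c a (discMap c k)) (cutPlane c) k :=
    (hasDerivAt_abelMap ha hac hη).differentiableAt.comp_differentiableWithinAt k
      (differentiableOn_discMap hc k hk)
  have h3 : DifferentiableWithinAt ℂ
      (fun k => thetaQuot (period c a) v (abelMap c a (discMap c k))) (cutPlane c) k :=
    DifferentiableAt.comp_differentiableWithinAt (g := thetaQuot (period c a) v) k
      (differentiableAt_thetaQuot hT v hP) h2
  have h4 : DifferentiableWithinAt ℂ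
      (fun k => thetaQuot (period c a) v (-abelMap c a (discMap c k))) (cutPlane c) k :=
    DifferentiableAt.comp_differentiableWithinAt (g := thetaQuot (period c a) v) k
      (differentiableAt_thetaQuot hT v (by rwa [thetaProd_neg])) h2.neg
  rw [differentiableWithinAt_pi]
  intro i
  fin_cases i
  · exact h1.mul h3
  · exact h1.mul h4

lemma modelSol_symmetry (c a v : ℝ) (k : ℂ) :
    modelSol c a v (-k) = Matrix.vecMul (modelSol c a v k) !![0, 1; 1, 0] := by
  rw [modelSol, sqrtRatio_neg, discMap_neg, abelMap_neg, neg_neg, modelSol]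
  ext i
  fin_cases i <;> simp [Matrix.vecMul, dotProduct, Fin.sum_univ_two]

lemma tendsto_cpow_half {F : Filter ℂ} {f : ℂ → ℂ} {z : ℂ} (h : Tendsto f F (𝓝 z))
    (hz : z ∈ slitPlane) : Tendsto (fun k => f k ^ (1 / 2 : ℂ)) F (𝓝 (z ^ (1 / 2 : ℂ))) :=
  (continuousAt_cpow_const hz).tendsto.comp h

lemma modelSol_normalization (ha : 0 < a) (hac : a < c) (v : ℝ) :
    Tendsto (modelSol c a v) (Bornology.cobounded ℂ) (𝓝 ![1, 1]) := by
  have hT := period_im_pos ha hac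
  have h1 : Tendsto (fun k => sqrtRatio c a k ^ (1 / 2 : ℂ)) (Bornology.cobounded ℂ) (𝓝 1) := by
    have := tendsto_cpow_half (tendsto_sqrtRatio_cobounded c a) (Or.inl (by simp))
    rwa [one_cpow] at this
  have h2 : Tendsto (fun k => abelMap c a (discMap c k)) (Bornology.cobounded ℂ) (𝓝 0) := by
    have := (hasDerivAt_abelMap ha hac (η := 0) (by simp)).continuousAt.tendsto.comp
      (tendsto_discMap_cobounded c)
    rwa [abelMap_zero] at this
  have h3 : Tendsto (thetaQuot (period c a) v) (𝓝 0) (𝓝 1) := by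
    have := (differentiableAt_thetaQuot hT v (thetaProd_zero_ne_zero hT)).continuousAt.tendsto
    rwa [thetaQuot_zero ha hac] at this
  have h4 := h2.neg
  rw [neg_zero] at h4
  refine tendsto_pi_nhds.2 fun i => ?_
  fin_cases i
  · have := h1.mul (h3.comp h2)
    rw [mul_one] at this
    exact this
  · have := h1.mul (h3.comp h4)
    rw [mul_one] at this
    exact this

/-- The left side of `iy` corresponds to the reflection of the right boundary point in the imaginary
axis, so the boundary values of `Z` from the two sides are complex conjugates. The jump relations
reduce to comparing `Z` with its conjugate. -/
lemma abelMap_neg_conj (ha : 0 < a) (hac : a < c) {y : ℝ} (hy : |y| ≤ c) :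
    abelMap c a (-rightPt c (-y)) = (starRingEnd ℂ) (abelMap c a (rightPt c y)) := by
  rw [← rightPt_conj, abelMap_neg, abelMap_conj ha hac (rightPt_mem (ha.trans hac) hy), neg_neg]

lemma conj_abelMap_gap (ha : 0 < a) (hac : a < c) {y : ℝ} (hy : |y| ≤ a) :
    (starRingEnd ℂ) (abelMap c a (rightPt c y)) = abelMap c a (rightPt c y) + period c a := by
  rw [abelMap_gap ha hac hy, map_sub, conj_ofReal, period]
  simp only [map_div₀, map_mul, conj_I, conj_ofReal, map_ofNat]
  ring

lemma conj_abelMap_band (ha : 0 < a) (hac : a < c) {y : ℝ} (hy : a ≤ |y|) (hyc : |y| ≤ c) :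
    (starRingEnd ℂ) (abelMap c a (rightPt c y)) = -abelMap c a (rightPt c y) - 1 ∨
    (starRingEnd ℂ) (abelMap c a (rightPt c y)) = -abelMap c a (rightPt c y) + 1 := by
  rcases abs_choice y with h2 | h2
  · left
    rw [h2] at hy hyc
    rw [abelMap_band ha hac hy hyc]
    simp only [map_add, map_neg, map_mul, conj_I, conj_ofReal, map_div₀, map_ofNat, map_one]
    ring
  · right
    have h4 : rightPt c (-y) ∈ 𝔻c := rightPt_mem (ha.trans hac) (by rwa [abs_neg])
    rw [h2] at hy hyc
    have e : abelMap c a (rightPt c y) = -(starRingEnd ℂ) (abelMap c a (rightPt c (-y))) := by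
      rw [← abelMap_conj ha hac h4, rightPt_conj, neg_neg]
    rw [e, abelMap_band ha hac hy hyc]
    simp only [map_add, map_neg, map_mul, conj_I, conj_ofReal, map_div₀, map_ofNat, map_one]
    ring

/-- The one-sided limits of the components, given the limits of their factors. -/
lemma tendsto_modelSol (ha : 0 < a) (hac : a < c) (v : ℝ) {F : Filter ℂ} {ρ g : ℂ} (hρ : ρ ∈ 𝔻c)
    (hP : thetaProd (period c a) (abelMap c a ρ) ≠ 0)
    (hF : cutPlane c ∈ F)
    (hη : Tendsto (discMap c) F (𝓝 ρ))
    (hg : Tendsto (fun k => sqrtRatio c a k ^ (1 / 2 : ℂ)) F (𝓝 g)) :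
    Tendsto (modelSol c a v) F (𝓝 ![g * thetaQuot (period c a) v (abelMap c a ρ),
      g * thetaQuot (period c a) v (-abelMap c a ρ)]) := by
  have hT := period_im_pos ha hac
  have h1 : Tendsto (discMap c) F (𝓝[𝔻c] ρ) := by
    refine tendsto_nhdsWithin_of_tendsto_nhds_of_eventually_within _ hη ?_
    filter_upwards [hF] with k hk
    exact Metric.ball_subset_closedBall (discMap_mem (ha.trans hac) hk)
  have h2 : Tendsto (fun k => abelMap c a (discMap c k)) F (𝓝 (abelMap c a ρ)) :=
    (continuousOn_abelMap ha hac ρ hρ).tendsto.comp h1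
  have h3 := (differentiableAt_thetaQuot hT v hP).continuousAt.tendsto.comp h2
  have h4 := (differentiableAt_thetaQuot hT v
    (z := -abelMap c a ρ) (by rwa [thetaProd_neg])).continuousAt.tendsto.comp h2.neg
  refine tendsto_pi_nhds.2 fun i => ?_
  fin_cases i
  · exact hg.mul h3
  · exact hg.mul h4

/-- On the gap the two values of `Z` differ by `T`, which multiplies the components by `e^{±iΛ}`. On
a band they are opposite modulo 1, which interchanges the components, and the factor `±i` comes from
the fourth root. -/
lemma modelSol_jump (ha : 0 < a) (hac : a < c) (v : ℝ) {y : ℝ} (hyc : |y| < c) (hya : |y| ≠ a) :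
    ∃ mp mm : Fin 2 → ℂ,
    Tendsto (modelSol c a v) (𝓝[{k : ℂ | 0 < k.re}] (I * y)) (𝓝 mp) ∧
    Tendsto (modelSol c a v) (𝓝[{k : ℂ | k.re < 0}] (I * y)) (𝓝 mm) ∧
    mp = Matrix.vecMul mm (modelJump a (2 * Real.pi * v) y) := by
  have hc := ha.trans hac
  have hT := period_im_pos ha hac
  have hρ := rightPt_mem hc hyc.le
  have hρ' : -rightPt c (-y) ∈ 𝔻c := by
    simpa using rightPt_mem hc (y := -y) (by rw [abs_neg]; exact hyc.le)
  have hR : cutPlane c ∈ 𝓝[{k : ℂ | 0 < k.re}] (I * y) := by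
    filter_upwards [self_mem_nhdsWithin] with k hk
    exact mem_cutPlane_of_re_ne_zero (ne_of_gt hk)
  have hL : cutPlane c ∈ 𝓝[{k : ℂ | k.re < 0}] (I * y) := by
    filter_upwards [self_mem_nhdsWithin] with k hk
    exact mem_cutPlane_of_re_ne_zero (ne_of_lt hk)
  have hηR := tendsto_discMap_right hc hyc
  have hηL := tendsto_discMap_left hc hyc
  have hconj := abelMap_neg_conj ha hac hyc.le
  rcases lt_or_gt_of_ne hya with h | h
  · have hs := tendsto_sqrtRatio_gap hac h
    have h1 := abs_lt_sq h
    have h2 := abs_lt_sq hyc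
    have hpos : 0 < Real.sqrt ((a ^ 2 - y ^ 2) / (c ^ 2 - y ^ 2)) :=
      Real.sqrt_pos.2 (div_pos (by linarith) (by linarith))
    have hg := tendsto_cpow_half hs (Or.inl (by simpa using hpos))
    have hP := thetaProd_abelMap_gap_ne_zero ha hac h
    have hcg := conj_abelMap_gap ha hac h.le
    have hP' : thetaProd (period c a) (abelMap c a (-rightPt c (-y))) ≠ 0 := by
      rw [hconj, hcg, thetaProd_add_period hT]
      exact mul_ne_zero (exp_ne_zero _) hP
    refine ⟨_, _, tendsto_modelSol ha hac v hρ hP hR hηR (hg.mono_left nhdsWithin_le_nhds),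
      tendsto_modelSol ha hac v hρ' hP' hL hηL (hg.mono_left nhdsWithin_le_nhds), ?_⟩
    rw [vecMul_modelJump_gap _ h, hconj, hcg]
    have e1 := thetaQuot_add_period hT v (abelMap c a (rightPt c y))
    have e2 := thetaQuot_add_period hT v (-(abelMap c a (rightPt c y) + period c a))
    rw [neg_add, neg_add_cancel_right] at e2
    have e3 : exp (-I * (2 * Real.pi * v)) * exp (I * (2 * Real.pi * v)) = 1 := by
      rw [← exp_add]; simp
    ext i
    fin_cases i
    · simp only [Fin.zero_eta, Matrix.cons_val_zero, Matrix.cons_val_one]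
      rw [e1]
      linear_combination -(Real.sqrt ((a ^ 2 - y ^ 2) / (c ^ 2 - y ^ 2)) : ℂ) ^ (1 / 2 : ℂ) *
        thetaQuot (period c a) v (abelMap c a (rightPt c y)) * e3
    · simp only [Fin.mk_one, Matrix.cons_val_zero, Matrix.cons_val_one]
      rw [e2, neg_add]
      ring
  · obtain ⟨r, hr, hsR, hsL⟩ := tendsto_sqrtRatio_band ha hac h hyc
    set σ : ℂ := if 0 < y then I else -I with hσ
    have hσI : σ = I ∨ σ = -I := by rw [hσ]; split_ifs <;> simp
    have hgR := tendsto_cpow_half hsR (Or.inr (by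
      rcases hσI with h | h <;> simp [h, hr.ne']))
    have hgL := tendsto_cpow_half hsL (Or.inr (by
      rcases hσI with h | h <;> simp [h, hr.ne']))
    have hP := thetaProd_ne_zero_of_abs_im_lt hT (abs_abelMap_im_lt_band ha hac h hyc.le)
    have hcb := conj_abelMap_band ha hac h.le hyc.le
    have hP' : thetaProd (period c a) (abelMap c a (-rightPt c (-y))) ≠ 0 := by
      rw [hconj]
      rcases hcb with hcb | hcb
      · rw [hcb, thetaProd_sub_one, thetaProd_neg]; exact hP
      · rw [hcb, thetaProd_add_one, thetaProd_neg]; exact hP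
    refine ⟨_, _, tendsto_modelSol ha hac v hρ hP hR hηR hgR,
      tendsto_modelSol ha hac v hρ' hP' hL hηL hgL, ?_⟩
    -- The one-sided limits of `sqrtRatio` are opposite imaginary numbers; their principal roots
    -- differ by `i` or `-i`, according to the half-plane in which they lie.
    have hroot : (σ * r) ^ (1 / 2 : ℂ) = σ * (-(σ * r)) ^ (1 / 2 : ℂ) := by
      rcases hσI with h | h
      · rw [h]; exact cpow_half_eq_I_mul (Or.inl (by simpa using hr))
      · rw [h]
        have := cpow_half_eq_I_mul (z := I * r) (Or.inl (by simpa using hr))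
        rw [neg_mul, neg_neg, this, ← mul_assoc]
        simp
    rw [vecMul_modelJump_band ha _ h, hconj, ← hσ, hroot]
    have e1 : thetaQuot (period c a) v ((starRingEnd ℂ) (abelMap c a (rightPt c y))) =
        thetaQuot (period c a) v (-abelMap c a (rightPt c y)) := by
      rcases hcb with hcb | hcb <;> rw [hcb]
      · rw [thetaQuot_sub_one]
      · rw [thetaQuot_add_one]
    have e2 : thetaQuot (period c a) v (-(starRingEnd ℂ) (abelMap c a (rightPt c y))) =
        thetaQuot (period c a) v (abelMap c a (rightPt c y)) := by
      rcases hcb with hcb | hcb <;> rw [hcb]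
      · rw [neg_sub, sub_neg_eq_add, add_comm, thetaQuot_add_one]
      · rw [neg_add, neg_neg, ← sub_eq_add_neg, thetaQuot_sub_one]
    ext i
    fin_cases i
    · simp only [Fin.zero_eta, Matrix.cons_val_zero, Matrix.cons_val_one]
      rw [e2]; ring
    · simp only [Fin.mk_one, Matrix.cons_val_zero, Matrix.cons_val_one]
      rw [e1]; ring
end

/-! ### Behaviour at the branch points and the zero of the product -/

section
variable {c a : ℝ}

lemma norm_thetaQuot_le (ha : 0 < a) (hac : a < c) (v : ℝ) : ∃ C : ℝ, ∀ η ∈ 𝔻c,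
    ‖quarticRoot (nodeE c a) η‖ * ‖thetaQuot (period c a) v (abelMap c a η)‖ ≤ C := by
  have hT := period_im_pos ha hac
  obtain ⟨C, hC⟩ := exists_norm_quarticRoot_le ha hac
  have hcont : ContinuousOn (fun η => jacobiTheta₂ (abelMap c a η - v) (period c a)) 𝔻c := by
    intro η hη
    exact (differentiableAt_jacobiTheta₂_fst (abelMap c a η - v) hT).continuousAt.tendsto.comp
      (Tendsto.sub_const (continuousOn_abelMap ha hac η hη) (v : ℂ))
  obtain ⟨D, hD⟩ := (isCompact_closedBall (0 : ℂ) 1).exists_bound_of_continuousOn hcont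
  set A : ℂ := thetaProd (period c a) 0 / jacobiTheta₂ v (period c a)
  refine ⟨‖A‖ * (|C| * |D|), fun η hη => ?_⟩
  have h1 := hC η hη
  have h2 := (hD η hη).trans (le_abs_self D)
  have h3 : 0 ≤ |C| * |D| := by positivity
  rw [thetaQuot, norm_mul, norm_div (jacobiTheta₂ _ _)]
  change _ * (‖A‖ * _) ≤ _
  generalize ‖thetaProd (period c a) (abelMap c a η)‖ = p at *
  -- At the corners `p = 0`; the quotient is then 0 by the convention for division and the bound
  -- still holds.
  have h4 : ‖quarticRoot (nodeE c a) η‖ / p ≤ |C| := by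
    rcases le_or_gt p 0 with hp | hp
    · exact (div_nonpos_of_nonneg_of_nonpos (norm_nonneg _) hp).trans (abs_nonneg C)
    · rw [div_le_iff₀ hp]
      exact h1.trans (by gcongr; exact le_abs_self C)
  calc _ = ‖A‖ * ((‖quarticRoot (nodeE c a) η‖ / p) *
        ‖jacobiTheta₂ (abelMap c a η - v) (period c a)‖) := by ring
    _ ≤ _ := by gcongr

lemma norm_thetaQuot_neg_le (ha : 0 < a) (hac : a < c) (v : ℝ) : ∃ C : ℝ, ∀ η ∈ 𝔻c,
    ‖quarticRoot (nodeE c a) η‖ * ‖thetaQuot (period c a) v (-abelMap c a η)‖ ≤ C := by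
  obtain ⟨C, hC⟩ := norm_thetaQuot_le ha hac v
  refine ⟨C, fun η hη => ?_⟩
  have := hC (-η) (by simpa using hη)
  rwa [quarticRoot_neg, abelMap_neg] at this

/-- `1/w` bounds the square of the components of the model solution. -/
lemma norm_component_le (ha : 0 < a) (hac : a < c) {C : ℝ} {k g : ℂ} (hk : k ∈ cutPlane c)
    (h : ‖quarticRoot (nodeE c a) (discMap c k)‖ * ‖g‖ ≤ C) :
    ‖sqrtRatio c a k ^ (1 / 2 : ℂ) * g‖ ^ 4 * ‖w c a k‖ ^ 2 * ‖discMap c k‖ ^ 4 ≤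
      C ^ 4 * c ^ 4 / 16 := by
  have hc := ha.trans hac
  set s := ‖sqrtRatio c a k‖ with hs
  set η := discMap c k
  have hs0 : 0 < s := norm_pos_iff.2 (sqrtRatio_ne_zero ha hac hk)
  have hη0 : 0 < ‖1 + η ^ 2‖ := norm_pos_iff.2 (one_add_sq_ne_zero (discMap_mem hc hk))
  have hS : ‖quarticRoot (nodeE c a) η‖ = s * ‖1 + η ^ 2‖ := by
    rw [quarticRoot_discMap ha hac hk, norm_mul]
  have hw : 4 * ‖η‖ ^ 2 * ‖w c a k‖ = c ^ 2 * ‖1 + η ^ 2‖ * (s * ‖1 + η ^ 2‖) := by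
    have := congrArg norm (w_discMap ha hac hk)
    rw [norm_mul, norm_mul, norm_mul, norm_mul, norm_pow, norm_pow, norm_real, Real.norm_eq_abs,
      abs_of_pos hc, hS] at this
    simpa using this
  have hr : ‖sqrtRatio c a k ^ (1 / 2 : ℂ)‖ ^ 2 = s := by
    rw [← norm_pow, cpow_half_sq]
  rw [hS] at h
  set r := ‖sqrtRatio c a k ^ (1 / 2 : ℂ)‖
  -- The powers are chosen so that all roots combine: `sqrtRatio² w² η⁴ = c⁴ S⁴ / 16`.
  have e : ‖sqrtRatio c a k ^ (1 / 2 : ℂ) * g‖ ^ 4 * ‖w c a k‖ ^ 2 * ‖η‖ ^ 4 =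
      (s * ‖1 + η ^ 2‖ * ‖g‖) ^ 4 * c ^ 4 / 16 := by
    rw [norm_mul]
    have e1 : (r * ‖g‖) ^ 4 * ‖w c a k‖ ^ 2 * ‖η‖ ^ 4 =
      (r ^ 2) ^ 2 * ‖g‖ ^ 4 * (4 * ‖η‖ ^ 2 * ‖w c a k‖) ^ 2 / 16 := by ring
    rw [e1, hr, hw]; ring
  rw [e]
  gcongr

/-- If `|k| < 2c` and `|η| < 3/16`, then `|2kη| < 3c/4`, whereas `c|1 - η²| ≥ 3c/4`. Only the
existence of a positive lower bound matters. -/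
lemma eventually_le_norm_discMap (hc : 0 < c) {κ : ℂ} (hκ : ‖κ‖ ≤ c) :
    ∀ᶠ k in 𝓝[cutPlane c] κ, (3 / 16 : ℝ) ≤ ‖discMap c k‖ := by
  have h1 : ∀ᶠ k in 𝓝[cutPlane c] κ, ‖k‖ < 2 * c :=
    nhdsWithin_le_nhds (continuous_norm.continuousAt.eventually_lt_const (by linarith))
  filter_upwards [h1, self_mem_nhdsWithin] with k hk hkc
  by_contra! hlt
  have := congrArg norm (two_mul_discMap hc hkc)
  rw [norm_mul, norm_mul, norm_mul, norm_real, Real.norm_eq_abs, abs_of_pos hc] at this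
  have h2 : ‖(1 : ℂ)‖ - ‖discMap c k ^ 2‖ ≤ ‖1 - discMap c k ^ 2‖ := norm_sub_norm_le _ _
  rw [norm_pow, norm_one] at h2
  have h3 : ‖(2 : ℂ)‖ = 2 := by simp
  rw [h3] at this
  have h4 := norm_nonneg (discMap c k)
  have h5 : ‖discMap c k‖ ^ 2 ≤ 1 / 4 := by nlinarith
  have h6 : 2 * ‖k‖ * ‖discMap c k‖ ≤ 2 * (2 * c) * (3 / 16) := by gcongr
  have h7 : c * (3 / 4) ≤ c * ‖1 - discMap c k ^ 2‖ := by gcongr; linarith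
  have h8 : ‖k‖ * ‖discMap c k‖ < 2 * c * (3 / 16) := by
    have := mul_le_mul_of_nonneg_left hlt.le (norm_nonneg k)
    nlinarith
  nlinarith

/-- `w² = (k² + a²)(k² + c²)` has simple zeros at the four branch points. -/
lemma isBigO_sub_w_sq (ha : 0 < a) (hac : a < c) {κ : ℂ} (hκ : κ ∈ branchPoints c a) :
    (fun k : ℂ => k - κ) =O[𝓝[cutPlane c] κ] fun k => w c a k ^ 2 := by
  have hc := ha.trans hac
  have hne : (c : ℂ) ^ 2 - (a : ℂ) ^ 2 ≠ 0 := by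
    have : (c ^ 2 - a ^ 2 : ℝ) ≠ 0 := by nlinarith
    exact_mod_cast this
  have key : ∀ b d : ℂ, κ ≠ 0 → κ ^ 2 + b = 0 → d - b ≠ 0 →
      (fun k : ℂ => k - κ) =O[𝓝 κ] fun k => (k ^ 2 + b) * (k ^ 2 + d) := by
    intro b d h0 hb hd
    have h1 : Tendsto (fun k : ℂ => (k + κ) * (k ^ 2 + d)) (𝓝 κ) (𝓝 ((κ + κ) * (κ ^ 2 + d))) :=
      (by fun_prop : Continuous fun k : ℂ => (k + κ) * (k ^ 2 + d)).tendsto κ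
    have h2 : (κ + κ) * (κ ^ 2 + d) ≠ 0 := by
      rw [← two_mul]
      refine mul_ne_zero (mul_ne_zero two_ne_zero h0) ?_
      rwa [show κ ^ 2 + d = d - b by linear_combination hb]
    have h3 : (fun _ : ℂ => (1 : ℂ)) =O[𝓝 κ] fun k => (k + κ) * (k ^ 2 + d) :=
      (isBigO_const_left_iff_pos_le_norm one_ne_zero).2
        ⟨‖(κ + κ) * (κ ^ 2 + d)‖ / 2, half_pos (norm_pos_iff.2 h2),
          (h1.norm.eventually_const_lt (half_lt_self (norm_pos_iff.2 h2))).mono fun _ h => h.le⟩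
    have h4 := (isBigO_refl (fun k : ℂ => k - κ) (𝓝 κ)).mul h3
    refine h4.congr (fun k => mul_one _) fun k => ?_
    linear_combination -(k ^ 2 + d) * hb
  have ha0 : (a : ℂ) ≠ 0 := by exact_mod_cast ha.ne'
  have hc0 : (c : ℂ) ≠ 0 := by exact_mod_cast hc.ne'
  have hmain : (fun k : ℂ => k - κ) =O[𝓝 κ]
      fun k => (k ^ 2 + (a : ℂ) ^ 2) * (k ^ 2 + (c : ℂ) ^ 2) := by
    have hA : κ ≠ 0 → κ ^ 2 + (a : ℂ) ^ 2 = 0 → _ := fun h0 h => key _ ((c : ℂ) ^ 2) h0 h hne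
    have hC : κ ≠ 0 → κ ^ 2 + (c : ℂ) ^ 2 = 0 → _ := fun h0 h =>
      key _ ((a : ℂ) ^ 2) h0 h (by rw [← neg_sub]; exact neg_ne_zero.2 hne)
    rcases hκ with rfl | rfl | rfl | rfl
    · exact (hC (mul_ne_zero I_ne_zero hc0) (by rw [mul_pow, I_sq]; ring)).congr_right fun k => mul_comm _ _
    · exact hA (mul_ne_zero I_ne_zero ha0) (by rw [mul_pow, I_sq]; ring)
    · exact hA (neg_ne_zero.2 (mul_ne_zero I_ne_zero ha0)) (by rw [neg_sq, mul_pow, I_sq]; ring)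
    · exact (hC (neg_ne_zero.2 (mul_ne_zero I_ne_zero hc0))
        (by rw [neg_sq, mul_pow, I_sq]; ring)).congr_right fun k => mul_comm _ _
  refine (hmain.mono nhdsWithin_le_nhds).congr' .rfl ?_
  filter_upwards [self_mem_nhdsWithin] with k hk
  rw [w_sq a (sq_add_sq_ne_zero hc.le le_rfl hc hk)]

lemma norm_le_of_mem_branchPoints (ha : 0 < a) (hac : a < c) {κ : ℂ} (hκ : κ ∈ branchPoints c a) :
    ‖κ‖ ≤ c := by
  have hc := ha.trans hac
  rcases hκ with rfl | rfl | rfl | rfl <;> simp [abs_of_pos ha, abs_of_pos hc, hac.le]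

lemma isBigO_rpow_of_pow_four_mul_le {l : Filter ℂ} {f : ℂ → ℂ} {κ : ℂ} {M : ℝ}
    (hne : ∀ᶠ k in l, k ≠ κ) (h : ∀ᶠ k in l, ‖f k‖ ^ 4 * ‖k - κ‖ ≤ M) :
    f =O[l] fun k => ‖k - κ‖ ^ (-(1 / 4) : ℝ) := by
  refine IsBigO.of_bound (M ^ (1 / 4 : ℝ)) ?_
  filter_upwards [hne, h] with k hk hM
  have h0 : 0 < ‖k - κ‖ := norm_pos_iff.2 (sub_ne_zero.2 hk)
  have hM0 : 0 ≤ M := le_trans (by positivity) hM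
  have e : ‖f k‖ = (‖f k‖ ^ 4) ^ (1 / 4 : ℝ) := by
    rw [← Real.rpow_natCast, ← Real.rpow_mul (norm_nonneg _)]; norm_num
  rw [Real.norm_of_nonneg (by positivity), e, Real.rpow_neg h0.le, ← div_eq_mul_inv,
    ← Real.div_rpow hM0 h0.le]
  exact Real.rpow_le_rpow (by positivity) ((le_div_iff₀ h0).2 hM) (by norm_num)

lemma isBigO_component (ha : 0 < a) (hac : a < c) {κ : ℂ} (hκ : κ ∈ branchPoints c a) {g : ℂ → ℂ}
    (hg : ∃ C : ℝ, ∀ k ∈ cutPlane c, ‖quarticRoot (nodeE c a) (discMap c k)‖ * ‖g k‖ ≤ C) :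
    (fun k => sqrtRatio c a k ^ (1 / 2 : ℂ) * g k) =O[𝓝[cutPlane c] κ]
      fun k => ‖k - κ‖ ^ (-(1 / 4) : ℝ) := by
  have hc := ha.trans hac
  obtain ⟨C, hC⟩ := hg
  obtain ⟨D, hD0, hD⟩ := (isBigO_sub_w_sq ha hac hκ).exists_nonneg
  refine isBigO_rpow_of_pow_four_mul_le (M := D * ((16 / 3) ^ 4 * (C ^ 4 * c ^ 4 / 16))) ?_ ?_
  · filter_upwards [self_mem_nhdsWithin] with k hk h
    subst h
    have hk' : k.re = 0 ∧ |k.im| ≤ c := by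
      rcases hκ with rfl | rfl | rfl | rfl <;> simp [abs_of_pos ha, abs_of_pos hc, hac.le]
    exact hk hk'
  · filter_upwards [self_mem_nhdsWithin, hD.bound,
      eventually_le_norm_discMap hc (norm_le_of_mem_branchPoints ha hac hκ)] with k hk h1 h2
    have h3 := norm_component_le ha hac hk (hC k hk)
    rw [norm_pow] at h1
    set F := ‖sqrtRatio c a k ^ (1 / 2 : ℂ) * g k‖
    have h4 : (1 : ℝ) ≤ (16 / 3) ^ 4 * ‖discMap c k‖ ^ 4 := by
      rw [← mul_pow]
      exact one_le_pow₀ (by linarith)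
    calc F ^ 4 * ‖k - κ‖ ≤ F ^ 4 * (D * ‖w c a k‖ ^ 2) := by gcongr
      _ = D * (F ^ 4 * ‖w c a k‖ ^ 2) * 1 := by ring
      _ ≤ D * (F ^ 4 * ‖w c a k‖ ^ 2) * ((16 / 3) ^ 4 * ‖discMap c k‖ ^ 4) := by gcongr
      _ = D * ((16 / 3) ^ 4 * (F ^ 4 * ‖w c a k‖ ^ 2 * ‖discMap c k‖ ^ 4)) := by ring
      _ ≤ _ := by gcongr

lemma modelSol_singularity (ha : 0 < a) (hac : a < c) (v : ℝ) {κ : ℂ} (hκ : κ ∈ branchPoints c a) :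
    modelSol c a v =O[𝓝[cutPlane c] κ] fun k => ‖k - κ‖ ^ (-(1 / 4) : ℝ) := by
  have hc := ha.trans hac
  have hd : ∀ k ∈ cutPlane c, discMap c k ∈ 𝔻c := fun k hk =>
    Metric.ball_subset_closedBall (discMap_mem hc hk)
  obtain ⟨C, hC⟩ := norm_thetaQuot_le ha hac v
  obtain ⟨D, hD⟩ := norm_thetaQuot_neg_le ha hac v
  rw [isBigO_pi]
  intro i
  fin_cases i
  · exact isBigO_component ha hac hκ
      (g := fun k => thetaQuot (period c a) v (abelMap c a (discMap c k)))
      ⟨C, fun k hk => hC _ (hd k hk)⟩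
  · exact isBigO_component ha hac hκ
      (g := fun k => thetaQuot (period c a) v (-abelMap c a (discMap c k)))
      ⟨D, fun k hk => hD _ (hd k hk)⟩

/-- The theta-function vector solves the model problem. -/
lemma isModelSolution_modelSol (ha : 0 < a) (hac : a < c) (v : ℝ) :
    IsModelSolution c a (2 * Real.pi * v) (modelSol c a v) where
  holomorphic := modelSol_holomorphic ha hac v
  jump _ hyc hya := modelSol_jump ha hac v hyc hya
  symmetry k _ := modelSol_symmetry c a v k
  normalization := modelSol_normalization ha hac v
  singularity _ hκ := modelSol_singularity ha hac v hκ

lemma modelSol_mul_mul_w (hc : 0 < c) (v : ℝ) {k : ℂ} (hk : k ∈ cutPlane c) :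
    modelSol c a v k 0 * modelSol c a v k 1 * w c a k = (k ^ 2 + (a : ℂ) ^ 2) *
      (thetaQuot (period c a) v (abelMap c a (discMap c k)) *
        thetaQuot (period c a) v (-abelMap c a (discMap c k))) := by
  have h1 := sqrtRatio_sq c a k
  have h2 := sq_add_sq_ne_zero hc.le le_rfl hc hk
  rw [eq_div_iff h2] at h1
  have h3 := cpow_half_sq (sqrtRatio c a k)
  simp only [modelSol, Matrix.cons_val_zero, Matrix.cons_val_one, w]
  set f := thetaQuot (period c a) v (abelMap c a (discMap c k))
  set g := thetaQuot (period c a) v (-abelMap c a (discMap c k))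
  linear_combination f * g * (k ^ 2 + (c : ℂ) ^ 2) * sqrtRatio c a k * h3 + f * g * h1

/-- Evenness and the period 1 make the values at `1/2 ± T/2` equal, while the quasi-period `T` makes
them opposite. -/
lemma jacobiTheta₂_half_sub_half (T : ℂ) : jacobiTheta₂ (1 / 2 - T / 2) T = 0 := by
  have h1 := jacobiTheta₂_add_left' (1 / 2 - T / 2) T
  have h2 : jacobiTheta₂ (1 / 2 - T / 2 + T) T = jacobiTheta₂ (1 / 2 - T / 2) T := by
    rw [← jacobiTheta₂_neg_left, ← jacobiTheta₂_add_left]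
    congr 1; ring
  have h3 : exp (-Real.pi * I * (T + 2 * (1 / 2 - T / 2))) = -1 := by
    rw [show -Real.pi * I * (T + 2 * (1 / 2 - T / 2)) = -(Real.pi * I) by ring, exp_neg, exp_pi_mul_I]
    norm_num
  rw [h2, h3] at h1
  linear_combination h1 / 2

lemma jacobiTheta₂_add_int (z T : ℂ) (n : ℤ) : jacobiTheta₂ (z + n) T = jacobiTheta₂ z T := by
  have h : Function.Periodic (fun z => jacobiTheta₂ z T) 1 := fun z => jacobiTheta₂_add_left z T
  simpa using h.int_mul n z

/-- The position `v₀(y)` of the theta shift for which the product vanishes at `±iy`. -/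
def shiftOf (c a y : ℝ) : ℝ := (1 - gapInt c a y / gapInt c a a) / 2

lemma jacobiTheta₂_mul_eq_zero {T z : ℂ} {s v : ℝ} (hz : z = 1 / 2 - T / 2 - s)
    (hv : ∃ n : ℤ, v = s + n ∨ v = -s + n) :
    jacobiTheta₂ (z - v) T * jacobiTheta₂ (z + v) T = 0 := by
  obtain ⟨n, rfl | rfl⟩ := hv
  · rw [hz]
    push_cast
    rw [show (1 / 2 - T / 2 - s + (s + n) : ℂ) = 1 / 2 - T / 2 + n by ring, jacobiTheta₂_add_int,
      jacobiTheta₂_half_sub_half, mul_zero]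
  · rw [hz]
    push_cast
    rw [show (1 / 2 - T / 2 - s - (-s + n) : ℂ) = 1 / 2 - T / 2 + (-n : ℤ) by push_cast; ring,
      jacobiTheta₂_add_int, jacobiTheta₂_half_sub_half, zero_mul]

/-- The zero of the product of the components. -/
lemma modelSol_zero_eq (ha : 0 < a) (hac : a < c) {v y : ℝ} {μ : ℂ}
    (hμ : ∀ k ∈ cutPlane c, modelSol c a v k 0 * modelSol c a v k 1 * w c a k = k ^ 2 - μ)
    (hy : y ∈ Icc 0 a) (hv : ∃ n : ℤ, v = shiftOf c a y + n ∨ v = -shiftOf c a y + n) :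
    μ = -(y : ℂ) ^ 2 := by
  have hc := ha.trans hac
  have hT := period_im_pos ha hac
  have hg : (gapInt c a a : ℂ) ≠ 0 := by exact_mod_cast (gapInt_a_pos ha hac).ne'
  have hya : |-y| ≤ a := by rw [abs_neg, abs_of_nonneg hy.1]; exact hy.2
  have hyc : |-y| < c := hya.trans_lt hac
  set T := period c a with hTd
  set A : ℂ := thetaProd T 0 / jacobiTheta₂ v T with hA
  obtain ⟨C, hC⟩ := exists_norm_quarticRoot_le ha hac
  have hc0 : (c : ℂ) ≠ 0 := by exact_mod_cast hc.ne'
  -- For `y = a` the limit point is a corner, where the denominator `P` vanishes, so the limit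
  -- cannot simply be taken in the formula. Since `k² + a² = c² S² / (4η²)`, the estimate `|S| ≤ C
  -- |P|` removes the denominator.
  have hbound : ∀ k ∈ cutPlane c, ‖k ^ 2 - μ‖ ≤ ‖A‖ ^ 2 * C ^ 2 * c ^ 2 / 4 *
      ‖jacobiTheta₂ (abelMap c a (discMap c k) - v) T * jacobiTheta₂ (abelMap c a (discMap c k) + v) T‖ /
        ‖discMap c k‖ ^ 2 := by
    intro k hk
    have hd := discMap_mem hc hk
    have hη0 : 0 < ‖discMap c k‖ := norm_pos_iff.2 (discMap_ne_zero hc hk)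
    have h1 := hC _ (Metric.ball_subset_closedBall hd)
    have hS := quarticRoot_sq_eq ha hac (two_mul_discMap hc hk)
    have hP := thetaProd_abelMap_ne_zero ha hac hd
    have hP0 := norm_pos_iff.2 hP
    rw [← hμ k hk, modelSol_mul_mul_w hc v hk, thetaQuot, thetaQuot, thetaProd_neg, ← hA]
    set z := abelMap c a (discMap c k)
    set η := discMap c k
    have e0 : jacobiTheta₂ (-z - v) T = jacobiTheta₂ (z + v) T := by
      rw [← jacobiTheta₂_neg_left]; congr 1; ring
    have e1 : (k ^ 2 + (a : ℂ) ^ 2) = c ^ 2 / (4 * η ^ 2) * quarticRoot (nodeE c a) η ^ 2 := by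
      rw [hS]
      have := norm_pos_iff.1 hη0
      field_simp
    rw [e0, e1]
    have e2 : c ^ 2 / (4 * η ^ 2) * quarticRoot (nodeE c a) η ^ 2 *
        (A * (jacobiTheta₂ (z - v) T / thetaProd T z) * (A * (jacobiTheta₂ (z + v) T / thetaProd T z))) =
        A ^ 2 * (quarticRoot (nodeE c a) η / thetaProd T z) ^ 2 * c ^ 2 / 4 *
          (jacobiTheta₂ (z - v) T * jacobiTheta₂ (z + v) T) / η ^ 2 := by
      have := norm_pos_iff.1 hη0
      field_simp
    have h5 : ‖quarticRoot (nodeE c a) η / thetaProd T z‖ ≤ C := by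
      rw [norm_div, div_le_iff₀ hP0]; exact h1
    rw [e2]
    simp only [norm_mul, norm_div, norm_pow, norm_real, Real.norm_eq_abs, sq_abs, norm_ofNat]
    rw [← norm_div]
    gcongr
  have hη := tendsto_discMap_right hc hyc
  have hmem : cutPlane c ∈ 𝓝[{k : ℂ | 0 < k.re}] (I * (-y : ℝ)) := by
    filter_upwards [self_mem_nhdsWithin] with k hk
    exact mem_cutPlane_of_re_ne_zero (ne_of_gt hk)
  have hη' : Tendsto (discMap c) (𝓝[{k : ℂ | 0 < k.re}] (I * (-y : ℝ))) (𝓝[𝔻c] (rightPt c (-y))) := by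
    refine tendsto_nhdsWithin_of_tendsto_nhds_of_eventually_within _ hη ?_
    filter_upwards [hmem] with k hk
    exact Metric.ball_subset_closedBall (discMap_mem hc hk)
  have hZ : Tendsto (fun k => abelMap c a (discMap c k)) (𝓝[{k : ℂ | 0 < k.re}] (I * (-y : ℝ)))
      (𝓝 (abelMap c a (rightPt c (-y)))) :=
    (continuousOn_abelMap ha hac _ (rightPt_mem hc hyc.le)).tendsto.comp hη'
  -- The boundary value of `Z` at `-iy` is `1/2 - T/2 - shiftOf y`, so one of the two factors is
  -- evaluated at the zero `1/2 - T/2` modulo 1, depending on the sign in `v = ±shiftOf y + n`.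
  have hzero : jacobiTheta₂ (abelMap c a (rightPt c (-y)) - v) T *
      jacobiTheta₂ (abelMap c a (rightPt c (-y)) + v) T = 0 := by
    refine jacobiTheta₂_mul_eq_zero ?_ hv
    rw [abelMap_gap ha hac hya, gapInt_neg, shiftOf]
    push_cast
    field_simp
    ring
  have hθ : ∀ z : ℂ, ContinuousAt (fun z => jacobiTheta₂ z T) z := fun z =>
    (differentiableAt_jacobiTheta₂_fst z hT).continuousAt
  have ht1 := (hθ _).tendsto.comp (hZ.sub_const (v : ℂ))
  have ht2 := (hθ _).tendsto.comp (hZ.add_const (v : ℂ))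
  have hr0 : ‖rightPt c (-y)‖ ^ 2 ≠ 0 := by rw [norm_rightPt hc hyc.le]; norm_num
  have hlim := (((ht1.mul ht2).norm.const_mul (‖A‖ ^ 2 * C ^ 2 * c ^ 2 / 4)).div
    (hη.norm.pow 2) hr0)
  rw [hzero, norm_zero, mul_zero, zero_div] at hlim
  have hk2 : Tendsto (fun k : ℂ => ‖k ^ 2 - μ‖) (𝓝[{k : ℂ | 0 < k.re}] (I * (-y : ℝ)))
      (𝓝 ‖(I * (-y : ℝ)) ^ 2 - μ‖) :=
    ((by fun_prop : Continuous fun k : ℂ => ‖k ^ 2 - μ‖).tendsto _).mono_left nhdsWithin_le_nhds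
  have hne : (𝓝[{k : ℂ | 0 < k.re}] (I * (-y : ℝ))).NeBot := by
    rw [← mem_closure_iff_nhdsWithin_neBot, closure_setOfPred_lt_re]
    simp
  have := le_of_tendsto_of_tendsto hk2 hlim (by
    filter_upwards [hmem] with k hk
    exact hbound k hk)
  have h0 := norm_eq_zero.1 (le_antisymm this (norm_nonneg _))
  push_cast at h0
  rw [mul_pow, I_sq] at h0
  linear_combination -h0
end

/-! ### The second logarithmic derivative of the theta function -/

section

/-- The second-order Taylor formula of an even entire function. -/
lemma exists_eq_add_sq_mul_of_even {h : ℂ → ℂ} (hd : Differentiable ℂ h) (he : ∀ z, h (-z) = h z) :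
    ∃ g : ℂ → ℂ, ContinuousAt g 0 ∧ g 0 = deriv (deriv h) 0 / 2 ∧ ∀ z, h z = h 0 + z ^ 2 * g z := by
  set G := dslope h 0 with hG
  have hGd : Differentiable ℂ G := differentiable_dslope hd 0
  have e1 : ∀ z, h z = h 0 + z * G z := by
    intro z
    have := sub_smul_dslope h 0 z
    rw [smul_eq_mul, sub_zero] at this
    rw [hG, this]; ring
  have hGodd : ∀ z, z ≠ 0 → G (-z) = -G z := by
    intro z hz
    have h1 := e1 z
    have h2 := e1 (-z)
    rw [he] at h2
    have : z * (G (-z) + G z) = 0 := by linear_combination h2 - h1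
    rcases mul_eq_zero.1 this with h | h
    · exact absurd h hz
    · linear_combination h
  have hG0 : G 0 = 0 := by
    have h1 : Tendsto (fun z => G (-z) + G z) (𝓝[≠] 0) (𝓝 (G 0 + G 0)) := by
      refine Tendsto.mono_left ?_ nhdsWithin_le_nhds
      have : Continuous fun z => G (-z) + G z := (hGd.continuous.comp continuous_neg).add hGd.continuous
      simpa using this.tendsto 0
    have h2 : Tendsto (fun z => G (-z) + G z) (𝓝[≠] 0) (𝓝 0) := by
      refine tendsto_const_nhds.congr' ?_
      filter_upwards [self_mem_nhdsWithin] with z hz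
      rw [hGodd z hz, neg_add_cancel]
    have := tendsto_nhds_unique h1 h2
    linear_combination this / 2
  have hG'd : Differentiable ℂ (deriv G) := fun z => (hGd.analyticAt z).deriv.differentiableAt
  have hder : deriv h = fun z => G z + z * deriv G z := by
    funext z
    have : HasDerivAt (fun z => h 0 + z * G z) (1 * G z + z * deriv G z) z :=
      ((hasDerivAt_id z).mul (hGd z).hasDerivAt).const_add _
    have e : h = fun z => h 0 + z * G z := funext e1
    rw [e, this.deriv, one_mul]
  have hder2 : deriv (deriv h) 0 = 2 * deriv G 0 := by
    have : HasDerivAt (fun z => G z + z * deriv G z)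
        (deriv G 0 + (1 * deriv G 0 + 0 * deriv (deriv G) 0)) 0 :=
      (hGd 0).hasDerivAt.add ((hasDerivAt_id (0 : ℂ)).mul (hG'd 0).hasDerivAt)
    rw [hder, this.deriv]; ring
  refine ⟨dslope G 0, (differentiable_dslope hGd 0).continuous.continuousAt, ?_, fun z => ?_⟩
  · rw [dslope_same, hder2]; ring
  · have := sub_smul_dslope G 0 z
    rw [smul_eq_mul, sub_zero, hG0, sub_zero] at this
    rw [e1 z, ← this]; ring

/-- `θ₃(z - v) θ₃(z + v)/θ₃(v)²`. -/
def thetaPair (T : ℂ) (v z : ℂ) : ℂ :=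
  jacobiTheta₂ (z - v) T * jacobiTheta₂ (z + v) T / jacobiTheta₂ v T ^ 2

variable {T : ℂ}

lemma differentiable_theta (hT : 0 < T.im) : Differentiable ℂ fun z => jacobiTheta₂ z T :=
  fun z => differentiableAt_jacobiTheta₂_fst z hT

lemma deriv_neg_of_even {f : ℂ → ℂ} (he : ∀ z, f (-z) = f z) (z : ℂ) : deriv f (-z) = -deriv f z := by
  have h := deriv_comp_neg f z
  have e : (fun x => f (-x)) = f := funext he
  rw [e] at h
  rw [h, neg_neg]

lemma deriv_neg_of_odd {f : ℂ → ℂ} (he : ∀ z, f (-z) = -f z) (z : ℂ) : deriv f (-z) = deriv f z := by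
  have h := deriv_comp_neg f z
  have e : (fun x => f (-x)) = -f := funext he
  rw [e, deriv.neg] at h
  linear_combination h

/-- The second logarithmic derivative of `θ₃`. -/
def thetaLogTwo (T v : ℂ) : ℂ := deriv (logDeriv fun z => jacobiTheta₂ z T) v

lemma hasDerivAt_logDeriv_theta (hT : 0 < T.im) {v : ℂ} (hv : jacobiTheta₂ v T ≠ 0) :
    HasDerivAt (logDeriv fun z => jacobiTheta₂ z T) (thetaLogTwo T v) v := by
  have hd := differentiable_theta hT
  have hd' : DifferentiableAt ℂ (deriv fun z => jacobiTheta₂ z T) v :=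
    (hd.analyticAt v).deriv.differentiableAt
  exact (hd'.div (hd v) hv).hasDerivAt

lemma thetaLogTwo_eq (hT : 0 < T.im) {v : ℂ} (hv : jacobiTheta₂ v T ≠ 0) :
    thetaLogTwo T v = (deriv (deriv fun z => jacobiTheta₂ z T) v * jacobiTheta₂ v T -
      deriv (fun z => jacobiTheta₂ z T) v ^ 2) / jacobiTheta₂ v T ^ 2 := by
  have hd := differentiable_theta hT
  have hd' : DifferentiableAt ℂ (deriv fun z => jacobiTheta₂ z T) v :=
    (hd.analyticAt v).deriv.differentiableAt
  have h : HasDerivAt (logDeriv fun z => jacobiTheta₂ z T) _ v := hd'.hasDerivAt.div (hd v).hasDerivAt hv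
  rw [thetaLogTwo, h.deriv]
  ring

/-- The function is even in `z` with value 1 at 0, and its second derivative at 0 is `2(θ''θ -
θ'²)/θ²`, which is twice the second logarithmic derivative at `v`. -/
lemma exists_thetaPair_eq (hT : 0 < T.im) {v : ℂ} (hv : jacobiTheta₂ v T ≠ 0) :
    ∃ g : ℂ → ℂ, ContinuousAt g 0 ∧ g 0 = thetaLogTwo T v ∧ ∀ z, thetaPair T v z = 1 + z ^ 2 * g z := by
  set θ : ℂ → ℂ := fun z => jacobiTheta₂ z T with hθ
  have hd : Differentiable ℂ θ := differentiable_theta hT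
  have hd' : Differentiable ℂ (deriv θ) := fun z => (hd.analyticAt z).deriv.differentiableAt
  have heven : ∀ z, θ (-z) = θ z := fun z => jacobiTheta₂_neg_left z T
  have hodd := deriv_neg_of_even heven
  have heven2 := deriv_neg_of_odd hodd
  have hpair : thetaPair T v = fun z => θ (z - v) * θ (z + v) / θ v ^ 2 := rfl
  have hs : ∀ (f : ℂ → ℂ), Differentiable ℂ f → ∀ z,
      HasDerivAt (fun z => f (z - v)) (deriv f (z - v)) z := fun f hf z =>
    HasDerivAt.comp_sub_const z v (hf _).hasDerivAt
  have ha : ∀ (f : ℂ → ℂ), Differentiable ℂ f → ∀ z,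
      HasDerivAt (fun z => f (z + v)) (deriv f (z + v)) z := fun f hf z =>
    HasDerivAt.comp_add_const z v (hf _).hasDerivAt
  have h1 : ∀ z, HasDerivAt (thetaPair T v)
      ((deriv θ (z - v) * θ (z + v) + θ (z - v) * deriv θ (z + v)) / θ v ^ 2) z := fun z =>
    ((hs θ hd z).mul (ha θ hd z)).div_const _
  have h2 : HasDerivAt (deriv (thetaPair T v))
      (((deriv (deriv θ) (0 - v) * θ (0 + v) + deriv θ (0 - v) * deriv θ (0 + v)) +
        (deriv θ (0 - v) * deriv θ (0 + v) + θ (0 - v) * deriv (deriv θ) (0 + v))) / θ v ^ 2) 0 := by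
    rw [show deriv (thetaPair T v) = fun z =>
      (deriv θ (z - v) * θ (z + v) + θ (z - v) * deriv θ (z + v)) / θ v ^ 2 from
      funext fun z => (h1 z).deriv]
    exact (((hs _ hd' 0).mul (ha _ hd 0)).add ((hs _ hd 0).mul (ha _ hd' 0))).div_const _
  obtain ⟨g, hg, hg0, hgz⟩ := exists_eq_add_sq_mul_of_even (h := thetaPair T v)
    (fun z => (h1 z).differentiableAt) (fun z => by
      simp only [hpair]
      rw [← heven (-z - v), ← heven (-z + v), mul_comm]
      congr 3 <;> ring)
  have h0 : thetaPair T v 0 = 1 := by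
    simp only [hpair]
    rw [zero_sub, heven, zero_add, ← sq, div_self (pow_ne_zero 2 hv)]
  refine ⟨g, hg, ?_, fun z => by rw [hgz z, h0]⟩
  rw [hg0, h2.deriv, thetaLogTwo_eq hT hv, zero_sub, zero_add, hodd, heven2, heven]
  ring

lemma logDeriv_theta_zero : logDeriv (fun z => jacobiTheta₂ z T) 0 = 0 := by
  have h := deriv_neg_of_even (f := fun z => jacobiTheta₂ z T) (fun z => jacobiTheta₂_neg_left z T) 0
  rw [neg_zero] at h
  have h2 : deriv (fun z => jacobiTheta₂ z T) 0 = 0 := by linear_combination h / 2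
  rw [logDeriv_apply, h2, zero_div]

/-- By the period 1, `θ₃` is even about `1/2` as well as about 0. -/
lemma logDeriv_theta_half : logDeriv (fun z => jacobiTheta₂ z T) (1 / 2) = 0 := by
  have h := deriv_neg_of_even (f := fun z => jacobiTheta₂ z T) (fun z => jacobiTheta₂_neg_left z T) (1 / 2)
  have h1 := deriv_comp_add_const (fun z => jacobiTheta₂ z T) 1 (-(1 / 2))
  have e : (fun z => jacobiTheta₂ (z + 1) T) = fun z => jacobiTheta₂ z T :=
    funext fun z => jacobiTheta₂_add_left z T
  rw [e, show -(1 / 2 : ℂ) + 1 = 1 / 2 by norm_num] at h1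
  have h2 : deriv (fun z => jacobiTheta₂ z T) (1 / 2) = 0 := by linear_combination (-h1 + h) / 2
  rw [logDeriv_apply, h2, zero_div]

/-- The real second derivative in the definition of `q^mod`. -/
lemma iteratedDeriv_log_theta (hT : 0 < T.im) (hpos : ∀ v : ℝ, ∃ r : ℝ, 0 < r ∧ jacobiTheta₂ v T = r) (s : ℝ) :
    iteratedDeriv 2 (fun v : ℝ => log (jacobiTheta₂ (v + s) T)) 0 = thetaLogTwo T s := by
  have hd := differentiable_theta hT
  have hsh : ∀ v : ℝ, HasDerivAt (fun v : ℝ => ((v : ℂ) + s)) 1 v := fun v =>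
    (ofRealCLM.hasDerivAt (x := v)).add_const _
  have h1 : ∀ v : ℝ, HasDerivAt (fun v : ℝ => log (jacobiTheta₂ (v + s) T))
      (logDeriv (fun z => jacobiTheta₂ z T) (v + s)) v := by
    intro v
    obtain ⟨r, hr, h⟩ := hpos (v + s)
    push_cast at h
    have h2 : HasDerivAt (fun v : ℝ => jacobiTheta₂ (v + s) T)
        (deriv (fun z => jacobiTheta₂ z T) (v + s) * 1) v :=
      HasDerivAt.comp (h₂ := fun z => jacobiTheta₂ z T) v (hd (v + s)).hasDerivAt (hsh v)
    rw [mul_one] at h2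
    have := h2.clog_real (by rw [h]; exact Or.inl (by simpa using hr))
    exact this
  rw [iteratedDeriv_succ, iteratedDeriv_one, show deriv (fun v : ℝ => log (jacobiTheta₂ (v + s) T)) =
    fun v : ℝ => logDeriv (fun z => jacobiTheta₂ z T) (v + s) from funext fun v => (h1 v).deriv]
  obtain ⟨r, hr, h⟩ := hpos s
  have h3 : HasDerivAt (fun v : ℝ => logDeriv (fun z => jacobiTheta₂ z T) (v + s))
      (thetaLogTwo T ((0 : ℝ) + s) * 1) 0 := by
    refine HasDerivAt.comp (0 : ℝ) (hasDerivAt_logDeriv_theta hT ?_) (hsh 0)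
    rw [ofReal_zero, zero_add, h]
    exact_mod_cast hr.ne'
  rw [h3.deriv, ofReal_zero, zero_add, mul_one]
end

/-! ### The zero of the product as a function of the theta shift -/

section
variable {c a : ℝ}

lemma tendsto_mul_abelMap (ha : 0 < a) (hac : a < c) :
    Tendsto (fun k => k * abelMap c a (discMap c k)) (Bornology.cobounded ℂ)
      (𝓝 (-I / (2 * gapInt c a a))) := by
  have hc := ha.trans hac
  have hc0 : (c : ℂ) ≠ 0 := by exact_mod_cast hc.ne'
  have hg : (gapInt c a a : ℂ) ≠ 0 := by exact_mod_cast (gapInt_a_pos ha hac).ne'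
  have h1 := hasDerivAt_abelMap ha hac (η := 0) (by simp)
  rw [quarticRoot_zero, div_one, mul_one, hasDerivAt_iff_tendsto_slope_zero] at h1
  have h2 : Tendsto (discMap c) (Bornology.cobounded ℂ) (𝓝[≠] 0) := by
    refine tendsto_nhdsWithin_of_tendsto_nhds_of_eventually_within _ (tendsto_discMap_cobounded c) ?_
    filter_upwards [cutPlane_mem_cobounded c] with k hk
    exact discMap_ne_zero hc hk
  have h3 := (tendsto_mul_discMap c).mul (h1.comp h2)
  refine (h3.congr' ?_).trans_eq ?_
  · filter_upwards [cutPlane_mem_cobounded c] with k hk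
    have := discMap_ne_zero hc hk
    simp only [Function.comp, zero_add, abelMap_zero, sub_zero, smul_eq_mul]
    field_simp
  · congr 1; field_simp

/-- The zeros for two values of the shift. -/
lemma zero_sub_eq (ha : 0 < a) (hac : a < c) {v v' : ℝ} {μ μ' : ℂ}
    (hμ : ∀ k ∈ cutPlane c, modelSol c a v k 0 * modelSol c a v k 1 * w c a k = k ^ 2 - μ)
    (hμ' : ∀ k ∈ cutPlane c, modelSol c a v' k 0 * modelSol c a v' k 1 * w c a k = k ^ 2 - μ') :
    μ - thetaLogTwo (period c a) v / (4 * gapInt c a a ^ 2) =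
      μ' - thetaLogTwo (period c a) v' / (4 * gapInt c a a ^ 2) := by
  have hc := ha.trans hac
  have hT := period_im_pos ha hac
  have hg : (gapInt c a a : ℂ) ≠ 0 := by exact_mod_cast (gapInt_a_pos ha hac).ne'
  set T := period c a
  have hv := jacobiTheta₂_period_ne_zero ha hac v
  have hv' := jacobiTheta₂_period_ne_zero ha hac v'
  have key : ∀ {v : ℝ} {μ : ℂ}, jacobiTheta₂ v T ≠ 0 →
      (∀ k ∈ cutPlane c, modelSol c a v k 0 * modelSol c a v k 1 * w c a k = k ^ 2 - μ) →
      ∀ k ∈ cutPlane c, k ^ 2 - μ = (k ^ 2 + (a : ℂ) ^ 2) *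
        (thetaProd T 0 / thetaProd T (abelMap c a (discMap c k))) ^ 2 *
          thetaPair T v (abelMap c a (discMap c k)) := by
    intro v μ hv h k hk
    rw [← h k hk, modelSol_mul_mul_w hc v hk, thetaQuot, thetaQuot, thetaProd_neg, thetaPair]
    set z := abelMap c a (discMap c k)
    have e0 : jacobiTheta₂ (-z - v) T = jacobiTheta₂ (z + v) T := by
      rw [← jacobiTheta₂_neg_left]; congr 1; ring
    rw [e0]
    ring
  -- Both products contain the common factor `(k² + a²)(P(0)/P(Z))²`, which cancels; no expansion of
  -- `P` at 0 is needed. In the limit `k → ∞` one has `k² Z² → -1/(4κ²)` with `κ = gapInt c a a`.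
  have hrel : ∀ k ∈ cutPlane c, (k ^ 2 - μ) * thetaPair T v' (abelMap c a (discMap c k)) =
      (k ^ 2 - μ') * thetaPair T v (abelMap c a (discMap c k)) := by
    intro k hk
    rw [key hv hμ k hk, key hv' hμ' k hk]; ring
  obtain ⟨g, hg1, hg0, hgz⟩ := exists_thetaPair_eq hT hv
  obtain ⟨g', hg1', hg0', hgz'⟩ := exists_thetaPair_eq hT hv'
  have hZ : Tendsto (fun k => abelMap c a (discMap c k)) (Bornology.cobounded ℂ) (𝓝 0) := by
    have := (hasDerivAt_abelMap ha hac (η := 0) (by simp)).continuousAt.tendsto.comp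
      (tendsto_discMap_cobounded c)
    rwa [abelMap_zero] at this
  have hkZ := tendsto_mul_abelMap ha hac
  have l1 := hg1.tendsto.comp hZ
  have l2 := hg1'.tendsto.comp hZ
  have lhs := (hkZ.pow 2).mul (l2.sub l1)
  have rhs := ((tendsto_const_nhds (x := μ)).mul ((tendsto_const_nhds (x := (1 : ℂ))).add
    ((hZ.pow 2).mul l2))).sub ((tendsto_const_nhds (x := μ')).mul
    ((tendsto_const_nhds (x := (1 : ℂ))).add ((hZ.pow 2).mul l1)))
  have := tendsto_nhds_unique lhs (rhs.congr' (by
    filter_upwards [cutPlane_mem_cobounded c] with k hk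
    have h := hrel k hk
    rw [hgz, hgz'] at h
    simp only [Function.comp]
    linear_combination -h))
  rw [hg0, hg0'] at this
  have e : (-I / (2 * gapInt c a a) : ℂ) ^ 2 = -(1 / (4 * gapInt c a a ^ 2)) := by
    rw [div_pow, neg_sq, I_sq]; ring
  rw [e] at this
  linear_combination -this

lemma exists_modelSol_zero (ha : 0 < a) (hac : a < c) (v : ℝ) : ∃ μ : ℂ, ∀ k ∈ cutPlane c,
    modelSol c a v k 0 * modelSol c a v k 1 * w c a k = k ^ 2 - μ :=
  exists_mul_mul_w_eq ha hac (isModelSolution_modelSol ha hac v) (isModelSolution_modelSol ha hac v)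

lemma continuous_gapW (c a : ℝ) : Continuous (gapW c a) :=
  Real.continuous_sqrt.comp (by fun_prop)

lemma hasDerivAt_gapInt (ha : 0 < a) (hac : a < c) {y : ℝ} (hy : |y| < a) :
    HasDerivAt (gapInt c a) (1 / gapW c a y) y := by
  have h := abs_lt.1 hy
  refine intervalIntegral.integral_hasDerivAt_right
    (intervalIntegrable_gapW_of_mem ha hac ⟨by linarith, ha.le⟩ ⟨h.1.le, h.2.le⟩) ?_ ?_
  · exact ((continuous_gapW c a).measurable.const_div 1).stronglyMeasurable.stronglyMeasurableAtFilter
  · exact continuousAt_const.div (continuous_gapW c a).continuousAt (gapW_pos hac hy).ne'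

lemma shiftOf_zero (c a : ℝ) : shiftOf c a 0 = 1 / 2 := by simp [shiftOf, gapInt_zero]

lemma shiftOf_self (ha : 0 < a) (hac : a < c) : shiftOf c a a = 0 := by
  simp [shiftOf, div_self (gapInt_a_pos ha hac).ne']

lemma continuousOn_shiftOf (ha : 0 < a) (hac : a < c) : ContinuousOn (shiftOf c a) (Icc 0 a) :=
  ((continuousOn_const.sub (((continuousOn_gapInt ha hac).mono
    (Icc_subset_Icc (by linarith) le_rfl)).div_const _)).div_const _)

lemma intervalIntegrable_sq_div_gapW (ha : 0 < a) (hac : a < c) :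
    IntervalIntegrable (fun y => y ^ 2 * (1 / gapW c a y)) volume 0 a :=
  (intervalIntegrable_gapW_of_mem ha hac ⟨by linarith, ha.le⟩ ⟨by linarith, le_rfl⟩).continuousOn_mul
    (by fun_prop)

/-- The zero of the product in terms of the second logarithmic derivative. -/
lemma modelSol_zero_eq_thetaLogTwo (ha : 0 < a) (hac : a < c) {v : ℝ} {μ : ℂ}
    (hμ : ∀ k ∈ cutPlane c, modelSol c a v k 0 * modelSol c a v k 1 * w c a k = k ^ 2 - μ) :
    μ = thetaLogTwo (period c a) v / (4 * gapInt c a a ^ 2) -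
      ((∫ y in (0 : ℝ)..a, y ^ 2 * (1 / gapW c a y)) / gapInt c a a : ℝ) := by
  have hT := period_im_pos ha hac
  have hg : (gapInt c a a : ℂ) ≠ 0 := by exact_mod_cast (gapInt_a_pos ha hac).ne'
  set T := period c a with hTd
  set κ := gapInt c a a with hκ
  set C := μ - thetaLogTwo T v / (4 * κ ^ 2) with hC
  -- For the shift `shiftOf y` the zero is `-y²`, so the second logarithmic derivative is an
  -- explicit quadratic in `y`, up to the unknown constant `C`.
  have hL : ∀ y ∈ Icc 0 a, thetaLogTwo T (shiftOf c a y) = -(4 * κ ^ 2) * ((y : ℂ) ^ 2 + C) := by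
    intro y hy
    obtain ⟨μ', hμ'⟩ := exists_modelSol_zero ha hac (shiftOf c a y)
    have h1 := modelSol_zero_eq ha hac hμ' hy ⟨0, Or.inl (by simp)⟩
    have h2 := zero_sub_eq ha hac hμ hμ'
    rw [← hTd, ← hκ, ← hC, h1] at h2
    field_simp at h2
    linear_combination h2
  set D : ℂ → ℂ := logDeriv fun z => jacobiTheta₂ z T
  have hD : ∀ y : ℝ, HasDerivAt D (thetaLogTwo T (shiftOf c a y)) (shiftOf c a y) := fun y =>
    hasDerivAt_logDeriv_theta hT (jacobiTheta₂_period_ne_zero ha hac _)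
  have hI0 := intervalIntegrable_gapW_of_mem ha hac (y := 0) (z := a)
    ⟨by linarith, ha.le⟩ ⟨by linarith, le_rfl⟩
  have hI1 : IntervalIntegrable (fun y => ((1 / gapW c a y : ℝ) : ℂ)) volume 0 a :=
    ⟨hI0.1.ofReal, hI0.2.ofReal⟩
  have hI2' := intervalIntegrable_sq_div_gapW ha hac
  have hI2 : IntervalIntegrable (fun y => ((y ^ 2 * (1 / gapW c a y) : ℝ) : ℂ)) volume 0 a :=
    ⟨hI2'.1.ofReal, hI2'.2.ofReal⟩
  -- As `y` runs from 0 to `a` the shift runs from `1/2` to 0 with speed `-1/(2κ gapW)`. The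
  -- logarithmic derivative vanishes at both ends, so the integral of `(y² + C)/gapW` is 0, which
  -- determines `C`.
  have hftc := intervalIntegral.integral_eq_sub_of_hasDeriv_right
    (f := fun y : ℝ => D (shiftOf c a y)) (a := 0) (b := a)
    (f' := fun y => 2 * κ * (((y ^ 2 * (1 / gapW c a y) : ℝ) : ℂ) + C * ((1 / gapW c a y : ℝ) : ℂ)))
    (by
      rw [uIcc_of_le ha.le]
      intro y hy
      exact ContinuousAt.comp_continuousWithinAt (g := D) (f := fun y : ℝ => (shiftOf c a y : ℂ))
        (hD y).continuousAt
        (continuous_ofReal.continuousAt.comp_continuousWithinAt (continuousOn_shiftOf ha hac y hy)))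
    (fun y hy => by
      rw [min_eq_left ha.le, max_eq_right ha.le] at hy
      have h1 : HasDerivAt (shiftOf c a) (-(1 / gapW c a y / κ) / 2) y :=
        ((((hasDerivAt_gapInt ha hac (abs_lt.2 ⟨by linarith [hy.1], hy.2⟩)).div_const κ).const_sub
          1).div_const 2)
      have h2 : HasDerivAt (fun y : ℝ => D (shiftOf c a y))
          (thetaLogTwo T (shiftOf c a y) * ((-(1 / gapW c a y / κ) / 2 : ℝ) : ℂ)) y :=
        (hD y).comp y h1.ofReal_comp
      refine (h2.congr_deriv ?_).hasDerivWithinAt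
      rw [hL y ⟨hy.1.le, hy.2.le⟩]
      push_cast
      field_simp
      ring)
    ((hI2.add (hI1.const_mul C)).const_mul _)
  rw [intervalIntegral.integral_const_mul, intervalIntegral.integral_add hI2 (hI1.const_mul C),
    intervalIntegral.integral_const_mul, intervalIntegral.integral_ofReal,
    intervalIntegral.integral_ofReal, shiftOf_zero, shiftOf_self ha hac] at hftc
  have e0 : D ((0 : ℝ) : ℂ) = 0 := by rw [ofReal_zero]; exact logDeriv_theta_zero
  have e1 : D ((1 / 2 : ℝ) : ℂ) = 0 := by push_cast; exact logDeriv_theta_half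
  have e2 : (∫ y in (0 : ℝ)..a, 1 / gapW c a y) = κ := rfl
  rw [e0, e1, e2, sub_zero] at hftc
  have h3 := (mul_eq_zero.1 hftc).resolve_left (mul_ne_zero two_ne_zero hg)
  push_cast
  have h5 : C = -((∫ y in (0 : ℝ)..a, y ^ 2 * (1 / gapW c a y) : ℝ) : ℂ) / κ := by
    rw [eq_div_iff hg]; linear_combination h3
  rw [h5] at hC
  linear_combination -hC
end

/-! ### Evaluation of the periods -/

section
variable {c a : ℝ}

lemma I_mul_sq_add (y b : ℝ) : (I * y : ℂ) ^ 2 + (b : ℂ) ^ 2 = ((b ^ 2 - y ^ 2 : ℝ) : ℂ) := by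
  rw [mul_pow, I_sq]; push_cast; ring

lemma sqrtRatio_I_mul (c a y : ℝ) :
    sqrtRatio c a (I * y) = (((a ^ 2 - y ^ 2) / (c ^ 2 - y ^ 2) : ℝ) : ℂ) ^ (1 / 2 : ℂ) := by
  rw [sqrtRatio, I_mul_sq_add, I_mul_sq_add, ofReal_div]

lemma sqrtRatio_gap (hac : a < c) {y : ℝ} (hy : |y| < a) :
    sqrtRatio c a (I * y) = ((a ^ 2 - y ^ 2) / gapW c a y : ℝ) := by
  have h1 := abs_lt_sq hy
  have h2 := abs_lt_sq (hy.trans hac)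
  rw [sqrtRatio_I_mul, cpow_half_ofReal (div_nonneg (by linarith) (by linarith)), gapW,
    Real.sqrt_div (by linarith), Real.sqrt_mul (by linarith)]
  have e := Real.mul_self_sqrt (by linarith : 0 ≤ a ^ 2 - y ^ 2)
  have h3 := Real.sqrt_pos.2 (by linarith : 0 < a ^ 2 - y ^ 2)
  have h4 := Real.sqrt_pos.2 (by linarith : 0 < c ^ 2 - y ^ 2)
  congr 1
  field_simp
  linarith

lemma sqrtRatio_band (ha : 0 < a) {y : ℝ} (hy : a < y) (hyc : y < c) :
    sqrtRatio c a (I * y) = I * ((y ^ 2 - a ^ 2) / bandW c a y : ℝ) := by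
  have h1 : 0 < y ^ 2 - a ^ 2 := by nlinarith
  have h2 : 0 < c ^ 2 - y ^ 2 := by nlinarith
  have hneg : (a ^ 2 - y ^ 2) / (c ^ 2 - y ^ 2) < 0 := div_neg_of_neg_of_pos (by linarith) h2
  rw [sqrtRatio_I_mul, cpow_half_eq_I_mul (Or.inr ⟨by rwa [ofReal_re], ofReal_im _⟩), ← ofReal_neg,
    cpow_half_ofReal (by linarith), ← neg_div, neg_sub, bandW,
    Real.sqrt_div h1.le, Real.sqrt_mul h1.le]
  have e := Real.mul_self_sqrt h1.le
  have h3 := Real.sqrt_pos.2 h1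
  have h4 := Real.sqrt_pos.2 h2
  congr 2
  field_simp
  linarith

lemma gapW_sq (hac : a < c) {y : ℝ} (hy : |y| < a) :
    gapW c a y ^ 2 = (a ^ 2 - y ^ 2) * (c ^ 2 - y ^ 2) := by
  have h1 := abs_lt_sq hy
  have h2 := abs_lt_sq (hy.trans hac)
  exact Real.sq_sqrt (mul_nonneg (by linarith) (by linarith))

lemma bandW_sq (ha : 0 < a) {y : ℝ} (hy : a < y) (hyc : y < c) :
    bandW c a y ^ 2 = (y ^ 2 - a ^ 2) * (c ^ 2 - y ^ 2) :=
  Real.sq_sqrt (mul_nonneg (by nlinarith) (by nlinarith))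

lemma w_gap (hac : a < c) {y : ℝ} (hy : |y| < a) : w c a (I * y) = (gapW c a y : ℝ) := by
  rw [w, sqrtRatio_gap hac hy, I_mul_sq_add, ← ofReal_mul]
  congr 1
  have h := gapW_sq hac hy
  have h0 := (gapW_pos hac hy).ne'
  field_simp
  linarith

lemma w_band (ha : 0 < a) {y : ℝ} (hy : a < y) (hyc : y < c) :
    w c a (I * y) = I * (bandW c a y : ℝ) := by
  rw [w, sqrtRatio_band ha hy hyc, I_mul_sq_add, mul_left_comm, ← ofReal_mul]
  congr 2
  have h := bandW_sq ha hy hyc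
  have h0 := (bandW_pos ha hy hyc).ne'
  field_simp
  linarith

lemma gapInt_sub (ha : 0 < a) (hac : a < c) {y z : ℝ} (hy : y ∈ Icc (-a) a) (hz : z ∈ Icc (-a) a) :
    ∫ s in y..z, 1 / gapW c a s = gapInt c a z - gapInt c a y := by
  have h0 : (0 : ℝ) ∈ Icc (-a) a := ⟨by linarith, ha.le⟩
  have := intervalIntegral.integral_add_adjacent_intervals
    (intervalIntegrable_gapW_of_mem ha hac h0 hy) (intervalIntegrable_gapW_of_mem ha hac hy hz)
  rw [gapInt, gapInt, ← this]; ring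

lemma integral_inv_w_gap (ha : 0 < a) (hac : a < c) :
    ∫ y in (-a)..a, I / w c a (I * y) = 2 * I * gapInt c a a := by
  have e : ∫ y in (-a)..a, I / w c a (I * y) = ∫ y in (-a)..a, I * ((1 / gapW c a y : ℝ) : ℂ) := by
    refine intervalIntegral.integral_congr_Ioo_of_le (by linarith) fun y hy => ?_
    rw [w_gap hac (abs_lt.2 hy)]
    push_cast; ring
  rw [e, intervalIntegral.integral_const_mul, intervalIntegral.integral_ofReal,
    gapInt_sub ha hac ⟨le_rfl, by linarith⟩ ⟨by linarith, le_rfl⟩, gapInt_neg]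
  push_cast; ring

lemma aCycle_eq (ha : 0 < a) (hac : a < c) : aCycle c a = -4 * I * gapInt c a a := by
  have e : ∫ y in (-a)..a, I / (-w c a (I * y)) = -∫ y in (-a)..a, I / w c a (I * y) := by
    rw [← intervalIntegral.integral_neg]
    simp only [div_neg]
  rw [aCycle, intervalIntegral.integral_symm, e, integral_inv_w_gap ha hac]
  ring

lemma Gam_eq (ha : 0 < a) (hac : a < c) : Gam c a = I / (4 * gapInt c a a) := by
  have hg : (gapInt c a a : ℂ) ≠ 0 := by exact_mod_cast (gapInt_a_pos ha hac).ne'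
  have hI := I_ne_zero
  rw [Gam, aCycle_eq ha hac]
  field_simp
  rw [I_sq]

lemma two_mul_tau (ha : 0 < a) (hac : a < c) : 2 * tau c a = period c a := by
  have hg : (gapInt c a a : ℂ) ≠ 0 := by exact_mod_cast (gapInt_a_pos ha hac).ne'
  have e1 : ∫ y in a..c, I / w c a (I * y) = bandInt c a c := by
    rw [bandInt, ← intervalIntegral.integral_ofReal]
    refine intervalIntegral.integral_congr_Ioo_of_le hac.le fun y hy => ?_
    rw [w_band ha hy.1 hy.2, ← div_div, div_self I_ne_zero]
    push_cast
    rfl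
  have e2 : ∫ y in c..a, I / (-w c a (I * y)) = bandInt c a c := by
    rw [intervalIntegral.integral_symm, ← e1, ← intervalIntegral.integral_neg]
    simp only [div_neg, neg_neg]
  rw [tau, e1, e2, Gam_eq ha hac, period]
  push_cast
  field_simp
  ring

/-! ### Complete elliptic integrals -/

lemma image_mul_sin (ha : 0 < a) :
    (fun θ : ℝ => a * Real.sin θ) '' Ioo 0 (Real.pi / 2) = Ioo 0 a := by
  have hp := Real.pi_pos
  ext y
  constructor
  · rintro ⟨θ, hθ, rfl⟩
    have h1 := Real.sin_pos_of_pos_of_lt_pi hθ.1 (by linarith [hθ.2])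
    have h2 : Real.sin θ < 1 := by
      rw [← Real.sin_pi_div_two]
      exact Real.sin_lt_sin_of_lt_of_le_pi_div_two (by linarith [hθ.1]) le_rfl hθ.2
    exact ⟨mul_pos ha h1, by nlinarith⟩
  · intro hy
    have h1 : 0 < y / a := div_pos hy.1 ha
    have h2 : y / a < 1 := (div_lt_one ha).2 hy.2
    refine ⟨Real.arcsin (y / a), ⟨Real.arcsin_pos.2 h1, Real.arcsin_lt_pi_div_two.2 h2⟩, ?_⟩
    simp only
    rw [Real.sin_arcsin (by linarith) h2.le]
    field_simp

/-- Injective substitution on the open interval. No integrability of `g` is required, so it applies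
directly to integrands singular at `y = a`. -/
lemma integral_mul_sin (ha : 0 < a) (g : ℝ → ℝ) :
    ∫ y in (0 : ℝ)..a, g y =
      ∫ θ in (0 : ℝ)..(Real.pi / 2), a * Real.cos θ * g (a * Real.sin θ) := by
  have hp := Real.pi_pos
  rw [intervalIntegral.integral_of_le ha.le, intervalIntegral.integral_of_le (by linarith),
    integral_Ioc_eq_integral_Ioo, integral_Ioc_eq_integral_Ioo, ← image_mul_sin ha,
    integral_image_eq_integral_abs_deriv_smul measurableSet_Ioo (f' := fun θ => a * Real.cos θ)
      (fun θ _ => ((Real.hasDerivAt_sin θ).const_mul a).hasDerivWithinAt)]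
  · refine setIntegral_congr_fun measurableSet_Ioo fun θ hθ => ?_
    have := Real.cos_pos_of_mem_Ioo (x := θ) ⟨by linarith [hθ.1], hθ.2⟩
    rw [abs_of_pos (mul_pos ha this), smul_eq_mul]
  · intro x hx y hy h
    exact Real.injOn_sin ⟨by linarith [hx.1], hx.2.le⟩ ⟨by linarith [hy.1], hy.2.le⟩
      (mul_left_cancel₀ ha.ne' h)

lemma one_sub_mul_sin_sq_pos (ha : 0 < a) (hac : a < c) (θ : ℝ) :
    0 < 1 - (a / c) ^ 2 * Real.sin θ ^ 2 := by
  have h := div_lt_one' ha hac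
  have h1 := Real.sin_sq_le_one θ
  nlinarith [sq_nonneg (a / c)]

lemma gapW_mul_sin (ha : 0 < a) (hac : a < c) {θ : ℝ} (hθ : θ ∈ Ioo 0 (Real.pi / 2)) :
    gapW c a (a * Real.sin θ) =
      a * Real.cos θ * (c * Real.sqrt (1 - (a / c) ^ 2 * Real.sin θ ^ 2)) := by
  have hc := ha.trans hac
  have hp := Real.pi_pos
  have hcos := Real.cos_pos_of_mem_Ioo (x := θ) ⟨by linarith [hθ.1], hθ.2⟩
  have hpos := one_sub_mul_sin_sq_pos ha hac θ
  have e : (a ^ 2 - (a * Real.sin θ) ^ 2) * (c ^ 2 - (a * Real.sin θ) ^ 2) =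
      (a * Real.cos θ * c) ^ 2 * (1 - (a / c) ^ 2 * Real.sin θ ^ 2) := by
    have h1 : a ^ 2 - (a * Real.sin θ) ^ 2 = (a * Real.cos θ) ^ 2 := by
      rw [mul_pow, mul_pow, Real.cos_sq']; ring
    rw [h1]
    field_simp
  rw [gapW, e, Real.sqrt_mul (by positivity), Real.sqrt_sq (by positivity)]
  ring

lemma continuous_sqrt_one_sub (s : ℝ) :
    Continuous fun θ : ℝ => Real.sqrt (1 - s ^ 2 * Real.sin θ ^ 2) :=
  Real.continuous_sqrt.comp (by fun_prop)

lemma ellipticK_eq (ha : 0 < a) (hac : a < c) : ellipticK (a / c) = c * gapInt c a a := by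
  have hc := ha.trans hac
  rw [gapInt, integral_mul_sin ha, ellipticK, ← intervalIntegral.integral_const_mul]
  refine intervalIntegral.integral_congr_Ioo_of_le (by positivity) fun θ hθ => ?_
  have hcos := Real.cos_pos_of_mem_Ioo (x := θ) ⟨by linarith [hθ.1, Real.pi_pos], hθ.2⟩
  have hpos := Real.sqrt_pos.2 (one_sub_mul_sin_sq_pos ha hac θ)
  rw [gapW_mul_sin ha hac hθ]
  field_simp

lemma integral_sq_div_gapW (ha : 0 < a) (hac : a < c) :
    ∫ y in (0 : ℝ)..a, y ^ 2 * (1 / gapW c a y) =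
      c * (ellipticK (a / c) - ellipticE (a / c)) := by
  have hc := ha.trans hac
  have hcont := continuous_sqrt_one_sub (a / c)
  have h0 : ∀ θ, Real.sqrt (1 - (a / c) ^ 2 * Real.sin θ ^ 2) ≠ 0 := fun θ =>
    (Real.sqrt_pos.2 (one_sub_mul_sin_sq_pos ha hac θ)).ne'
  have hcont' : Continuous fun θ : ℝ => 1 / Real.sqrt (1 - (a / c) ^ 2 * Real.sin θ ^ 2) :=
    continuous_const.div hcont h0
  rw [integral_mul_sin ha, ellipticK, ellipticE, ← intervalIntegral.integral_sub
    (hcont'.intervalIntegrable _ _) (hcont.intervalIntegrable _ _),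
    ← intervalIntegral.integral_const_mul]
  refine intervalIntegral.integral_congr_Ioo_of_le (by positivity) fun θ hθ => ?_
  have hcos := Real.cos_pos_of_mem_Ioo (x := θ) ⟨by linarith [hθ.1, Real.pi_pos], hθ.2⟩
  have hpos := Real.sqrt_pos.2 (one_sub_mul_sin_sq_pos ha hac θ)
  have hsq := Real.sq_sqrt (one_sub_mul_sin_sq_pos ha hac θ).le
  rw [gapW_mul_sin ha hac hθ]
  set r := Real.sqrt (1 - (a / c) ^ 2 * Real.sin θ ^ 2)
  have e : a ^ 2 * Real.sin θ ^ 2 = c ^ 2 * (1 - r ^ 2) := by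
    rw [hsq]; field_simp; ring
  have : a * Real.cos θ * ((a * Real.sin θ) ^ 2 * (1 / (a * Real.cos θ * (c * r)))) =
      (a ^ 2 * Real.sin θ ^ 2) / (c * r) := by field_simp
  rw [this, e]
  field_simp

/-! ### The elliptic surface -/

/-- The substitution `λ = k²` with `k = iy` carries integrals over the elliptic surface to integrals
in the variable of `w`. -/
lemma integral_comp_neg_sq {p q : ℝ} (hp : 0 ≤ p) (hpq : p ≤ q) (g : ℝ → ℂ) :
    ∫ μ in (-q ^ 2)..(-p ^ 2), g μ = ∫ y in p..q, (2 * y : ℝ) * g (-y ^ 2) := by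
  have himg : (fun y : ℝ => -y ^ 2) '' Ioo p q = Ioo (-q ^ 2) (-p ^ 2) := by
    ext μ
    constructor
    · rintro ⟨y, hy, rfl⟩
      have h1 := hy.1
      have h2 := hy.2
      constructor <;> simp only <;> nlinarith
    · rintro ⟨h1, h2⟩
      have h3 : 0 ≤ -μ := by nlinarith
      refine ⟨Real.sqrt (-μ), ⟨?_, ?_⟩, ?_⟩
      · exact Real.lt_sqrt_of_sq_lt (by linarith)
      · exact (Real.sqrt_lt' (by nlinarith)).2 (by linarith)
      · simp only [Real.sq_sqrt h3, neg_neg]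
  rw [intervalIntegral.integral_of_le (by nlinarith), intervalIntegral.integral_of_le hpq,
    integral_Ioc_eq_integral_Ioo, integral_Ioc_eq_integral_Ioo, ← himg,
    integral_image_eq_integral_abs_deriv_smul measurableSet_Ioo (f' := fun y => -(2 * y))
      (fun y _ => ?_)]
  · refine setIntegral_congr_fun measurableSet_Ioo fun y hy => ?_
    have : 0 < y := hp.trans_lt hy.1
    rw [abs_neg, abs_of_pos (by positivity), real_smul]
  · intro x hx y hy h
    simp only [neg_inj] at h
    exact (sq_eq_sq₀ (hp.trans hx.1.le) (hp.trans hy.1.le)).1 h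
  · have : HasDerivAt (fun y : ℝ => -y ^ 2) (-(2 * y)) y :=
      (hasDerivAt_pow 2 y).neg.congr_deriv (by norm_num)
    exact this.hasDerivWithinAt

lemma sqrtUp_neg_sq {y : ℝ} (hy : 0 ≤ y) : sqrtUp ((-y ^ 2 : ℝ) : ℂ) = I * y := by
  rw [sqrtUp, ← ofReal_neg, neg_neg, cpow_half_ofReal (sq_nonneg y), Real.sqrt_sq hy]

lemma R_gap (hac : a < c) {y : ℝ} (hy0 : 0 ≤ y) (hy : y < a) :
    R c a ((-y ^ 2 : ℝ) : ℂ) = I * y * (gapW c a y : ℝ) := by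
  rw [R, sqrtUp_neg_sq hy0, w_gap hac (by rwa [abs_of_nonneg hy0])]

lemma R_band (ha : 0 < a) {y : ℝ} (hy : a < y) (hyc : y < c) :
    R c a ((-y ^ 2 : ℝ) : ℂ) = -(y * (bandW c a y : ℝ)) := by
  rw [R, sqrtUp_neg_sq (by linarith), w_band ha hy hyc]
  linear_combination (y : ℂ) * (bandW c a y : ℝ) * I_sq

lemma integral_div_R_gap (hac : a < c) {p : ℝ} (hp : p ∈ Icc 0 a) (F : ℂ → ℂ) :
    ∫ μ in (-a ^ 2)..(-p ^ 2), F μ / R c a μ =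
      -2 * I * ∫ y in p..a, F (-(y : ℂ) ^ 2) * (1 / gapW c a y : ℝ) := by
  rw [integral_comp_neg_sq hp.1 hp.2 (fun μ => F μ / R c a μ), ← intervalIntegral.integral_const_mul]
  refine intervalIntegral.integral_congr_Ioo_of_le hp.2 fun y hy => ?_
  have hy0 : 0 < y := hp.1.trans_lt hy.1
  have hyC : (y : ℂ) ≠ 0 := by exact_mod_cast hy0.ne'
  have hw : (gapW c a y : ℂ) ≠ 0 := by
    exact_mod_cast (gapW_pos hac (by rw [abs_of_pos hy0]; exact hy.2)).ne'
  have hI := I_ne_zero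
  rw [R_gap hac hy0.le hy.2]
  push_cast
  field_simp
  rw [I_sq]; ring

lemma integral_div_R_band (ha : 0 < a) (hac : a < c) (F : ℂ → ℂ) :
    ∫ μ in (-c ^ 2)..(-a ^ 2), F μ / R c a μ =
      -2 * ∫ y in a..c, F (-(y : ℂ) ^ 2) * (1 / bandW c a y : ℝ) := by
  rw [integral_comp_neg_sq ha.le hac.le (fun μ => F μ / R c a μ), ← intervalIntegral.integral_const_mul]
  refine intervalIntegral.integral_congr_Ioo_of_le hac.le fun y hy => ?_
  have hyC : (y : ℂ) ≠ 0 := by exact_mod_cast (ha.trans hy.1).ne'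
  have hw : (bandW c a y : ℂ) ≠ 0 := by exact_mod_cast (bandW_pos ha hy.1 hy.2).ne'
  rw [R_band ha hy.1 hy.2]
  push_cast
  field_simp

lemma aHatPeriod_eq (ha : 0 < a) (hac : a < c) (F : ℂ → ℂ) : aHatPeriod c a F =
    4 * I * ∫ y in (0 : ℝ)..a, F (-(y : ℂ) ^ 2) * (1 / gapW c a y : ℝ) := by
  have h := integral_div_R_gap hac (p := 0) ⟨le_rfl, ha.le⟩ F
  rw [zero_pow two_ne_zero, neg_zero] at h
  have e : ∫ μ in (-a ^ 2)..(0 : ℝ), F μ / (-R c a μ) = -∫ μ in (-a ^ 2)..(0 : ℝ), F μ / R c a μ := by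
    rw [← intervalIntegral.integral_neg]
    simp only [div_neg]
  rw [aHatPeriod, e, intervalIntegral.integral_symm (-a ^ 2) 0, h]
  ring

lemma bHatPeriod_eq (ha : 0 < a) (hac : a < c) (F : ℂ → ℂ) : bHatPeriod c a F =
    4 * ∫ y in a..c, F (-(y : ℂ) ^ 2) * (1 / bandW c a y : ℝ) := by
  have e : ∫ μ in (-c ^ 2)..(-a ^ 2), F μ / (-R c a μ) =
      -∫ μ in (-c ^ 2)..(-a ^ 2), F μ / R c a μ := by
    rw [← intervalIntegral.integral_neg]
    simp only [div_neg]
  rw [bHatPeriod, e, intervalIntegral.integral_symm (-c ^ 2) (-a ^ 2), integral_div_R_band ha hac]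
  ring

lemma aHatPeriod_one (ha : 0 < a) (hac : a < c) :
    aHatPeriod c a (fun _ => 1) = 4 * I * gapInt c a a := by
  rw [aHatPeriod_eq ha hac]
  simp only [one_mul]
  rw [intervalIntegral.integral_ofReal, gapInt]

/-- The Abel map on the gap. -/
lemma abelHat_eq (ha : 0 < a) (hac : a < c) {y : ℝ} (hy : y ∈ Icc 0 a) (p : GapPoint a)
    (hp : p.proj = -y ^ 2) :
    abelHat c a p = -((p.sheet : ℤ) : ℂ) * (2 * Real.pi * I * shiftOf c a y) := by
  have hg : (gapInt c a a : ℂ) ≠ 0 := by exact_mod_cast (gapInt_a_pos ha hac).ne'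
  have hI := I_ne_zero
  have hs : (((p.sheet : ℤ) : ℂ))⁻¹ = ((p.sheet : ℤ) : ℂ) := by
    rcases Int.units_eq_one_or p.sheet with h | h <;> simp [h]
  have h1 := integral_div_R_gap hac hy (fun _ => ((p.sheet : ℤ) : ℂ)⁻¹)
  have h2 : ∫ s in y..a, ((1 / gapW c a s : ℝ) : ℂ) = ((gapInt c a a - gapInt c a y : ℝ) : ℂ) := by
    rw [intervalIntegral.integral_ofReal, gapInt_sub ha hac ⟨by linarith [hy.1], hy.2⟩
      ⟨by linarith, le_rfl⟩]
  rw [intervalIntegral.integral_const_mul, h2, hs] at h1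
  have h3 : ∀ μ : ℝ, 1 / (((p.sheet : ℤ) : ℂ) * R c a μ) = ((p.sheet : ℤ) : ℂ) / R c a μ := by
    intro μ
    rw [← div_div, one_div, hs]
  simp only [abelHat, h3]
  rw [hp, h1, aHatPeriod_one ha hac, shiftOf]
  push_cast
  field_simp
  ring

/-! ### The phase -/

/-- The numerator `(μ + ξ + (c² - a²)/2)(μ + a²)` of the quasi-momentum differential. -/
def phaseNum (c a ξ y : ℝ) : ℝ := (-y ^ 2 + ξ + (c ^ 2 - a ^ 2) / 2) * (a ^ 2 - y ^ 2)

lemma phaseIntegrand_gap (hac : a < c) (ξ : ℝ) {y : ℝ} (hy : |y| < a) :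
    phaseIntegrand c a ξ y = I * (phaseNum c a ξ y * (1 / gapW c a y) : ℝ) := by
  rw [phaseIntegrand, sqrtRatio_gap hac hy, phaseNum, mul_pow, I_sq]
  push_cast; ring

lemma phaseIntegrand_band (ha : 0 < a) (ξ : ℝ) {y : ℝ} (hy : a < y) (hyc : y < c) :
    phaseIntegrand c a ξ y = (phaseNum c a ξ y * (1 / bandW c a y) : ℝ) := by
  rw [phaseIntegrand, sqrtRatio_band ha hy hyc, phaseNum, mul_pow, I_sq]
  push_cast
  linear_combination ((-(y : ℂ) ^ 2 + ξ + (c ^ 2 - a ^ 2) / 2) * ((y ^ 2 - a ^ 2) / bandW c a y)) * I_sq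

lemma integral_phaseNum_gap {ξ : ℝ} (h : IsWhithamParameter c ξ a) :
    ∫ y in (0 : ℝ)..a, phaseNum c a ξ y * (1 / gapW c a y) = 0 := by
  obtain ⟨ha, hac, h⟩ := h
  have e : ∫ y in (0 : ℝ)..a, phaseIntegrand c a ξ y =
      ∫ y in (0 : ℝ)..a, I * ((phaseNum c a ξ y * (1 / gapW c a y) : ℝ) : ℂ) := by
    refine intervalIntegral.integral_congr_Ioo_of_le ha.le fun y hy => ?_
    exact phaseIntegrand_gap hac ξ (abs_lt.2 ⟨by linarith [hy.1], hy.2⟩)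
  rw [e, intervalIntegral.integral_const_mul, intervalIntegral.integral_ofReal] at h
  exact_mod_cast (mul_eq_zero.1 h).resolve_left I_ne_zero

lemma phaseB_eq (ha : 0 < a) (hac : a < c) (ξ : ℝ) : phaseB c a ξ =
    (24 * ∫ y in a..c, phaseNum c a ξ y * (1 / bandW c a y) : ℝ) := by
  have e : ∫ y in a..c, phaseIntegrand c a ξ y =
      ∫ y in a..c, ((phaseNum c a ξ y * (1 / bandW c a y) : ℝ) : ℂ) := by
    refine intervalIntegral.integral_congr_Ioo_of_le hac.le fun y hy => ?_
    exact phaseIntegrand_band ha ξ hy.1 hy.2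
  rw [phaseB, gPlus, intervalIntegral.integral_symm, e, intervalIntegral.integral_ofReal]
  push_cast; ring

lemma continuous_omegaOne (c a : ℝ) : Continuous (omegaOne c a) := by
  unfold omegaOne; fun_prop

lemma continuous_omegaThree (c a : ℝ) : Continuous (omegaThree c a) := by
  unfold omegaThree; fun_prop

lemma intervalIntegrable_mul_bandW (ha : 0 < a) (hac : a < c) {F : ℂ → ℂ} (hF : Continuous F) :
    IntervalIntegrable (fun y : ℝ => F (-(y : ℂ) ^ 2) * (1 / bandW c a y : ℝ)) volume a c := by
  have h := intervalIntegrable_bandW ha hac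
  have h' : IntervalIntegrable (fun y => ((1 / bandW c a y : ℝ) : ℂ)) volume a c :=
    ⟨h.1.ofReal, h.2.ofReal⟩
  exact h'.continuousOn_mul (by fun_prop)

lemma intervalIntegrable_pow_mul_gapW (ha : 0 < a) (hac : a < c) (n : ℕ) :
    IntervalIntegrable (fun y : ℝ => y ^ n * (1 / gapW c a y)) volume 0 a :=
  (intervalIntegrable_gapW_of_mem ha hac ⟨by linarith, ha.le⟩ ⟨by linarith, le_rfl⟩).continuousOn_mul
    (by fun_prop)

/-- Since `x = 12tξ`, both sides are `6it` times a monic quadratic in `λ = -y²` with linear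
coefficient `ξ + (a² + c²)/2`. The constant terms agree because each side has vanishing `â`-period:
on the left by normalization, on the right by the Whitham equation. -/
lemma omega_combination {x t : ℝ} (ht : 0 < t) (h : IsWhithamParameter c (x / (12 * t)) a) (y : ℝ) :
    x * omegaOne c a (-(y : ℂ) ^ 2) - 4 * t * omegaThree c a (-(y : ℂ) ^ 2) =
      6 * I * t * (phaseNum c a (x / (12 * t)) y : ℝ) := by
  have hW := integral_phaseNum_gap h
  obtain ⟨ha, hac, -⟩ := h
  have hg := (gapInt_a_pos ha hac).ne'
  have hgC : (gapInt c a a : ℂ) ≠ 0 := by exact_mod_cast hg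
  have hI := I_ne_zero
  set ξ := x / (12 * t) with hξ
  have hx : x = 12 * t * ξ := by rw [hξ]; field_simp
  set J₁ := ∫ y in (0 : ℝ)..a, y ^ 2 * (1 / gapW c a y) with hJ₁
  set J₂ := ∫ y in (0 : ℝ)..a, y ^ 4 * (1 / gapW c a y) with hJ₂
  have i0 := intervalIntegrable_gapW_of_mem ha hac (y := 0) (z := a)
    ⟨by linarith, ha.le⟩ ⟨by linarith, le_rfl⟩
  have i2 := intervalIntegrable_pow_mul_gapW ha hac 2
  have i4 := intervalIntegrable_pow_mul_gapW ha hac 4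
  have hW' : J₂ - ((a ^ 2 + c ^ 2) / 2 + ξ) * J₁ +
      a ^ 2 * (ξ + (c ^ 2 - a ^ 2) / 2) * gapInt c a a = 0 := by
    rw [← hW, hJ₁, hJ₂, gapInt, ← intervalIntegral.integral_const_mul,
      ← intervalIntegral.integral_const_mul, ← intervalIntegral.integral_sub i4 (i2.const_mul _),
      ← intervalIntegral.integral_add (i4.sub (i2.const_mul _)) (i0.const_mul _)]
    refine intervalIntegral.integral_congr fun y _ => ?_
    simp only [phaseNum]
    ring
  have a1 : aHatPeriod c a (fun s => s) = 4 * I * (-J₁ : ℝ) := by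
    rw [aHatPeriod_eq ha hac, hJ₁, ← intervalIntegral.integral_neg, ← intervalIntegral.integral_ofReal]
    congr 1
    refine intervalIntegral.integral_congr fun y _ => ?_
    push_cast; ring
  have a2 : aHatPeriod c a (fun s => s ^ 2 + ((a : ℂ) ^ 2 + (c : ℂ) ^ 2) / 2 * s) =
      4 * I * (J₂ - (a ^ 2 + c ^ 2) / 2 * J₁ : ℝ) := by
    have e : J₂ - (a ^ 2 + c ^ 2) / 2 * J₁ = ∫ y in (0 : ℝ)..a,
        (y ^ 4 * (1 / gapW c a y) - (a ^ 2 + c ^ 2) / 2 * (y ^ 2 * (1 / gapW c a y))) := by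
      rw [intervalIntegral.integral_sub i4 (i2.const_mul _), intervalIntegral.integral_const_mul]
    rw [aHatPeriod_eq ha hac, e, ← intervalIntegral.integral_ofReal]
    congr 1
    refine intervalIntegral.integral_congr fun y _ => ?_
    push_cast; ring
  have hWC : (J₂ : ℂ) - ((a ^ 2 + c ^ 2) / 2 + ξ) * J₁ +
      a ^ 2 * (ξ + (c ^ 2 - a ^ 2) / 2) * gapInt c a a = 0 := by exact_mod_cast hW'
  have q1 : aHatPeriod c a (fun s => s) / aHatPeriod c a (fun _ => 1) = -J₁ / gapInt c a a := by
    rw [a1, aHatPeriod_one ha hac]; push_cast; field_simp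
  have q2 : aHatPeriod c a (fun s => s ^ 2 + ((a : ℂ) ^ 2 + (c : ℂ) ^ 2) / 2 * s) /
      aHatPeriod c a (fun _ => 1) = (J₂ - (a ^ 2 + c ^ 2) / 2 * J₁) / gapInt c a a := by
    rw [a2, aHatPeriod_one ha hac]; push_cast; field_simp
  rw [omegaOne, omegaThree, q1, q2, phaseNum, hx]
  push_cast
  field_simp
  linear_combination (-24 * t : ℂ) * hWC

/-- Integration of `omega_combination` over the band: the `b̂`-period contributes the factor 4, so
`4 · 6it / i = 24t`, the factor in `tB`. -/
lemma wave_phase {x t : ℝ} (ht : 0 < t) (h : IsWhithamParameter c (x / (12 * t)) a) :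
    V c a * x - 4 * W c a * t = t * phaseB c a (x / (12 * t)) := by
  have ha := h.1
  have hac := h.2.1
  have hI := I_ne_zero
  have i1 := intervalIntegrable_mul_bandW ha hac (continuous_omegaOne c a)
  have i3 := intervalIntegrable_mul_bandW ha hac (continuous_omegaThree c a)
  have e : x * (∫ y in a..c, omegaOne c a (-(y : ℂ) ^ 2) * (1 / bandW c a y : ℝ)) -
      4 * t * (∫ y in a..c, omegaThree c a (-(y : ℂ) ^ 2) * (1 / bandW c a y : ℝ)) =
      6 * I * t * ∫ y in a..c, ((phaseNum c a (x / (12 * t)) y * (1 / bandW c a y) : ℝ) : ℂ) := by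
    rw [← intervalIntegral.integral_const_mul, ← intervalIntegral.integral_const_mul,
      ← intervalIntegral.integral_const_mul,
      ← intervalIntegral.integral_sub (i1.const_mul _) (i3.const_mul _)]
    refine intervalIntegral.integral_congr fun y _ => ?_
    have := omega_combination ht h y
    rw [ofReal_mul]
    linear_combination ((1 / bandW c a y : ℝ) : ℂ) * this
  rw [intervalIntegral.integral_ofReal] at e
  rw [V, W, bHatPeriod_eq ha hac, bHatPeriod_eq ha hac, phaseB_eq ha hac, ofReal_mul]
  generalize (∫ y in a..c, omegaOne c a (-(y : ℂ) ^ 2) * (1 / bandW c a y : ℝ)) = X at *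
  generalize (∫ y in a..c, omegaThree c a (-(y : ℂ) ^ 2) * (1 / bandW c a y : ℝ)) = Y at *
  generalize (∫ y in a..c, phaseNum c a (x / (12 * t)) y * (1 / bandW c a y)) = N at *
  push_cast
  field_simp
  linear_combination 4 * e
end

/-! ### Jacobi inversion on the gap -/

section
variable {c a : ℝ}

lemma exists_shiftOf_eq (ha : 0 < a) (hac : a < c) {s : ℝ} (hs : s ∈ Icc (0 : ℝ) (1 / 2)) :
    ∃ y ∈ Icc 0 a, shiftOf c a y = s := by
  have := intermediate_value_Icc' ha.le (continuousOn_shiftOf ha hac)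
  rw [shiftOf_zero, shiftOf_self ha hac] at this
  exact this hs

/-- Modulo 1 any real `s` is represented in `[-1/2, 1/2]`. The absolute value is attained by
`shiftOf` on the gap, and the sign selects the sheet. -/
lemma exists_abelHat_eq (ha : 0 < a) (hac : a < c) (s : ℝ) :
    ∃ p : GapPoint a, EqModPeriod (abelHat c a p) (-I * (2 * Real.pi * s)) := by
  obtain ⟨y, hy, hys⟩ := exists_shiftOf_eq ha hac ⟨abs_nonneg (s - round s), abs_sub_round s⟩
  have hmem : -y ^ 2 ∈ Icc (-a ^ 2) 0 := ⟨by nlinarith [hy.1, hy.2], by nlinarith⟩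
  rcases abs_choice (s - round s) with h | h
  · refine ⟨⟨-y ^ 2, 1, hmem⟩, round s, ?_⟩
    rw [abelHat_eq ha hac hy _ rfl, hys, h]
    push_cast; ring
  · refine ⟨⟨-y ^ 2, -1, hmem⟩, round s, ?_⟩
    rw [abelHat_eq ha hac hy _ rfl, hys, h]
    push_cast; ring

lemma exists_shiftOf_of_abelHat (ha : 0 < a) (hac : a < c) {s : ℝ} {p : GapPoint a}
    (h : EqModPeriod (abelHat c a p) (-I * (2 * Real.pi * s))) :
    ∃ y ∈ Icc 0 a, p.proj = -y ^ 2 ∧ ∃ n : ℤ, s = shiftOf c a y + n ∨ s = -shiftOf c a y + n := by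
  obtain ⟨n, hn⟩ := h
  have hp := p.mem
  have h0 : 0 ≤ -p.proj := by linarith [hp.2]
  have hy : Real.sqrt (-p.proj) ∈ Icc 0 a :=
    ⟨Real.sqrt_nonneg _, (Real.sqrt_le_left ha.le).2 (by linarith [hp.1])⟩
  have hproj : p.proj = -Real.sqrt (-p.proj) ^ 2 := by rw [Real.sq_sqrt h0, neg_neg]
  refine ⟨_, hy, hproj, n, ?_⟩
  rw [abelHat_eq ha hac hy p hproj] at hn
  have hpi : (2 * Real.pi * I : ℂ) ≠ 0 := two_pi_I_ne_zero
  have key : ((p.sheet : ℤ) : ℂ) * shiftOf c a (Real.sqrt (-p.proj)) = s - n := by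
    refine mul_left_cancel₀ hpi ?_
    linear_combination -hn
  rcases Int.units_eq_one_or p.sheet with h | h
  · left
    rw [h] at key
    have : (s : ℂ) = shiftOf c a (Real.sqrt (-p.proj)) + n := by
      push_cast at key
      linear_combination -key
    exact_mod_cast this
  · right
    rw [h] at key
    have : (s : ℂ) = -shiftOf c a (Real.sqrt (-p.proj)) + n := by
      push_cast at key
      linear_combination -key
    exact_mod_cast this

/-! ### The Dirichlet point, its uniqueness and the trace formula -/

/-- `Λ/(2π)` as a real number. -/
def realShift (c a x t Δ : ℝ) : ℝ :=
  (t * (24 * ∫ y in a..c, phaseNum c a (x / (12 * t)) y * (1 / bandW c a y)) + Δ) / (2 * Real.pi)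

lemma bigLambda_eq (ha : 0 < a) (hac : a < c) (x t Δ : ℝ) :
    bigLambda c a x t Δ = 2 * Real.pi * realShift c a x t Δ := by
  have hpi : (Real.pi : ℂ) ≠ 0 := by exact_mod_cast Real.pi_ne_zero
  rw [bigLambda, phaseB_eq ha hac, realShift]
  push_cast
  field_simp

lemma bigLambda_div (ha : 0 < a) (hac : a < c) (x t Δ : ℝ) :
    bigLambda c a x t Δ / (2 * Real.pi) = realShift c a x t Δ := by
  have hpi : (Real.pi : ℂ) ≠ 0 := by exact_mod_cast Real.pi_ne_zero
  rw [bigLambda_eq ha hac]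
  field_simp

/-- The initial divisor is found by inverting the Abel map at `Δ`, and the moving point by inverting
it at the total phase `Λ = Δ + Vx - 4Wt`. -/
lemma exists_isDirichletPoint {x t : ℝ} (Δ : ℝ) (ht : 0 < t)
    (h : IsWhithamParameter c (x / (12 * t)) a) : ∃ lam, IsDirichletPoint c a x t Δ lam := by
  have ha := h.1
  have hac := h.2.1
  obtain ⟨p₀, hp₀⟩ := exists_abelHat_eq ha hac (Δ / (2 * Real.pi))
  obtain ⟨p, n, hn⟩ := exists_abelHat_eq ha hac (realShift c a x t Δ)
  have e : (2 * Real.pi * (Δ / (2 * Real.pi) : ℝ) : ℂ) = Δ := by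
    have hpi : (Real.pi : ℂ) ≠ 0 := by exact_mod_cast Real.pi_ne_zero
    push_cast
    field_simp
  rw [e] at hp₀
  refine ⟨p.proj, p₀, p, hp₀, ?_, rfl⟩
  obtain ⟨n₀, hn₀⟩ := hp₀
  refine ⟨n - n₀, ?_⟩
  rw [← bigLambda_eq ha hac, bigLambda] at hn
  rw [wave_phase ht h, hn, hn₀]
  push_cast; ring

lemma IsDirichletPoint.exists_shiftOf {x t Δ lam : ℝ} (ht : 0 < t)
    (h : IsWhithamParameter c (x / (12 * t)) a) (hd : IsDirichletPoint c a x t Δ lam) :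
    ∃ y ∈ Icc 0 a, lam = -y ^ 2 ∧ ∃ n : ℤ, realShift c a x t Δ = shiftOf c a y + n ∨
      realShift c a x t Δ = -shiftOf c a y + n := by
  have ha := h.1
  have hac := h.2.1
  obtain ⟨p₀, p, ⟨n₀, hn₀⟩, ⟨n, hn⟩, rfl⟩ := hd
  refine exists_shiftOf_of_abelHat ha hac ⟨n₀ + n, ?_⟩
  rw [← bigLambda_eq ha hac, bigLambda]
  rw [wave_phase ht h] at hn
  push_cast
  linear_combination hn + hn₀

/-- The Dirichlet point is the zero of the product of the components. -/
lemma IsDirichletPoint.modelSol_eq {x t Δ lam : ℝ} (ht : 0 < t)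
    (h : IsWhithamParameter c (x / (12 * t)) a) (hd : IsDirichletPoint c a x t Δ lam) :
    ∀ k ∈ cutPlane c, modelSol c a (realShift c a x t Δ) k 0 *
      modelSol c a (realShift c a x t Δ) k 1 * w c a k = k ^ 2 - lam := by
  obtain ⟨y, hy, hlam, hv⟩ := hd.exists_shiftOf ht h
  obtain ⟨μ, hμ⟩ := exists_modelSol_zero h.1 h.2.1 (realShift c a x t Δ)
  have h1 := modelSol_zero_eq h.1 h.2.1 hμ hy hv
  have h2 : (lam : ℂ) = μ := by rw [h1, hlam]; push_cast; rfl
  rw [h2]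
  exact hμ

/-- Two candidates would give the same product of components of the explicit solution; its value at
the single point `k = 1` already determines `λ`. -/
lemma IsDirichletPoint.unique {x t Δ lam lam' : ℝ} (ht : 0 < t)
    (h : IsWhithamParameter c (x / (12 * t)) a) (hd : IsDirichletPoint c a x t Δ lam)
    (hd' : IsDirichletPoint c a x t Δ lam') : lam = lam' := by
  have hk : (1 : ℂ) ∈ cutPlane c := mem_cutPlane_of_re_ne_zero (by simp)
  have := (hd.modelSol_eq ht h 1 hk).symm.trans (hd'.modelSol_eq ht h 1 hk)
  exact_mod_cast sub_right_injective this

/-- The trace formula. -/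
lemma qMod_eq {x t Δ lam : ℝ} (ht : 0 < t)
    (h : IsWhithamParameter c (x / (12 * t)) a) (hd : IsDirichletPoint c a x t Δ lam) :
    qMod c a x t Δ = -(c : ℂ) ^ 2 - (a : ℂ) ^ 2 - 2 * lam := by
  have ha := h.1
  have hac := h.2.1
  have hc := ha.trans hac
  have hg := gapInt_a_pos ha hac
  have hgC : (gapInt c a a : ℂ) ≠ 0 := by exact_mod_cast hg.ne'
  have h1 := modelSol_zero_eq_thetaLogTwo ha hac (hd.modelSol_eq ht h)
  have hder := iteratedDeriv_log_theta (period_im_pos ha hac)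
    (jacobiTheta₂_pos (div_pos (bandInt_c_pos ha hac) hg)) (realShift c a x t Δ)
  have hQ : ((∫ y in (0 : ℝ)..a, y ^ 2 * (1 / gapW c a y)) / gapInt c a a : ℝ) =
      c ^ 2 - c ^ 2 * (ellipticE (a / c) / ellipticK (a / c)) := by
    rw [integral_sq_div_gapW ha hac, ellipticK_eq ha hac]
    field_simp
  rw [hQ] at h1
  rw [qMod, two_mul_tau ha hac, bigLambda_div ha hac, hder, Gam_eq ha hac, constQ, h1, div_pow, I_sq]
  push_cast
  field_simp
  ring

/-! ### Asymptotics of the product -/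

/-- The remainder is `X²` times the second divided difference, which is continuous at 0. It is
applied with `X = k⁻²`, so that the error becomes `k⁻⁴`. -/
lemma isBigO_sub_linear {f : ℂ → ℂ} {f' : ℂ} (hf : AnalyticAt ℂ f 0) (hd : HasDerivAt f f' 0) :
    (fun X => f X - (f 0 + f' * X)) =O[𝓝 0] fun X => X ^ 2 := by
  obtain ⟨p, hp⟩ := hf
  have h1 := hp.has_fpower_series_dslope_fslope
  have h2 := h1.has_fpower_series_dslope_fslope
  have hc : ContinuousAt (dslope (dslope f 0) 0) 0 := h2.analyticAt.continuousAt
  have e : ∀ X, f X - (f 0 + f' * X) = X ^ 2 * dslope (dslope f 0) 0 X := by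
    intro X
    have e1 := sub_smul_dslope f 0 X
    have e2 := sub_smul_dslope (dslope f 0) 0 X
    rw [smul_eq_mul, sub_zero] at e1 e2
    rw [dslope_same, hd.deriv] at e2
    linear_combination -e1 - X * e2
  simp only [e]
  simpa using (isBigO_refl (fun X : ℂ => X ^ 2) (𝓝 0)).mul (hc.tendsto.isBigO_one ℂ)

/-- `(k² - λ)/w(k)` as a function of `X = k⁻²`. -/
def productProfile (c a : ℝ) (lam X : ℂ) : ℂ :=
  (1 - lam * X) / ((1 + (c : ℂ) ^ 2 * X) *
    ((1 + (a : ℂ) ^ 2 * X) / (1 + (c : ℂ) ^ 2 * X)) ^ (1 / 2 : ℂ))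

lemma productProfile_inv_sq (c a : ℝ) (lam : ℂ) {k : ℂ} (hk : k ≠ 0) :
    productProfile c a lam (k ^ 2)⁻¹ = (k ^ 2 - lam) / w c a k := by
  rw [productProfile, ← sqrtRatio_eq_of_ne_zero c a hk, w]
  have e1 : 1 - lam * (k ^ 2)⁻¹ = (k ^ 2)⁻¹ * (k ^ 2 - lam) := by field_simp
  have e2 : 1 + (c : ℂ) ^ 2 * (k ^ 2)⁻¹ = (k ^ 2)⁻¹ * (k ^ 2 + (c : ℂ) ^ 2) := by field_simp
  rw [e1, e2, mul_assoc, mul_div_mul_left _ _ (inv_ne_zero (pow_ne_zero 2 hk))]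

lemma productProfile_zero (c a : ℝ) (lam : ℂ) : productProfile c a lam 0 = 1 := by
  simp [productProfile]

lemma analyticAt_productProfile (c a : ℝ) (lam : ℂ) : AnalyticAt ℂ (productProfile c a lam) 0 := by
  have h1 : AnalyticAt ℂ (fun X : ℂ => 1 + (a : ℂ) ^ 2 * X) 0 := by fun_prop
  have h2 : AnalyticAt ℂ (fun X : ℂ => 1 + (c : ℂ) ^ 2 * X) 0 := by fun_prop
  have h3 : AnalyticAt ℂ (fun X : ℂ => 1 - lam * X) 0 := by fun_prop
  have h4 : AnalyticAt ℂ (fun X : ℂ =>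
      ((1 + (a : ℂ) ^ 2 * X) / (1 + (c : ℂ) ^ 2 * X)) ^ (1 / 2 : ℂ)) 0 :=
    (h1.div h2 (by simp)).cpow analyticAt_const (by simp)
  exact h3.div (h2.mul h4) (by simp)

lemma hasDerivAt_productProfile (c a : ℝ) (lam : ℂ) :
    HasDerivAt (productProfile c a lam) (-lam - ((a : ℂ) ^ 2 + (c : ℂ) ^ 2) / 2) 0 := by
  have hlin : ∀ b : ℂ, HasDerivAt (fun X : ℂ => 1 + b * X) b 0 := fun b => by
    simpa using ((hasDerivAt_id (0 : ℂ)).const_mul b).const_add 1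
  have h3 : HasDerivAt (fun X : ℂ => 1 - lam * X) (-lam) 0 := by
    simpa using ((hasDerivAt_id (0 : ℂ)).const_mul lam).const_sub 1
  have h1 := (hlin ((a : ℂ) ^ 2)).div (hlin ((c : ℂ) ^ 2)) (by simp)
  have h2 := h1.cpow_const (c := (1 / 2 : ℂ)) (Or.inl (by simp))
  have h4 := h3.div ((hlin ((c : ℂ) ^ 2)).mul h2) (by simp)
  refine h4.congr_deriv ?_
  simp
  ring

lemma isBigO_product (c a : ℝ) (lam : ℂ) :
    (fun k : ℂ => (k ^ 2 - lam) / w c a k -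
      (1 + (-(c : ℂ) ^ 2 - (a : ℂ) ^ 2 - 2 * lam) / (2 * k ^ 2)))
      =O[Bornology.cobounded ℂ] fun k : ℂ => (k ^ 4)⁻¹ := by
  have h := (isBigO_sub_linear (analyticAt_productProfile c a lam)
    (hasDerivAt_productProfile c a lam)).comp_tendsto tendsto_inv_sq_cobounded
  refine h.congr' ?_ (.of_forall fun k => ?_)
  · filter_upwards [eventually_ne_zero_cobounded] with k hk
    simp only [Function.comp]
    rw [productProfile_inv_sq c a lam hk, productProfile_zero]
    field_simp
    ring
  · simp only [Function.comp]
    rw [← inv_pow, ← pow_mul, inv_pow]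
end

end

end KdVShock

theorem lemma4p5 (c a x t Δ : ℝ) (hc : 0 < c) (ht : 0 < t)
    (hξ : x / (12 * t) ∈ Ioo (-(c ^ 2) / 2) (c ^ 2 / 3))
    (ha : IsWhithamParameter c (x / (12 * t)) a) :
    (∃ m : ℂ → Fin 2 → ℂ, IsModelSolution c a (bigLambda c a x t Δ) m) ∧
    (∃! lam : ℝ, IsDirichletPoint c a x t Δ lam) ∧
    ∀ lam : ℝ, IsDirichletPoint c a x t Δ lam →
      (∀ m : ℂ → Fin 2 → ℂ, IsModelSolution c a (bigLambda c a x t Δ) m →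
        (∀ k ∈ cutPlane c, m k 0 * m k 1 = (k ^ 2 - lam) / w c a k) ∧
        (fun k : ℂ => m k 0 * m k 1 - (1 + qMod c a x t Δ / (2 * k ^ 2)))
          =O[Bornology.cobounded ℂ] fun k : ℂ => (k ^ 4)⁻¹) ∧
      qMod c a x t Δ = -(c : ℂ) ^ 2 - (a : ℂ) ^ 2 - 2 * lam := by
  have ha0 := ha.1
  have hac := ha.2.1
  have hsol := isModelSolution_modelSol ha0 hac (realShift c a x t Δ)
  rw [← bigLambda_eq ha0 hac] at hsol
  refine ⟨⟨_, hsol⟩, ?_, fun lam hlam => ⟨fun m hm => ?_, qMod_eq ht ha hlam⟩⟩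
  · obtain ⟨lam, hlam⟩ := exists_isDirichletPoint Δ ht ha
    exact ⟨lam, hlam, fun lam' hlam' => hlam'.unique ht ha hlam⟩
  · obtain ⟨μ, hμ⟩ := exists_mul_mul_w_eq ha0 hac hm hm
    -- The zero does not depend on the solution, so it can be taken from the theta-function
    -- solution, where it is the Dirichlet point.
    have hμlam : μ = lam := zero_unique ha0 hac hm hsol hμ (hlam.modelSol_eq ht ha)
    have hprod : ∀ k ∈ cutPlane c, m k 0 * m k 1 = (k ^ 2 - lam) / w c a k := by
      intro k hk
      rw [eq_div_iff (w_ne_zero ha0 hac hk), hμ k hk, hμlam]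
    refine ⟨hprod, ?_⟩
    rw [qMod_eq ht ha hlam]
    refine (isBigO_product c a lam).congr' ?_ .rfl
    filter_upwards [cutPlane_mem_cobounded c] with k hk
    rw [hprod k hk]
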